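/- **Setting.** A depth-$d$ IQP circuit $C$ of $k$-local diagonal gates on $n$ qubits consists of $d$ layers. Each layer is a finite list of diagonal unitary gates acting on pairwise disjoint sets of qubits, each set having at least one and at most $k$ elements. The noisy circuit $\tilde C$ is obtained by applying, after each layer, the same Pauli noise channel $$\mathcal N(\rho)=p_I\rho+p_X X\rho X+p_Y Y\rho Y+p_Z Z\rho Z,\qquad p_X,p_Y,p_Z\ge 0,\quad p_I=1-p_X-p_Y-p_Z\ge \tfrac12,$$ to every qubit. Let $\Phi_{\tilde C}$ be the resulting channel, and let $$P_{\tilde C}(b)=\operatorname{tr}\left[H^{\dagger\otimes n}|b\rangle\langle b|H^{\otimes n}\,\Phi_{\tilde C}\big(|+\rangle\langle +|^{\otimes n}\big)\right],\qquad b\in\{0,1\}^n,$$ be its output distribution. Put $p=p_Z+\min(p_X,p_Y)$. **Model of computation.** Algorithms are finite random-access programs with fair coin flips as their only source of randomness. The description of $\tilde C$ (the numbers $n$, $d$, $p_X,p_Y,p_Z$, the lists of gates with the qubits on which they act, and the real and imaginary parts of their diagonal entries) is available as read-only input. Every operation on natural numbers (addition, truncated subtraction, halving, comparison), memory access, input access,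 coin flip and control step costs $1$. Every operation on real numbers (exact addition, subtraction, multiplication, division, comparison, reading and writing) costs $n^2$. The running time $T$ is the total cost until the program halts. **Theorem.** There are universal constants $A,B$, a depth threshold $d_c=d_c(p,k)\in\mathbb N$ with $$d_c(p,k)\le A\,p^{-1}\log(kp^{-1})\qquad\text{for all } 0<p\le\tfrac12,\ k\ge1,$$ and a single program with the following property. For all $n,k\ge 1$ and $d\ge 0$, all $C$ as above and all noise parameters as above with $p>0$ and $d\ge d_c(p,k)$, the program on the input $\tilde C$ outputs each $b\in\{0,1\}^n$ with probability exactly $P_{\tilde C}(b)$, and its expected running time satisfies $$\mathbf E[T]\le B\,d\,n^5 .$$ -/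

import Mathlib

open scoped ENNReal

noncomputable section

namespace NoisyIQP

/-! ## Noisy IQP circuits -/

/-- Bit strings of length `n`; they index the computational basis of `n` qubits. -/
abbrev Bits (n : ℕ) : Type := Fin n → Fin 2

/-- Operators (in particular density matrices) on `n` qubits, in the computational basis. -/
abbrev Op (n : ℕ) : Type := Matrix (Bits n) (Bits n) ℂ

/-- A single-qubit operator acting on qubit `v` (identity on every other qubit). -/
def onQubit {n : ℕ} (v : Fin n) (A : Matrix (Fin 2) (Fin 2) ℂ) : Op n :=
  Matrix.of fun x y => if ∀ w, w ≠ v → x w = y w then A (x v) (y v) else 0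

/-- The tensor power `A ⊗ ⋯ ⊗ A` (`n` factors). -/
def tensorPower (n : ℕ) (A : Matrix (Fin 2) (Fin 2) ℂ) : Op n :=
  Matrix.of fun x y => ∏ v, A (x v) (y v)

def pauliX : Matrix (Fin 2) (Fin 2) ℂ := !![0, 1; 1, 0]

def pauliY : Matrix (Fin 2) (Fin 2) ℂ := !![0, -Complex.I; Complex.I, 0]

def pauliZ : Matrix (Fin 2) (Fin 2) ℂ := !![1, 0; 0, -1]

def hadamard : Matrix (Fin 2) (Fin 2) ℂ :=
  ((Real.sqrt 2 : ℝ) : ℂ)⁻¹ • !![1, 1; 1, -1]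

/-- The projector on `|+⟩ = (|0⟩ + |1⟩) / √2`. -/
def ketbraPlus : Matrix (Fin 2) (Fin 2) ℂ := !![1 / 2, 1 / 2; 1 / 2, 1 / 2]

/-- A diagonal gate on `arity ≥ 1` distinct qubits of an `n`-qubit system, given by the list of
qubits on which it acts and by the diagonal entries of its unitary matrix. -/
structure DiagGate (n : ℕ) where
  arity : ℕ
  arity_pos : 0 < arity
  qubit : Fin arity ↪ Fin n
  diag : Bits arity → ℂ
  norm_diag : ∀ x, ‖diag x‖ = 1

/-- The unitary matrix of the gate on the whole `n`-qubit system. -/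
def DiagGate.unitary {n : ℕ} (g : DiagGate n) : Op n :=
  Matrix.diagonal fun x => g.diag fun i => x (g.qubit i)

/-- The unitary channel `ρ ↦ D ρ D†` of a diagonal gate. -/
def DiagGate.channel {n : ℕ} (g : DiagGate n) (ρ : Op n) : Op n :=
  g.unitary * ρ * g.unitary.conjTranspose

/-- An IQP circuit on `n` qubits, of depth `d`, built from `k`-local diagonal gates: `d` layers,
in each of which the gates act on pairwise disjoint sets of at most `k` qubits. The Hadamard
gates are part of the preparation of the initial state and of the measurement. -/
structure Circuit (n d k : ℕ) where
  layer : Fin d → List (DiagGate n)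
  disjoint : ∀ t, (layer t).Pairwise fun g h => Disjoint (Set.range g.qubit) (Set.range h.qubit)
  isLocal : ∀ t, ∀ g ∈ layer t, g.arity ≤ k

/-- The parameters of a single-qubit Pauli noise channel; the remaining weight
`pI = 1 - pX - pY - pZ` is at least `1 / 2`. -/
structure PauliNoise where
  pX : ℝ
  pY : ℝ
  pZ : ℝ
  pX_nonneg : 0 ≤ pX
  pY_nonneg : 0 ≤ pY
  pZ_nonneg : 0 ≤ pZ
  half_le_pI : 1 / 2 ≤ 1 - pX - pY - pZ

/-- `p = pZ + min (pX, pY)`. -/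
def PauliNoise.p (N : PauliNoise) : ℝ := N.pZ + min N.pX N.pY

/-- The channel `ρ ↦ pI ρ + pX X ρ X + pY Y ρ Y + pZ Z ρ Z` on qubit `v`. -/
def PauliNoise.channel (N : PauliNoise) {n : ℕ} (v : Fin n) (ρ : Op n) : Op n :=
  ((1 - N.pX - N.pY - N.pZ : ℝ) : ℂ) • ρ
    + (N.pX : ℂ) • (onQubit v pauliX * ρ * onQubit v pauliX)
    + (N.pY : ℂ) • (onQubit v pauliY * ρ * onQubit v pauliY)
    + (N.pZ : ℂ) • (onQubit v pauliZ * ρ * onQubit v pauliZ)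

/-- The gates of layer `t`, followed by the noise channel on every qubit. -/
def noisyLayer {n d k : ℕ} (C : Circuit n d k) (N : PauliNoise) (t : Fin d) (ρ : Op n) : Op n :=
  (List.finRange n).foldl (fun σ v => N.channel v σ)
    ((C.layer t).foldl (fun σ g => g.channel σ) ρ)

/-- The channel of the whole noisy circuit. -/
def noisyChannel {n d k : ℕ} (C : Circuit n d k) (N : PauliNoise) (ρ : Op n) : Op n :=
  (List.finRange d).foldl (fun σ t => noisyLayer C N t σ) ρ

/-- The probability of the outcome `b` when the noisy circuit is applied to `|+⟩⟨+|^{⊗ n}` and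
every qubit is then measured in the Hadamard basis. -/
def outputProb {n d k : ℕ} (C : Circuit n d k) (N : PauliNoise) (b : Bits n) : ℝ :=
  (Matrix.trace ((tensorPower n hadamard).conjTranspose * Matrix.single b b 1
    * tensorPower n hadamard * noisyChannel C N (tensorPower n ketbraPlus))).re

/-! ## Randomized random-access programs with real arithmetic

The memory consists of arrays of natural numbers and arrays of real numbers. A program is a finite
syntax tree. The description of the noisy circuit is read-only. The only randomness is that of fair
coins. -/

/-- The contents of the memory: `nat a i` and `real a i` are the cells with index `i` of the `a`-th
array of natural numbers and of the `a`-th array of real numbers. -/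
structure Mem where
  nat : ℕ → ℕ → ℕ
  real : ℕ → ℕ → ℝ

/-- The initial memory. -/
def Mem.zero : Mem := ⟨fun _ _ => 0, fun _ _ => 0⟩

def Mem.setNat (m : Mem) (a i x : ℕ) : Mem :=
  { m with nat := Function.update m.nat a (Function.update (m.nat a) i x) }

def Mem.setReal (m : Mem) (a i : ℕ) (x : ℝ) : Mem :=
  { m with real := Function.update m.real a (Function.update (m.real a) i x) }

/-- Expressions for natural numbers. -/
inductive NExp : Type
  /-- a constant -/
  | const (c : ℕ)
  /-- the cell with index `i` of the array `a` -/
  | get (a : ℕ) (i : NExp)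
  | plus (e f : NExp)
  /-- truncated subtraction -/
  | minus (e f : NExp)
  /-- the integer part of one half (right shift) -/
  | half (e : NExp)
  /-- input: the number of qubits -/
  | numQubits
  /-- input: the depth -/
  | depth
  /-- input: the number of gates in layer `t` -/
  | gateCount (t : NExp)
  /-- input: the number of qubits on which gate `j` of layer `t` acts -/
  | gateArity (t j : NExp)
  /-- input: the `i`-th qubit on which gate `j` of layer `t` acts -/
  | gateQubit (t j i : NExp)

/-- Expressions for real numbers. -/
inductive RExp : Type
  /-- a natural number as a constant -/
  | const (c : ℕ)
  /-- the cell with index `i` of the array `a` -/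
  | get (a : ℕ) (i : NExp)
  | plus (e f : RExp)
  | minus (e f : RExp)
  | times (e f : RExp)
  | quot (e f : RExp)
  /-- input: the parameters of the noise -/
  | noiseX
  | noiseY
  | noiseZ
  /-- input: the real part of the diagonal entry with number `x` of gate `j` of layer `t` -/
  | gateRe (t j x : NExp)
  /-- input: the imaginary part of the diagonal entry with number `x` of gate `j` of layer `t` -/
  | gateIm (t j x : NExp)

/-- Tests. -/
inductive BExp : Type
  | natLt (e f : NExp)
  | realLt (e f : RExp)
  | not (b : BExp)
  | and (b c : BExp)

/-- Programs. -/
inductive Prog : Type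
  | skip
  /-- store the value of `e` in cell `i` of the natural-number array `a` -/
  | setNat (a : ℕ) (i e : NExp)
  /-- store the value of `e` in cell `i` of the real array `a` -/
  | setReal (a : ℕ) (i : NExp) (e : RExp)
  /-- store the outcome (0 or 1) of a fair coin in cell `i` of the natural-number array `a` -/
  | flip (a : ℕ) (i : NExp)
  | seq (c c' : Prog)
  | ite (b : BExp) (c c' : Prog)
  | while (b : BExp) (c : Prog)

/-- Binary expansion: the `i`-th bit of `x`, least significant bit first. -/
def bitsOf (a x : ℕ) : Bits a := fun i => Fin.ofNat 2 (x / 2 ^ (i : ℕ))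

section Input

variable {n d k : ℕ} (C : Circuit n d k) (N : PauliNoise)

/-- The gates of layer `t` as a list (empty if there is no such layer). -/
def gatesAt (t : ℕ) : List (DiagGate n) := if h : t < d then C.layer ⟨t, h⟩ else []

/-- Reading a number from gate `j` of layer `t` (0 if there is no such gate). -/
def readGate {α : Type} [Zero α] (t j : ℕ) (f : DiagGate n → α) : α :=
  ((gatesAt C t)[j]?.map f).getD 0

/-- The value of a natural-number expression. -/
def NExp.eval (m : Mem) : NExp → ℕ
  | .const c => c
  | .get a i => m.nat a (i.eval m)
  | .plus e f => e.eval m + f.eval m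
  | .minus e f => e.eval m - f.eval m
  | .half e => e.eval m / 2
  | .numQubits => n
  | .depth => d
  | .gateCount t => (gatesAt C (t.eval m)).length
  | .gateArity t j => readGate C (t.eval m) (j.eval m) fun g => g.arity
  | .gateQubit t j i => readGate C (t.eval m) (j.eval m) fun g =>
      if h : i.eval m < g.arity then (g.qubit ⟨i.eval m, h⟩ : ℕ) else 0

/-- The value of a real expression. -/
def RExp.eval (m : Mem) : RExp → ℝ
  | .const c => c
  | .get a i => m.real a (i.eval C m)
  | .plus e f => e.eval m + f.eval m
  | .minus e f => e.eval m - f.eval m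
  | .times e f => e.eval m * f.eval m
  | .quot e f => e.eval m / f.eval m
  | .noiseX => N.pX
  | .noiseY => N.pY
  | .noiseZ => N.pZ
  | .gateRe t j x => readGate C (t.eval C m) (j.eval C m) fun g =>
      (g.diag (bitsOf g.arity (x.eval C m))).re
  | .gateIm t j x => readGate C (t.eval C m) (j.eval C m) fun g =>
      (g.diag (bitsOf g.arity (x.eval C m))).im

/-- The truth of a test. -/
def BExp.Holds (m : Mem) : BExp → Prop
  | .natLt e f => e.eval C m < f.eval C m
  | .realLt e f => e.eval C N m < f.eval C N m
  | .not b => ¬ b.Holds m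
  | .and b c => b.Holds m ∧ c.Holds m

end Input

/-! ### Costs

Every operation on natural numbers, access to memory or input, test, coin flip and control step
costs `1`; every operation on real numbers costs `w`. -/

/-- The cost of evaluating a natural-number expression. -/
def NExp.cost : NExp → ℕ
  | .const _ => 1
  | .get _ i => i.cost + 1
  | .plus e f => e.cost + f.cost + 1
  | .minus e f => e.cost + f.cost + 1
  | .half e => e.cost + 1
  | .numQubits => 1
  | .depth => 1
  | .gateCount t => t.cost + 1
  | .gateArity t j => t.cost + j.cost + 1
  | .gateQubit t j i => t.cost + j.cost + i.cost + 1

/-- The cost of evaluating a real expression. -/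
def RExp.cost (w : ℕ) : RExp → ℕ
  | .const _ => w
  | .get _ i => i.cost + w
  | .plus e f => e.cost w + f.cost w + w
  | .minus e f => e.cost w + f.cost w + w
  | .times e f => e.cost w + f.cost w + w
  | .quot e f => e.cost w + f.cost w + w
  | .noiseX => w
  | .noiseY => w
  | .noiseZ => w
  | .gateRe t j x => t.cost + j.cost + x.cost + w
  | .gateIm t j x => t.cost + j.cost + x.cost + w

/-- The cost of a test. -/
def BExp.cost (w : ℕ) : BExp → ℕ
  | .natLt e f => e.cost + f.cost + 1
  | .realLt e f => e.cost w + f.cost w + w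
  | .not b => b.cost w + 1
  | .and b c => b.cost w + c.cost w + 1

/-- The cost of the first step in the execution of a program. -/
def Prog.stepCost (w : ℕ) : Prog → ℕ
  | .skip => 1
  | .setNat _ i e => i.cost + e.cost + 1
  | .setReal _ i e => i.cost + e.cost w + w
  | .flip _ i => i.cost + 1
  | .seq _ _ => 1
  | .ite b _ _ => b.cost w + 1
  | .while b _ => b.cost w + 1

/-! ### Execution -/

/-- A configuration: the programs that remain to be executed, in this order, and the memory.
The machine has halted when no program remains. -/
abbrev Config : Type := List Prog × Mem

/-- The cost of the next step (no cost after halting). -/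
def Config.cost (w : ℕ) (c : Config) : ℕ :=
  match c.1 with
  | [] => 0
  | q :: _ => q.stepCost w

section Run

variable {n d k : ℕ} (C : Circuit n d k) (N : PauliNoise)

open Classical in
/-- One step of the machine. -/
def step : Config → PMF Config
  | ([], m) => PMF.pure ([], m)
  | (.skip :: K, m) => PMF.pure (K, m)
  | (.setNat a i e :: K, m) => PMF.pure (K, m.setNat a (i.eval C m) (e.eval C m))
  | (.setReal a i e :: K, m) => PMF.pure (K, m.setReal a (i.eval C m) (e.eval C N m))
  | (.flip a i :: K, m) =>
      (PMF.uniformOfFintype (Fin 2)).map fun x : Fin 2 => (K, m.setNat a (i.eval C m) (x : ℕ))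
  | (.seq q q' :: K, m) => PMF.pure (q :: q' :: K, m)
  | (.ite b q q' :: K, m) => PMF.pure ((if b.Holds C N m then q else q') :: K, m)
  | (.while b q :: K, m) =>
      PMF.pure (if b.Holds C N m then q :: .while b q :: K else K, m)

/-- The distribution of the configuration after `t` steps. -/
def run (q : Prog) : ℕ → PMF Config
  | 0 => PMF.pure ([q], Mem.zero)
  | t + 1 => (run q t).bind (step C N)

/-- The machine has halted with output `b`: the string `b` stands in the first `n` cells of the
natural-number array `0`. -/
def haltedWith {n : ℕ} (b : Bits n) : Set Config :=
  {c | c.1 = [] ∧ ∀ v : Fin n, c.2.nat 0 v = (b v : ℕ)}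

/-- The probability that the program, on the noisy circuit as its input, halts with output `b`:
the limit of the nondecreasing probabilities that this has happened after at most `t` steps. -/
def samplingProb (q : Prog) (b : Bits n) : ℝ≥0∞ :=
  ⨆ t, (run C N q t).toOuterMeasure (haltedWith b)

/-- The expected running time, i.e. the expected total cost of all steps, where an operation on real
numbers costs `n ^ 2`. -/
def expectedTime (q : Prog) : ℝ≥0∞ :=
  ∑' t, ∑' c, run C N q t c * (Config.cost (n ^ 2) c : ℝ≥0∞)

end Run

end NoisyIQP

end

/-!
The proof exhibits one program, `sampler`, and analyses it exactly.

*The noise as a classical mixture.* The noise on one qubit after one layer is a mixture of four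
outcomes: the qubit is flipped or not, and it is dephased or not. Dephasing replaces the coherences
of the qubit by `0`, and it has total probability `2 p`. All gates are diagonal, so dephasing commutes
with them, and a flip only shifts the arguments of the later gates. Conditioned on the pattern `ω` of
all outcomes the state is explicit (`patternState`), and the output distribution is the average over
`ω` of explicit distributions (`outputProb_eq`, `patternProb_eq`): dephased qubits are replaced by
uniformly random bits in the circuit and have uniformly random outcomes, and the remaining qubits have
the squared norm of an amplitude as their outcome distribution. This amplitude factorizes over the
connected components of the graph in which two undephased qubits are adjacent if they lie in a common
gate (`prod_norm_amp_block`).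

*The program.* It draws the pattern with exact Bernoulli sampling from fair coins, labels the qubits
by their components, and draws the outcomes component by component with rejection sampling: a uniformly
random string on a component of size `s` is accepted with the squared norm of its amplitude, a sum of
`2 ^ s` terms. A round succeeds with probability `2 ^ (-s)`, so a component costs `4 ^ s` up to a
polynomial factor (`ert_sampleBlock_le`).

*Percolation.* A qubit remains undephased in all `d` layers with probability `(1 - 2 p) ^ d`, and it
shares gates with at most `d k` qubits. Above the depth threshold, the expectation of `4 ^ s`, bounded
by a sum over all connected sets that contain a given qubit, is at most `2`
(`sum_rootedIn_le`, `noiseAvg_clusterSum_le_two_mul`). Hence all components together have an expected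
cost of order `d n ^ 4`.

*Expected costs.* `ert` is a weakest-precondition transformer for programs. `ert C N ε q X` is an upper
bound for the expectation of `ε * cost + X`, where `X` is a function of the final memory, and a loop is
bounded by any of its invariants (`ert_while_le`). One computation, `ert_sampler_le`, gives both the
running time (`ε = 1`, `X = 0`) and an upper bound for the probability of every outcome (`ε = 0` and
`X` the indicator of the outcome). Upper bounds suffice: the expected time is finite, so the program
halts almost surely, its output consists of bits, and the bounds sum up to `1`, so that they are attained
(`samplingProb_eq_of_le`).
-/

open scoped ENNReal NNReal

noncomputable section

namespace NoisyIQP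

/-! ### The expected-cost transformer -/

section Transformer

variable {n d k : ℕ} (C : Circuit n d k) (N : PauliNoise) (ε : ℝ≥0∞)

open Classical in
/-- `ert C N ε q X m` is the expectation of `ε * (total cost) + X (final memory)` when `q` is run
from the memory `m`. A loop is sent to the infimum of the prefixed points of its unfolding, so that
every invariant of the loop bounds it from above. -/
def ert : Prog → (Mem → ℝ≥0∞) → Mem → ℝ≥0∞
  | .skip, X, m => ε * ((Prog.skip.stepCost (n ^ 2) : ℕ) : ℝ≥0∞) + X m
  | .setNat a i e, X, m => ε * (((Prog.setNat a i e).stepCost (n ^ 2) : ℕ) : ℝ≥0∞)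
      + X (m.setNat a (i.eval C m) (e.eval C m))
  | .setReal a i e, X, m => ε * (((Prog.setReal a i e).stepCost (n ^ 2) : ℕ) : ℝ≥0∞)
      + X (m.setReal a (i.eval C m) (e.eval C N m))
  | .flip a i, X, m => ε * (((Prog.flip a i).stepCost (n ^ 2) : ℕ) : ℝ≥0∞)
      + 2⁻¹ * (X (m.setNat a (i.eval C m) 0) + X (m.setNat a (i.eval C m) 1))
  | .seq p q, X, m => ε * (((Prog.seq p q).stepCost (n ^ 2) : ℕ) : ℝ≥0∞) + ert p (ert q X) m
  | .ite b p q, X, m => ε * (((Prog.ite b p q).stepCost (n ^ 2) : ℕ) : ℝ≥0∞)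
      + if b.Holds C N m then ert p X m else ert q X m
  | .while b q, X, m => ⨅ (Y : Mem → ℝ≥0∞)
      (_ : ∀ m, ε * (((Prog.while b q).stepCost (n ^ 2) : ℕ) : ℝ≥0∞)
        + (if b.Holds C N m then ert q Y m else X m) ≤ Y m), Y m

/-- Every assignment and coin flip in the program preserves the property `I` of memories. -/
def Prog.Preserves (I : Mem → Prop) : Prog → Prop
  | .skip => True
  | .setNat a i e => ∀ m, I m → I (m.setNat a (i.eval C m) (e.eval C m))
  | .setReal a i e => ∀ m, I m → I (m.setReal a (i.eval C m) (e.eval C N m))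
  | .flip a i => ∀ m, I m → ∀ x, x ≤ 1 → I (m.setNat a (i.eval C m) x)
  | .seq p q => p.Preserves I ∧ q.Preserves I
  | .ite _ p q => p.Preserves I ∧ q.Preserves I
  | .while _ q => q.Preserves I

variable {C N ε}

/-- Monotonicity of the transformer; only memories with an invariant property matter. -/
theorem ert_le_of_preserves {I : Mem → Prop} {q : Prog} (hq : q.Preserves C N I)
    {X X' : Mem → ℝ≥0∞} (h : ∀ m, I m → X m ≤ X' m) {m : Mem} (hm : I m) :
    ert C N ε q X m ≤ ert C N ε q X' m := by
  induction q generalizing X X' m with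
  | skip => exact add_le_add_right (h m hm) _
  | setNat a i e => exact add_le_add_right (h _ (hq m hm)) _
  | setReal a i e => exact add_le_add_right (h _ (hq m hm)) _
  | flip a i =>
    simp only [ert]
    gcongr
    · exact h _ (hq m hm 0 (by norm_num))
    · exact h _ (hq m hm 1 le_rfl)
  | seq p q ihp ihq =>
    exact add_le_add_right (ihp hq.1 (fun m hm => ihq hq.2 h hm) hm) _
  | ite b p q ihp ihq =>
    simp only [ert]
    split_ifs
    · exact add_le_add_right (ihp hq.1 h hm) _
    · exact add_le_add_right (ihq hq.2 h hm) _
  | _ b q ih =>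
    classical
    simp only [ert]
    refine le_iInf₂ fun Y hY => ?_
    -- The value `⊤` discards the memories without the invariant property.
    refine (iInf₂_le (fun m => if I m then Y m else ⊤) fun m' => ?_).trans (by simp [hm])
    by_cases hm' : I m'
    · simp only [hm', if_true]
      refine le_trans (add_le_add_right ?_ _) (hY m')
      split_ifs
      · exact ih hq (fun m'' h'' => by simp [h'']) hm'
      · exact h m' hm'
    · simp [hm']

theorem ert_mono {q : Prog} {X X' : Mem → ℝ≥0∞} (h : ∀ m, X m ≤ X' m) (m : Mem) :
    ert C N ε q X m ≤ ert C N ε q X' m := by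
  refine ert_le_of_preserves (I := fun _ => True) ?_ (fun m _ => h m) trivial
  induction q <;> simp_all [Prog.Preserves]

/-- The value of a loop is itself a prefixed point of the unfolding. -/
theorem ert_while_unfold {b : BExp} {q : Prog} (X : Mem → ℝ≥0∞) (m : Mem) :
    ε * (((Prog.while b q).stepCost (n ^ 2) : ℕ) : ℝ≥0∞)
      + (open Classical in if b.Holds C N m then ert C N ε q (ert C N ε (.while b q) X) m else X m)
      ≤ ert C N ε (.while b q) X m := by
  conv_rhs => rw [ert]
  refine le_iInf₂ fun Y hY => (add_le_add_right ?_ _).trans (hY m)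
  split_ifs
  · exact ert_mono (fun m' => by rw [ert]; exact iInf₂_le Y hY) m
  · exact le_rfl

/-- Park induction: an invariant bounds the expected cost of a loop. It has to be checked only where
it is finite. -/
theorem ert_while_le {b : BExp} {q : Prog} {X Y : Mem → ℝ≥0∞}
    (ht : ∀ m, Y m ≠ ⊤ → b.Holds C N m →
      ε * (((Prog.while b q).stepCost (n ^ 2) : ℕ) : ℝ≥0∞) + ert C N ε q Y m ≤ Y m)
    (hf : ∀ m, Y m ≠ ⊤ → ¬ b.Holds C N m →
      ε * (((Prog.while b q).stepCost (n ^ 2) : ℕ) : ℝ≥0∞) + X m ≤ Y m) (m : Mem) :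
    ert C N ε (.while b q) X m ≤ Y m := by
  classical
  rw [ert]
  refine iInf₂_le Y fun m' => ?_
  by_cases hY : Y m' = ⊤
  · simp [hY]
  split_ifs with h
  · exact ht m' hY h
  · exact hf m' hY h

variable (C N ε) in
/-- The transformer of a list of programs that are run one after the other. -/
def ertList : List Prog → (Mem → ℝ≥0∞) → Mem → ℝ≥0∞
  | [], X => X
  | q :: K, X => ert C N ε q (ertList K X)

theorem PMF.tsum_pure_mul {α : Type*} (a : α) (g : α → ℝ≥0∞) :
    ∑' c, PMF.pure a c * g c = g a := by
  rw [tsum_eq_single a (fun b hb => by simp [hb])]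
  simp

theorem PMF.tsum_bind_mul {α β : Type*} (p : PMF α) (f : α → PMF β) (g : β → ℝ≥0∞) :
    ∑' c, (p.bind f) c * g c = ∑' a, p a * ∑' c, f a c * g c := by
  simp_rw [PMF.bind_apply, ← ENNReal.tsum_mul_right, ← ENNReal.tsum_mul_left, mul_assoc]
  exact ENNReal.tsum_comm

/-- In one step of the machine, the cost and the value of the remaining programs do not exceed the
former value. -/
theorem cost_add_step_le (X : Mem → ℝ≥0∞) (c : Config) :
    ε * (c.cost (n ^ 2) : ℝ≥0∞) + ∑' c', step C N c c' * ertList C N ε c'.1 X c'.2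
      ≤ ertList C N ε c.1 X c.2 := by
  obtain ⟨K, m⟩ := c
  match K with
  | [] => simp [step, Config.cost, ertList]
  | .skip :: K => simp [step, Config.cost, ertList, ert]
  | .setNat a i e :: K => simp [step, Config.cost, ertList, ert]
  | .setReal a i e :: K => simp [step, Config.cost, ertList, ert]
  | .seq p q :: K => simp [step, Config.cost, ertList, ert]
  | .ite b p q :: K =>
    simp only [step, PMF.tsum_pure_mul, Config.cost, ertList, ert]
    split_ifs <;> simp
  | .while b q :: K =>
    simp only [step, PMF.tsum_pure_mul, Config.cost, ertList]
    refine le_trans (le_of_eq ?_) (ert_while_unfold _ m)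
    split_ifs <;> simp [ertList]
  | .flip a i :: K =>
    simp only [step, Config.cost, ertList, ert, PMF.map, PMF.tsum_bind_mul,
      Function.comp_apply, PMF.tsum_pure_mul, tsum_fintype, Fin.sum_univ_two,
      PMF.uniformOfFintype_apply, Fintype.card_fin]
    simp [mul_add]

/-- Soundness of the transformer: the cost of the first `t` steps and the value after `t` steps are
bounded by it. -/
theorem sum_cost_add_run_le (q : Prog) (X : Mem → ℝ≥0∞) (t : ℕ) :
    ∑ s ∈ Finset.range t, ∑' c, run C N q s c * (ε * (Config.cost (n ^ 2) c : ℝ≥0∞))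
      + ∑' c, run C N q t c * ertList C N ε c.1 X c.2 ≤ ert C N ε q X Mem.zero := by
  induction t with
  | zero => simp [run, ertList]
  | succ t ih =>
    refine le_trans ?_ ih
    rw [Finset.sum_range_succ, add_assoc]
    refine add_le_add_right ?_ _
    rw [run, PMF.tsum_bind_mul, ← ENNReal.tsum_add]
    refine ENNReal.tsum_le_tsum fun c => ?_
    rw [← mul_add]
    exact mul_le_mul_right (cost_add_step_le X c) _

theorem expectedTime_le_ert (q : Prog) :
    expectedTime C N q ≤ ert C N 1 q (fun _ => 0) Mem.zero := by
  rw [expectedTime, ENNReal.tsum_eq_iSup_nat]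
  refine iSup_le fun t => ?_
  have h := sum_cost_add_run_le (C := C) (N := N) (ε := 1) q (fun _ => 0) t
  simp only [one_mul] at h
  exact le_self_add.trans h

/-- The transformer without costs bounds the probability to halt in a set of memories. -/
theorem run_halted_le_ert (q : Prog) (t : ℕ) (S : Set Mem) :
    (run C N q t).toOuterMeasure {c | c.1 = [] ∧ c.2 ∈ S}
      ≤ ert C N 0 q (S.indicator 1) Mem.zero := by
  refine le_trans ?_ (le_add_self.trans
    (sum_cost_add_run_le (C := C) (N := N) (ε := 0) q (S.indicator 1) t))
  rw [PMF.toOuterMeasure_apply]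
  refine ENNReal.tsum_le_tsum fun c => ?_
  by_cases h : c ∈ {c : Config | c.1 = [] ∧ c.2 ∈ S}
  · rw [Set.indicator_of_mem h, h.1]
    simp [ertList, Set.indicator_of_mem h.2]
  · simp [Set.indicator_of_notMem h]

end Transformer

/-! ### Memory that a program does not touch -/

/-- Some command of the program writes to the array `a` of natural numbers. -/
def Prog.writesNat (a : ℕ) : Prog → Bool
  | .skip => false
  | .setNat a' _ _ => a' == a
  | .setReal _ _ _ => false
  | .flip a' _ => a' == a
  | .seq p q => p.writesNat a || q.writesNat a
  | .ite _ p q => p.writesNat a || q.writesNat a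
  | .while _ q => q.writesNat a

/-- Some command of the program writes to the array `a` of real numbers. -/
def Prog.writesReal (a : ℕ) : Prog → Bool
  | .skip => false
  | .setNat _ _ _ => false
  | .setReal a' _ _ => a' == a
  | .flip _ _ => false
  | .seq p q => p.writesReal a || q.writesReal a
  | .ite _ p q => p.writesReal a || q.writesReal a
  | .while _ q => q.writesReal a

/-- The memories agree on the arrays to which the program does not write. -/
structure Agree (q : Prog) (m m' : Mem) : Prop where
  nat : ∀ a, q.writesNat a = false → m'.nat a = m.nat a
  real : ∀ a, q.writesReal a = false → m'.real a = m.real a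

theorem Agree.refl (q : Prog) (m : Mem) : Agree q m m := ⟨fun _ _ => rfl, fun _ _ => rfl⟩

theorem Agree.trans {q : Prog} {m m' m'' : Mem} (h : Agree q m m') (h' : Agree q m' m'') :
    Agree q m m'' :=
  ⟨fun a ha => (h'.nat a ha).trans (h.nat a ha), fun a ha => (h'.real a ha).trans (h.real a ha)⟩

theorem Agree.mono {p q : Prog} {m m' : Mem} (h : Agree p m m')
    (hn : ∀ a, q.writesNat a = false → p.writesNat a = false)
    (hr : ∀ a, q.writesReal a = false → p.writesReal a = false) : Agree q m m' :=
  ⟨fun a ha => h.nat a (hn a ha), fun a ha => h.real a (hr a ha)⟩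

section Rules

variable {n d k : ℕ} {C : Circuit n d k} {N : PauliNoise} {ε : ℝ≥0∞}

/-- A part of the program `q` preserves the agreement with a memory on the arrays that `q` does not
touch. -/
theorem preserves_agree (q : Prog) (m₀ : Mem) (p : Prog)
    (hn : ∀ a, q.writesNat a = false → p.writesNat a = false)
    (hr : ∀ a, q.writesReal a = false → p.writesReal a = false) :
    p.Preserves C N (Agree q m₀) := by
  induction p with
  | skip => trivial
  | setNat a i e =>
    refine fun m hm => ⟨fun a' h => ?_, fun a' h => hm.real a' h⟩
    have := hn a' h
    simp only [Prog.writesNat, beq_eq_false_iff_ne] at this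
    simpa [Mem.setNat, Function.update_of_ne this.symm] using hm.nat a' h
  | setReal a i e =>
    refine fun m hm => ⟨fun a' h => hm.nat a' h, fun a' h => ?_⟩
    have := hr a' h
    simp only [Prog.writesReal, beq_eq_false_iff_ne] at this
    simpa [Mem.setReal, Function.update_of_ne this.symm] using hm.real a' h
  | flip a i =>
    refine fun m hm x _ => ⟨fun a' h => ?_, fun a' h => hm.real a' h⟩
    have := hn a' h
    simp only [Prog.writesNat, beq_eq_false_iff_ne] at this
    simpa [Mem.setNat, Function.update_of_ne this.symm] using hm.nat a' h
  | seq p p' ihp ihq =>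
    simp only [Prog.writesNat, Prog.writesReal, Bool.or_eq_false_iff] at hn hr
    exact ⟨ihp (fun a h => (hn a h).1) (fun a h => (hr a h).1),
      ihq (fun a h => (hn a h).2) (fun a h => (hr a h).2)⟩
  | ite b p p' ihp ihq =>
    simp only [Prog.writesNat, Prog.writesReal, Bool.or_eq_false_iff] at hn hr
    exact ⟨ihp (fun a h => (hn a h).1) (fun a h => (hr a h).1),
      ihq (fun a h => (hn a h).2) (fun a h => (hr a h).2)⟩
  | _ b p ih => exact ih hn hr

/-- The frame rule: only memories that agree with the initial one on the untouched arrays matter. -/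
theorem ert_frame {q : Prog} {X X' : Mem → ℝ≥0∞} {m : Mem}
    (h : ∀ m', Agree q m m' → X m' ≤ X' m') : ert C N ε q X m ≤ ert C N ε q X' m :=
  ert_le_of_preserves (preserves_agree q m q (fun _ h => h) (fun _ h => h)) h (Agree.refl q m)

theorem ert_seq_le {p q : Prog} {X : Mem → ℝ≥0∞} {m : Mem} {e : ℝ≥0∞}
    (h : ε + ert C N ε p (ert C N ε q X) m ≤ e) : ert C N ε (.seq p q) X m ≤ e := by
  simpa [ert, Prog.stepCost] using h

variable (C N) in
/-- From the memory `m`, the program surely halts at a cost of at most `c` in a memory with the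
property `Q`. -/
def Det (q : Prog) (m : Mem) (c : ℕ) (Q : Mem → Prop) : Prop :=
  ∀ (ε : ℝ≥0∞) (X : Mem → ℝ≥0∞) (e : ℝ≥0∞), (∀ m', Q m' → X m' ≤ e) →
    ert C N ε q X m ≤ ε * c + e

namespace Det

variable {p q : Prog} {m : Mem} {c c' : ℕ} {Q Q' : Mem → Prop}

theorem frame (h : Det C N q m c Q) : Det C N q m c (fun m' => Agree q m m' ∧ Q m') := by
  classical
  intro ε X e hX
  refine le_trans (ert_frame (X' := fun m' => if Agree q m m' then X m' else 0) ?_) (h ε _ e ?_)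
  · intro m' hm'
    simp [hm']
  · intro m' hm'
    split_ifs with ha
    · exact hX m' ⟨ha, hm'⟩
    · exact zero_le

theorem mono (h : Det C N q m c Q) (hc : c ≤ c') (hQ : ∀ m', Agree q m m' → Q m' → Q' m') :
    Det C N q m c' Q' := fun ε X e hX =>
  (h.frame ε X e fun m' hm' => hX m' (hQ m' hm'.1 hm'.2)).trans <| by gcongr

theorem skip (h : Q m) : Det C N .skip m 1 Q := fun ε X e hX => by
  simpa [ert, Prog.stepCost] using add_le_add_right (hX m h) _

theorem setNat {a : ℕ} {i e : NExp} (h : Q (m.setNat a (i.eval C m) (e.eval C m))) :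
    Det C N (.setNat a i e) m (i.cost + e.cost + 1) Q := fun ε X e hX => by
  simpa [ert, Prog.stepCost] using add_le_add_right (hX _ h) _

theorem setReal {a : ℕ} {i : NExp} {e : RExp} (h : Q (m.setReal a (i.eval C m) (e.eval C N m))) :
    Det C N (.setReal a i e) m (i.cost + e.cost (n ^ 2) + n ^ 2) Q := fun ε X e hX => by
  simpa [ert, Prog.stepCost] using add_le_add_right (hX _ h) _

theorem seq (h : Det C N p m c (fun m' => Det C N q m' c' Q)) :
    Det C N (.seq p q) m (c + c' + 1) Q := fun ε X e hX => by
  refine ert_seq_le ?_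
  calc ε + ert C N ε p (ert C N ε q X) m ≤ ε + (ε * c + (ε * c' + e)) := by
        gcongr
        exact h ε _ _ fun m' hm' => hm' ε X e hX
    _ = _ := by push_cast; ring

theorem ite {b : BExp} (hp : b.Holds C N m → Det C N p m c Q)
    (hq : ¬ b.Holds C N m → Det C N q m c Q) :
    Det C N (.ite b p q) m (b.cost (n ^ 2) + 1 + c) Q := fun ε X e hX => by
  simp only [ert, Prog.stepCost]
  rw [Nat.cast_add (_ + 1) c, mul_add, add_assoc]
  refine add_le_add le_rfl ?_
  split_ifs with h
  · exact hp h ε X e hX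
  · exact hq h ε X e hX

theorem setNat_le {a : ℕ} {i e : NExp} (hc : i.cost + e.cost + 1 ≤ c)
    (h : Q (m.setNat a (i.eval C m) (e.eval C m))) : Det C N (.setNat a i e) m c Q :=
  (setNat h).mono hc fun _ _ h => h

theorem setReal_le {a : ℕ} {i : NExp} {e : RExp} (hc : i.cost + e.cost (n ^ 2) + n ^ 2 ≤ c)
    (h : Q (m.setReal a (i.eval C m) (e.eval C N m))) : Det C N (.setReal a i e) m c Q :=
  (setReal h).mono hc fun _ _ h => h

theorem skip_le (hc : 1 ≤ c) (h : Q m) : Det C N .skip m c Q := (skip h).mono hc fun _ _ h => h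

theorem cost_le (h : Det C N q m c Q) (hc : c ≤ c') : Det C N q m c' Q := h.mono hc fun _ _ h => h

theorem comp {P : Mem → Prop} (hp : Det C N p m c P)
    (hq : ∀ m', Agree p m m' → P m' → Det C N q m' c' Q) :
    Det C N (.seq p q) m (c + c' + 1) Q :=
  seq (hp.mono le_rfl hq)

theorem setNat_seq {a : ℕ} {i e : NExp}
    (h : Det C N q (m.setNat a (i.eval C m) (e.eval C m)) c Q) :
    Det C N (.seq (.setNat a i e) q) m (i.cost + e.cost + 1 + c + 1) Q :=
  seq (setNat h)

theorem setReal_seq {a : ℕ} {i : NExp} {e : RExp}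
    (h : Det C N q (m.setReal a (i.eval C m) (e.eval C N m)) c Q) :
    Det C N (.seq (.setReal a i e) q) m (i.cost + e.cost (n ^ 2) + n ^ 2 + c + 1) Q :=
  seq (setReal h)

end Det

/-! ### Counting loops -/

/-- Cell `0` of the array `a` of natural numbers, used as a variable. -/
abbrev NExp.var (a : ℕ) : NExp := .get a (.const 0)

/-- The loop `for a = 0, …, e - 1 do q`. -/
def Prog.for (a : ℕ) (e : NExp) (q : Prog) : Prog :=
  .seq (.setNat a (.const 0) (.const 0))
    (.while (.natLt (.var a) e)
      (.seq q (.setNat a (.const 0) (.plus (.var a) (.const 1)))))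

@[simp] theorem Prog.writesNat_for (a a' : ℕ) (e : NExp) (q : Prog) :
    (Prog.for a e q).writesNat a' = (a == a' || q.writesNat a') := by
  simp only [Prog.for, Prog.writesNat]
  grind

@[simp] theorem Prog.writesReal_for (a a' : ℕ) (e : NExp) (q : Prog) :
    (Prog.for a e q).writesReal a' = q.writesReal a' := by
  simp [Prog.for, Prog.writesReal]

@[simp] theorem Mem.setNat_nat (m : Mem) (a i x a' : ℕ) :
    (m.setNat a i x).nat a' = if a' = a then Function.update (m.nat a) i x else m.nat a' := by
  simp only [Mem.setNat, Function.update_apply]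

@[simp] theorem Mem.setNat_real (m : Mem) (a i x : ℕ) : (m.setNat a i x).real = m.real := rfl

@[simp] theorem Mem.setReal_nat (m : Mem) (a i : ℕ) (x : ℝ) : (m.setReal a i x).nat = m.nat := rfl

@[simp] theorem Mem.setReal_real (m : Mem) (a i : ℕ) (x : ℝ) (a' : ℕ) :
    (m.setReal a i x).real a' = if a' = a then Function.update (m.real a) i x else m.real a' := by
  simp only [Mem.setReal, Function.update_apply]

/-- A constant can be pulled out of the transformer. The reverse inequality fails for loops that do
not halt. -/
theorem ert_const_add_le {q : Prog} (δ : ℝ≥0∞) (X : Mem → ℝ≥0∞) (m : Mem) :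
    ert C N ε q (fun m => δ + X m) m ≤ δ + ert C N ε q X m := by
  induction q generalizing X m with
  | skip => exact (add_left_comm _ _ _).le
  | setNat a i e => exact (add_left_comm _ _ _).le
  | setReal a i e => exact (add_left_comm _ _ _).le
  | flip a i =>
    simp only [ert]
    rw [add_left_comm δ, add_add_add_comm, mul_add, ← two_mul, ← mul_assoc,
      ENNReal.inv_mul_cancel two_ne_zero ENNReal.ofNat_ne_top, one_mul]
  | seq p q ihp ihq =>
    simp only [ert]
    rw [add_left_comm δ]
    exact add_le_add_right ((ert_mono (fun m => ihq X m) m).trans (ihp _ m)) _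
  | ite b p q ihp ihq =>
    simp only [ert]
    rw [add_left_comm δ]
    split_ifs
    · exact add_le_add_right (ihp X m) _
    · exact add_le_add_right (ihq X m) _
  | _ b q ih =>
    conv_rhs => rw [ert]
    simp only [ENNReal.add_iInf]
    refine le_iInf₂ fun Y hY => ?_
    refine ert_while_le (Y := fun m => δ + Y m) (fun m' _ hb => ?_) (fun m' _ hb => ?_) m
    · have := hY m'
      rw [if_pos hb] at this
      calc _ ≤ _ + (δ + ert C N ε q Y m') := add_le_add_right (ih Y m') _
        _ ≤ _ := by rw [add_left_comm]; exact add_le_add_right this _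
    · have := hY m'
      rw [if_neg hb] at this
      rw [add_left_comm]
      exact add_le_add_right this _

/-- The rule for counting loops with potentials: `J j` bounds the expectation from the beginning of
round `j` on, up to the cost of the rounds. -/
theorem ert_for_le {a M c : ℕ} {e : NExp} {q : Prog} {X : Mem → ℝ≥0∞} {m₀ : Mem}
    {I : ℕ → Mem → Prop} {J : ℕ → Mem → ℝ≥0∞}
    (hw : q.writesNat a = false)
    (he : ∀ m, Agree (Prog.for a e q) m₀ m → e.eval C m = M)
    (h0 : I 0 m₀)
    (hI : ∀ j m x, I j m → I j (m.setNat a 0 x))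
    (hJ : ∀ j m x, J j (m.setNat a 0 x) = J j m)
    (hq : ∀ j < M, ∀ m, Agree (Prog.for a e q) m₀ m → m.nat a 0 = j → I j m →
      ∀ X, (∀ m', Agree q m m' → I (j + 1) m' → X m' ≤ J (j + 1) m') →
      ert C N ε q X m ≤ ε * c + J j m)
    (hX : ∀ m, Agree (Prog.for a e q) m₀ m → I M m → X m ≤ J M m) :
    ert C N ε (Prog.for a e q) X m₀
      ≤ ε * ((c + e.cost + 11) * M + e.cost + 8 : ℕ) + J 0 m₀ := by
  classical
  set A := Agree (Prog.for a e q) m₀ with hA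
  -- A round costs `c` for `q`, at most `e.cost + 4` for the test and `7` for the rest of the body.
  set w : ℕ := c + e.cost + 11 with hw'
  set body : Prog := .seq q (.setNat a (.const 0) (.plus (.var a) (.const 1))) with hbody
  set Y : Mem → ℝ≥0∞ := fun m => if A m ∧ m.nat a 0 ≤ M ∧ I (m.nat a 0) m then
    ε * (w * (M - m.nat a 0) + e.cost + 4 : ℕ) + J (m.nat a 0) m else ⊤ with hY
  have hAset : ∀ m x, A m → A (m.setNat a 0 x) := fun m x h =>
    h.trans ⟨fun a' ha' => by
      have : a' ≠ a := by rintro rfl; simp at ha'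
      simp [this], fun a' _ => rfl⟩
  have hAq : ∀ m m', A m → Agree q m m' → A m' := fun m m' h h' =>
    h.trans (h'.mono (fun a' ha' => by simp_all) (fun a' ha' => by simp_all))
  have hstep : ∀ m, A m → m.nat a 0 < M → I (m.nat a 0) m →
      ert C N ε body Y m ≤ ε * (c + 7 + (w * (M - (m.nat a 0 + 1)) + e.cost + 4) : ℕ)
        + J (m.nat a 0) m := by
    intro m hAm hlt hIm
    set j := m.nat a 0 with hj
    set K : ℝ≥0∞ := ε * (6 + (w * (M - (j + 1)) + e.cost + 4) : ℕ) with hK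
    refine ert_seq_le ?_
    have h1 : ert C N ε q (ert C N ε (.setNat a (.const 0) (.plus (.var a) (.const 1))) Y) m
        ≤ ert C N ε q (fun m' => K + if I (j + 1) m' then J (j + 1) m' else ⊤) m := by
      refine ert_frame fun m' hm' => ?_
      by_cases hI' : I (j + 1) m'
      · have hj' : m'.nat a 0 = j := by rw [hm'.nat a hw]
        have hAm' := hAset m' (j + 1) (hAq m m' hAm hm')
        have hc : A (m'.setNat a 0 (j + 1)) ∧ (m'.setNat a 0 (j + 1)).nat a 0 ≤ M ∧
            I ((m'.setNat a 0 (j + 1)).nat a 0) (m'.setNat a 0 (j + 1)) := by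
          refine ⟨hAm', ?_, ?_⟩
          · simpa using hlt
          · simpa using hI _ _ _ hI'
        simp only [ert, NExp.eval, hj', hY, if_pos hc, if_pos hI']
        rw [← add_assoc, ← mul_add, hJ]
        simp only [Mem.setNat_nat, if_true, Function.update_self, hK]
        rw [← Nat.cast_add]
        simp [Prog.stepCost, NExp.cost]
      · simp [hI']
    refine (add_le_add_right (h1.trans ((ert_const_add_le _ _ m).trans (add_le_add_right
      (hq j hlt m hAm rfl hIm _ fun m' _ h => by rw [if_pos h]) _))) _).trans (le_of_eq ?_)
    rw [hK]
    push_cast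
    ring
  have key : ∀ m, ert C N ε (.while (.natLt (.var a) e) body) X m ≤ Y m := by
    refine ert_while_le (fun m hm hb => ?_) (fun m hm hb => ?_)
    · have hm : A m ∧ m.nat a 0 ≤ M ∧ I (m.nat a 0) m := by
        by_contra h
        exact hm (if_neg h)
      have hlt : m.nat a 0 < M := by simpa [BExp.Holds, NExp.eval, he m hm.1] using hb
      refine (add_le_add_right (hstep m hm.1 hlt hm.2.2) _).trans (le_of_eq ?_)
      simp only [hY, if_pos hm, Prog.stepCost, BExp.cost, NExp.cost]
      obtain ⟨r, hr⟩ := Nat.exists_eq_add_of_lt hlt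
      rw [← add_assoc, ← mul_add, ← Nat.cast_add]
      congr 3
      rw [show M - (m.nat a 0 + 1) = r by omega, show M - m.nat a 0 = r + 1 by omega, hw']
      ring
    · have hm : A m ∧ m.nat a 0 ≤ M ∧ I (m.nat a 0) m := by
        by_contra h
        exact hm (if_neg h)
      have hM : m.nat a 0 = M := by
        have : ¬ m.nat a 0 < M := by simpa [BExp.Holds, NExp.eval, he m hm.1] using hb
        omega
      simp only [hY, if_pos hm, Prog.stepCost, BExp.cost, NExp.cost]
      rw [hM] at hm ⊢
      refine add_le_add ?_ (hX m hm.1 hm.2.2)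
      refine mul_le_mul_right (Nat.cast_le.2 ?_) _
      simp only [Nat.sub_self, mul_zero]
      omega
  refine ert_seq_le ?_
  have hc : A (m₀.setNat a 0 0) ∧ (m₀.setNat a 0 0).nat a 0 ≤ M ∧
      I ((m₀.setNat a 0 0).nat a 0) (m₀.setNat a 0 0) :=
    ⟨hAset _ _ (Agree.refl _ _), by simp, by simpa using hI _ _ _ h0⟩
  have := key (m₀.setNat a 0 0)
  simp only [hY, if_pos hc] at this
  simp only [ert, NExp.eval, Prog.stepCost, NExp.cost]
  refine (add_le_add_right (add_le_add_right this _) _).trans (le_of_eq ?_)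
  rw [hJ]
  simp only [Mem.setNat_nat, if_true, Function.update_self, Nat.sub_zero]
  push_cast
  ring

/-- The rule for counting loops whose body is deterministic. -/
theorem Det.for {a M c : ℕ} {e : NExp} {q : Prog} {m₀ : Mem} {I : ℕ → Mem → Prop}
    (hw : q.writesNat a = false)
    (he : ∀ m, Agree (Prog.for a e q) m₀ m → e.eval C m = M)
    (h0 : I 0 m₀)
    (hI : ∀ j m x, I j m → I j (m.setNat a 0 x))
    (hq : ∀ j < M, ∀ m, Agree (Prog.for a e q) m₀ m → m.nat a 0 = j → I j m →
      Det C N q m c (I (j + 1))) :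
    Det C N (Prog.for a e q) m₀ ((c + e.cost + 11) * M + e.cost + 8) (I M) := by
  intro ε X b hX
  refine ert_for_le (I := I) (J := fun _ _ => b) hw he h0 hI (fun _ _ _ => rfl) ?_ ?_
  · intro j hj m hA hjm hIm X hX
    exact (hq j hj m hA hjm hIm).frame ε X b fun m' hm' => hX m' hm'.1 hm'.2
  · exact fun m _ h => hX m h

end Rules

/-! ### The program -/

/-- Cell `0` of the array `a` of real numbers, used as a variable. -/
abbrev RExp.var (a : ℕ) : RExp := .get a (.const 0)

/-- Assignment to a variable for natural numbers. -/
abbrev Prog.assign (a : ℕ) (e : NExp) : Prog := .setNat a (.const 0) e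

/-- Assignment to a variable for real numbers. -/
abbrev Prog.assignReal (a : ℕ) (e : RExp) : Prog := .setReal a (.const 0) e

/-- The residue modulo `2`. -/
abbrev NExp.parity (e : NExp) : NExp := .minus e (.plus (.half e) (.half e))

/-- The test whether a number is odd. -/
abbrev BExp.odd (e : NExp) : BExp := .natLt (.const 0) e.parity

/-- The test whether two numbers are equal. -/
abbrev BExp.natEq (e f : NExp) : BExp := .and (.not (.natLt e f)) (.not (.natLt f e))

/-- Exact Bernoulli sampling. The real variable `0` holds the success probability at first. While it
lies in `(0, 1)`, it is replaced by `2 x` or `2 x - 1` with probability one half each. The value, clamped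
to `[0, 1]`, is a martingale, and it leaves `(0, 1)` with probability at least one half in every round. At
the end, a value of at least `1` means success. -/
def bernoulli : Prog :=
  .while (.and (.realLt (.const 0) (.var 0)) (.realLt (.var 0) (.const 1)))
    (.seq (.flip 11 (.const 0))
      (.ite (.natLt (.const 0) (.var 11))
        (.assignReal 0 (.minus (.plus (.var 0) (.var 0)) (.const 1)))
        (.assignReal 0 (.plus (.var 0) (.var 0)))))

/-- The test for the outcome `0` of `bernoulli`. -/
abbrev BExp.failed : BExp := .realLt (.var 0) (.const 1)

/-- Sampling of the noise on the qubit in variable `9` after the layer in variable `8`; variable `7`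
holds the index of this pair. The qubit is flipped with probability `pX + pY`; given this, it is dephased
with probability `2 * pZ / (1 - pX - pY)` if it is not flipped and `2 * min (pX, pY) / (pX + pY)` if it
is. Array `3` counts the earlier flips, array `4` counts the flips that
come with a phase flip, and array `2` becomes `n` where a qubit is dephased. -/
def sampleNoise : Prog :=
  .seq (.assignReal 0 (.plus .noiseX .noiseY)) <|
  .seq bernoulli <|
  .seq (.ite .failed
    (.seq (.setNat 3 (.plus (.var 7) .numQubits) (.get 3 (.var 7))) <|
     .seq (.assignReal 0 (.quot (.plus .noiseZ .noiseZ)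
        (.minus (.minus (.const 1) .noiseX) .noiseY))) <|
     .seq bernoulli <|
      .ite .failed .skip (.setNat 2 (.var 9) .numQubits))
    (.seq (.setNat 3 (.plus (.var 7) .numQubits) (.plus (.get 3 (.var 7)) (.const 1))) <|
     .seq (.ite (.realLt .noiseX .noiseY) (.assignReal 1 .noiseX) (.assignReal 1 .noiseY)) <|
     .seq (.assignReal 0 (.quot (.plus (.var 1) (.var 1)) (.plus .noiseX .noiseY))) <|
     .seq bernoulli <|
      .ite .failed
        (.ite (.realLt .noiseX .noiseY)
          (.setNat 4 (.var 9) (.plus (.get 4 (.var 9)) (.const 1))) .skip)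
        (.setNat 2 (.var 9) .numQubits)))
  (.assign 7 (.plus (.var 7) (.const 1)))

/-- Labels every qubit by itself and then samples the noise on all qubits after all layers. -/
def noisePhase : Prog :=
  .seq (.for 6 .numQubits (.setNat 2 (.var 6) (.var 6)))
    (.for 8 .depth (.for 9 .numQubits sampleNoise))

/-- Identifies the labels in variables `17` and `18`. -/
def relabel : Prog :=
  .for 16 .numQubits (.ite (.natEq (.get 2 (.var 16)) (.var 17))
    (.setNat 2 (.var 16) (.var 18)) .skip)

/-- Merges the labels of all qubits that are not dephased and belong to a common gate. -/
def mergePhase : Prog :=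
  .for 12 .depth <| .for 13 (.gateCount (.var 12)) <|
  .for 14 (.gateArity (.var 12) (.var 13)) <| .for 15 (.gateArity (.var 12) (.var 13)) <|
  .seq (.assign 17 (.get 2 (.gateQubit (.var 12) (.var 13) (.var 14)))) <|
  .seq (.assign 18 (.get 2 (.gateQubit (.var 12) (.var 13) (.var 15)))) <|
  .ite (.and (.natLt (.var 17) .numQubits) (.natLt (.var 18) .numQubits)) relabel .skip

/-- Flips the cells of array `0` at the qubits with the label in variable `19`. -/
def flipBlock : Prog :=
  .for 6 .numQubits (.ite (.natEq (.get 2 (.var 6)) (.var 19)) (.flip 0 (.var 6)) .skip)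

/-- Flips all cells of array `a`. -/
def flipAll (a : ℕ) : Prog := .for 6 .numQubits (.flip a (.var 6))

/-- Variable `21` becomes `2 ^ s` and real variable `6` becomes `4 ^ s`, where `s` is the size of
the block with the label in variable `19`. -/
def blockPowers : Prog :=
  .seq (.assign 21 (.const 1)) <| .seq (.assignReal 6 (.const 1)) <|
  .for 22 .numQubits (.ite (.natEq (.get 2 (.var 22)) (.var 19))
    (.seq (.assign 21 (.plus (.var 21) (.var 21)))
      (.assignReal 6 (.times (.const 4) (.var 6)))) .skip)

/-- Writes into array `5` the string that has the binary digits of variable `23` in the block and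
coincides with array `1` elsewhere; the pair `(2, 3)` of real variables becomes the sign with which
this string contributes to the amplitude. -/
def decode : Prog :=
  .seq (.assign 24 (.var 23)) <| .seq (.assignReal 2 (.const 1)) <|
  .seq (.assignReal 3 (.const 0)) <|
  .for 25 .numQubits (.ite (.natEq (.get 2 (.var 25)) (.var 19))
    (.seq (.setNat 5 (.var 25) (NExp.parity (.var 24))) <|
     .seq (.assign 24 (.half (.var 24))) <|
      .ite (.and (.odd (.get 5 (.var 25))) (.odd (.plus (.get 0 (.var 25)) (.get 4 (.var 25)))))
        (.assignReal 2 (.minus (.const 0) (.var 2))) .skip)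
    (.setNat 5 (.var 25) (.get 1 (.var 25))))

/-- Variable `29` becomes the number of the diagonal entry of gate `27` of layer `26` at the string
in array `5`, shifted by the earlier flips in array `3`; variable `31` holds the offset of the
layer in this array. -/
def gateIndex : Prog :=
  .seq (.assign 29 (.const 0)) <| .seq (.assign 30 (.const 1)) <|
  .for 28 (.gateArity (.var 26) (.var 27)) <|
  .seq (.ite (.odd (.plus (.get 5 (.gateQubit (.var 26) (.var 27) (.var 28)))
      (.get 3 (.plus (.var 31) (.gateQubit (.var 26) (.var 27) (.var 28))))))
    (.assign 29 (.plus (.var 29) (.var 30))) .skip) <|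
  .assign 30 (.plus (.var 30) (.var 30))

/-- Multiplies the complex number in the real variables `2`, `3` by the current diagonal entry. -/
def multiplyGate : Prog :=
  .seq (.assignReal 7 (.minus
    (.times (.var 2) (.gateRe (.var 26) (.var 27) (.var 29)))
    (.times (.var 3) (.gateIm (.var 26) (.var 27) (.var 29))))) <|
  .seq (.assignReal 3 (.plus
    (.times (.var 2) (.gateIm (.var 26) (.var 27) (.var 29)))
    (.times (.var 3) (.gateRe (.var 26) (.var 27) (.var 29))))) <|
  .assignReal 2 (.var 7)

/-- Multiplies the complex number in the real variables `2`, `3` by the phase that the gates give to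
the string in array `5`. -/
def multiplyPhase : Prog :=
  .seq (.assign 31 (.const 0)) <|
  .for 26 .depth <|
    .seq (.for 27 (.gateCount (.var 26)) (.seq gateIndex multiplyGate))
      (.assign 31 (.plus (.var 31) .numQubits))

/-- The real variables `4`, `5` become the sum of all contributions to the amplitude. -/
def blockAmplitude : Prog :=
  .seq (.assignReal 4 (.const 0)) <| .seq (.assignReal 5 (.const 0)) <|
  .for 23 (.var 21) <| .seq decode <| .seq multiplyPhase <|
  .seq (.assignReal 4 (.plus (.var 4) (.var 2))) (.assignReal 5 (.plus (.var 5) (.var 3)))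

/-- One round of rejection sampling for the block with the label in variable `19`. -/
def tryBlock : Prog :=
  .seq flipBlock <| .seq blockPowers <| .seq blockAmplitude <|
  .seq (.assignReal 0 (.quot
    (.plus (.times (.var 4) (.var 4)) (.times (.var 5) (.var 5))) (.var 6))) <|
  .seq bernoulli (.ite .failed .skip (.assign 20 (.const 1)))

/-- Rejection sampling of the block with the label in variable `19`. -/
def sampleBlock : Prog :=
  .seq (.assign 20 (.const 0)) (.while (.natLt (.var 20) (.const 1)) tryBlock)

/-- The sampling program: the noise is drawn, the connected components of the qubits that are not
dephased are found, and the outcomes are drawn component by component. -/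
def sampler : Prog :=
  .seq noisePhase <| .seq mergePhase <| .seq (flipAll 1) <| .seq (flipAll 0) <|
    .for 19 .numQubits sampleBlock

/-! ### Bernoulli sampling -/

section Bernoulli

variable {n d k : ℕ} {C : Circuit n d k} {N : PauliNoise} {ε : ℝ≥0∞}

theorem half_mul_two (a : ℝ≥0∞) : 2⁻¹ * (a + a) = a := by
  rw [← two_mul, ← mul_assoc, ENNReal.inv_mul_cancel two_ne_zero ENNReal.ofNat_ne_top, one_mul]

theorem ert_flip_seq_le {a : ℕ} {i : NExp} {q : Prog} {X : Mem → ℝ≥0∞} {m : Mem} {c : ℕ}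
    {e₀ e₁ : ℝ≥0∞} (h₀ : ert C N ε q X (m.setNat a (i.eval C m) 0) ≤ ε * c + e₀)
    (h₁ : ert C N ε q X (m.setNat a (i.eval C m) 1) ≤ ε * c + e₁) :
    ert C N ε (.seq (.flip a i) q) X m ≤ ε * (i.cost + 2 + c : ℕ) + 2⁻¹ * (e₀ + e₁) := by
  refine ert_seq_le ((add_le_add_right (add_le_add_right (mul_le_mul_right
    (add_le_add h₀ h₁) _) _) _).trans (le_of_eq ?_))
  rw [add_add_add_comm, mul_add, half_mul_two]
  simp only [Prog.stepCost]
  push_cast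
  ring

theorem half_mix_left {x : ℝ} (h0 : 0 ≤ x) (h1 : 2 * x ≤ 1) (a b : ℝ≥0∞) :
    2⁻¹ * ((ENNReal.ofReal (x + x) * a + ENNReal.ofReal (1 - (x + x)) * b) + b)
      = ENNReal.ofReal x * a + ENNReal.ofReal (1 - x) * b := by
  have e1 : ENNReal.ofReal (1 - x) + ENNReal.ofReal (1 - x) = ENNReal.ofReal (1 - (x + x)) + 1 := by
    rw [← ENNReal.ofReal_one, ← ENNReal.ofReal_add, ← ENNReal.ofReal_add] <;> first | linarith | skip
    congr 1; ring
  rw [add_assoc, ← add_one_mul, ← e1, ENNReal.ofReal_add h0 h0, ← half_mul_two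
    (ENNReal.ofReal x * a + ENNReal.ofReal (1 - x) * b)]
  ring

theorem half_mix_right {x : ℝ} (h0 : 1 ≤ 2 * x) (h1 : x ≤ 1) (a b : ℝ≥0∞) :
    2⁻¹ * (a + (ENNReal.ofReal (x + x - 1) * a + ENNReal.ofReal (1 - (x + x - 1)) * b))
      = ENNReal.ofReal x * a + ENNReal.ofReal (1 - x) * b := by
  have := half_mix_left (x := 1 - x) (by linarith) (by linarith) b a
  rw [show 1 - x + (1 - x) = 1 - (x + x - 1) by ring, show 1 - (1 - (x + x - 1)) = x + x - 1 by ring,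
    show 1 - (1 - x) = x by ring] at this
  rw [add_comm (ENNReal.ofReal x * a), ← this]
  congr 1
  ring

theorem ert_bernoulli_body_le (Y : Mem → ℝ≥0∞) (m : Mem) :
    ert C N ε (.seq (.flip 11 (.const 0))
      (.ite (.natLt (.const 0) (.var 11))
        (.assignReal 0 (.minus (.plus (.var 0) (.var 0)) (.const 1)))
        (.assignReal 0 (.plus (.var 0) (.var 0))))) Y m
      ≤ ε * (6 * n ^ 2 + 11 : ℕ)
        + 2⁻¹ * (Y ((m.setNat 11 0 0).setReal 0 0 (m.real 0 0 + m.real 0 0))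
          + Y ((m.setNat 11 0 1).setReal 0 0 (m.real 0 0 + m.real 0 0 - 1))) := by
  rw [show 6 * n ^ 2 + 11 = (NExp.const 0).cost + 2 + (6 * n ^ 2 + 8) by
    simp only [NExp.cost]; omega]
  refine ert_flip_seq_le ?_ ?_
  · refine ((Det.ite (c := 6 * n ^ 2 + 3) (Q := fun m'' => m'' =
      (m.setNat 11 0 0).setReal 0 0 (m.real 0 0 + m.real 0 0)) (fun h => ?_) fun h => ?_).mono ?_
      fun _ _ h => h) ε Y _ (fun m'' h => by rw [h])
    · simp [BExp.Holds, NExp.eval] at h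
    · refine (Det.setReal ?_).mono ?_ fun _ _ h => h
      · simp [RExp.eval, NExp.eval]
      · simp only [RExp.cost, NExp.cost]; omega
    · simp only [BExp.cost, NExp.cost]; omega
  · refine ((Det.ite (c := 6 * n ^ 2 + 3) (Q := fun m'' => m'' =
      (m.setNat 11 0 1).setReal 0 0 (m.real 0 0 + m.real 0 0 - 1)) (fun h => ?_)
      fun h => ?_).mono ?_ fun _ _ h => h) ε Y _ (fun m'' h => by rw [h])
    · refine (Det.setReal ?_).mono ?_ fun _ _ h => h
      · simp [RExp.eval, NExp.eval]
      · simp only [RExp.cost, NExp.cost]; omega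
    · simp [BExp.Holds, NExp.eval] at h
    · simp only [BExp.cost, NExp.cost]; omega

/-- The Bernoulli loop: `a` bounds the value after success and `b` the value after failure. -/
theorem ert_bernoulli_le {X : Mem → ℝ≥0∞} {m : Mem} {a b : ℝ≥0∞}
    (h0 : 0 ≤ m.real 0 0) (h1 : m.real 0 0 ≤ 1)
    (hX : ∀ m', Agree bernoulli m m' → X m' ≤ if m'.real 0 0 < 1 then b else a) :
    ert C N ε bernoulli X m ≤ ε * (30 * n ^ 2 + 34 : ℕ)
      + (ENNReal.ofReal (m.real 0 0) * a + ENNReal.ofReal (1 - m.real 0 0) * b) := by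
  classical
  -- The invariant: `x * a + (1 - x) * b` is a martingale, and in `(0, 1)` the remaining cost `30 n ^ 2 + 34`
  -- pays for a round, which costs at most `12 n ^ 2 + 15`, for one half of the last test, which costs
  -- `6 n ^ 2 + 4`, and for one half of itself.
  set Y : Mem → ℝ≥0∞ := fun m' => if Agree bernoulli m m' then
    (if 0 < m'.real 0 0 ∧ m'.real 0 0 < 1 then ε * (30 * n ^ 2 + 34 : ℕ)
      + (ENNReal.ofReal (m'.real 0 0) * a + ENNReal.ofReal (1 - m'.real 0 0) * b)
     else ε * (6 * n ^ 2 + 4 : ℕ) + if m'.real 0 0 < 1 then b else a) else ⊤ with hY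
  have hcost : (6 * n ^ 2 + 4 : ℕ) ≤ 30 * n ^ 2 + 34 := by omega
  have hYm : Y m ≤ ε * (30 * n ^ 2 + 34 : ℕ)
      + (ENNReal.ofReal (m.real 0 0) * a + ENNReal.ofReal (1 - m.real 0 0) * b) := by
    simp only [hY, Agree.refl, if_true]
    split_ifs with h h'
    · exact le_rfl
    · have : m.real 0 0 = 0 := le_antisymm (not_lt.1 fun h'' => h ⟨h'', h'⟩) h0
      rw [this]
      simp only [ENNReal.ofReal_zero, zero_mul, sub_zero, ENNReal.ofReal_one, one_mul, zero_add]
      gcongr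
    · have : m.real 0 0 = 1 := le_antisymm h1 (not_lt.1 h')
      rw [this]
      simp only [ENNReal.ofReal_zero, zero_mul, sub_self, ENNReal.ofReal_one, one_mul, add_zero]
      gcongr
  refine le_trans (ert_while_le (Y := Y) (fun m' hm' hb => ?_) (fun m' hm' hb => ?_) m) hYm
  · have hA : Agree bernoulli m m' := by
      by_contra h
      exact hm' (if_neg h)
    have hx : 0 < m'.real 0 0 ∧ m'.real 0 0 < 1 := by
      simpa [BExp.Holds, RExp.eval, NExp.eval] using hb
    have hAc : ∀ c x, Agree bernoulli m ((m'.setNat 11 0 c).setReal 0 0 x) := fun c x =>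
      hA.trans ⟨fun a' ha' => by
        have : a' ≠ 11 := by rintro rfl; simp [bernoulli, Prog.writesNat] at ha'
        simp [this], fun a' ha' => by
        have : a' ≠ 0 := by rintro rfl; simp [bernoulli, Prog.writesReal] at ha'
        simp [this]⟩
    set x := m'.real 0 0 with hxdef
    have e0 : Y ((m'.setNat 11 0 0).setReal 0 0 (x + x)) ≤
        if 2 * x ≤ 1 then ε * (30 * n ^ 2 + 34 : ℕ)
          + (ENNReal.ofReal (x + x) * a + ENNReal.ofReal (1 - (x + x)) * b)
        else ε * (6 * n ^ 2 + 4 : ℕ) + a := by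
      simp only [hY, hAc, if_true, Mem.setReal_real, Function.update_self]
      by_cases h : x = 1 / 2
      · norm_num [h]
        gcongr <;> norm_num
      · grind
    have e1 : Y ((m'.setNat 11 0 1).setReal 0 0 (x + x - 1)) ≤
        if 2 * x ≤ 1 then ε * (6 * n ^ 2 + 4 : ℕ) + b else ε * (30 * n ^ 2 + 34 : ℕ)
          + (ENNReal.ofReal (x + x - 1) * a + ENNReal.ofReal (1 - (x + x - 1)) * b) := by
      simp only [hY, hAc, if_true, Mem.setReal_real, Function.update_self]
      grind
    have hstep := ert_bernoulli_body_le (C := C) (N := N) (ε := ε) Y m'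
    rw [← hxdef] at hstep
    refine (add_le_add le_rfl (hstep.trans (add_le_add le_rfl (mul_le_mul_right
      (add_le_add e0 e1) _)))).trans (le_of_eq ?_)
    have hsum : ∀ u : ℝ≥0∞,
        ε * (6 * n ^ 2 + 4 : ℕ) + (ε * (6 * n ^ 2 + 11 : ℕ)
          + (2⁻¹ * (ε * (30 * n ^ 2 + 34 : ℕ) + ε * (6 * n ^ 2 + 4 : ℕ)) + u))
        = ε * (30 * n ^ 2 + 34 : ℕ) + u := by
      intro u
      rw [← mul_add ε, ← Nat.cast_add, show 30 * n ^ 2 + 34 + (6 * n ^ 2 + 4)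
        = (18 * n ^ 2 + 19) + (18 * n ^ 2 + 19) by ring, Nat.cast_add (18 * n ^ 2 + 19), mul_add ε,
        half_mul_two,
        ← add_assoc, ← add_assoc, ← mul_add, ← mul_add, ← Nat.cast_add, ← Nat.cast_add]
      congr 3
      omega
    have hYm' : Y m' = ε * (30 * n ^ 2 + 34 : ℕ)
        + (ENNReal.ofReal x * a + ENNReal.ofReal (1 - x) * b) := by
      simp only [hY, hA, if_true, ← hxdef, if_pos hx]
    have hcost' : ∀ q, (Prog.stepCost (n ^ 2) (.while (.and (.realLt (.const 0) (.var 0))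
        (.realLt (.var 0) (.const 1))) q)) = 6 * n ^ 2 + 4 := by
      intro q
      simp only [Prog.stepCost, BExp.cost, RExp.cost, NExp.cost]
      omega
    rw [hYm', hcost']
    refine Eq.trans (congr_arg₂ _ rfl (congr_arg₂ _ rfl ?_)) (hsum _)
    rcases le_or_gt (2 * x) 1 with h | h
    · rw [if_pos h, if_pos h, ← half_mix_left hx.1.le h, ← mul_add]
      congr 1
      ring
    · rw [if_neg h.not_ge, if_neg h.not_ge, ← half_mix_right h.le hx.2.le, ← mul_add]
      congr 1
      ring
  · have hA : Agree bernoulli m m' := by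
      by_contra h
      exact hm' (if_neg h)
    have hx : ¬ (0 < m'.real 0 0 ∧ m'.real 0 0 < 1) := by
      simpa [BExp.Holds, RExp.eval, NExp.eval] using hb
    simp only [hY, hA, if_true, if_neg hx]
    refine add_le_add ?_ (hX m' hA)
    gcongr
    simp only [Prog.stepCost, BExp.cost, RExp.cost, NExp.cost]
    omega

end Bernoulli

/-! ### Averages over bit strings -/

section Average

variable {n : ℕ} {M : Type*} [AddCommMonoid M] [Module ℝ≥0 M]

/-- The uniform average over all bit strings of length `n`. Strings on a part `P` of the qubits are
not encoded separately: they are the values on `P` of strings of length `n`, and `P.piecewise y u`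
replaces the part of `u` on `P`. -/
def avg (f : Bits n → M) : M := ((2 : ℝ≥0)⁻¹ ^ n) • ∑ y, f y

theorem avg_add (f g : Bits n → M) : avg (fun y => f y + g y) = avg f + avg g := by
  simp only [avg, Finset.sum_add_distrib, smul_add]

@[simp] theorem avg_const (a : M) : avg (fun _ : Bits n => a) = a := by
  simp only [avg, Finset.sum_const, Finset.card_univ, Fintype.card_pi, Fintype.card_fin,
    Finset.prod_const]
  rw [← Nat.cast_smul_eq_nsmul ℝ≥0, smul_smul]
  simp

theorem avg_smul (c : ℝ≥0) (f : Bits n → M) : avg (fun y => c • f y) = c • avg f := by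
  simp only [avg, ← Finset.smul_sum]
  rw [smul_comm]

theorem avg_comm {m : ℕ} (f : Bits n → Bits m → M) :
    avg (fun x => avg fun y => f x y) = avg fun y => avg fun x => f x y := by
  simp only [avg, ← Finset.smul_sum]
  rw [Finset.sum_comm, smul_comm]

theorem avg_equiv (e : Bits n ≃ Bits n) (f : Bits n → M) : avg (fun y => f (e y)) = avg f := by
  simp only [avg, e.sum_comp]

theorem avg_add_right (z : Bits n) (f : Bits n → M) : avg (fun y => f (y + z)) = avg f :=
  avg_equiv (Equiv.addRight z) f

theorem avg_mul_left {A : Type*} [Semiring A] [Algebra ℝ≥0 A] (a : A) (f : Bits n → A) :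
    avg (fun y => a * f y) = a * avg f := by
  simp only [avg, ← Finset.mul_sum, mul_smul_comm]

theorem avg_mul_right {A : Type*} [Semiring A] [Algebra ℝ≥0 A] (a : A) (f : Bits n → A) :
    avg (fun y => f y * a) = avg f * a := by
  simp only [avg, ← Finset.sum_mul, smul_mul_assoc]

theorem ofReal_avg {f : Bits n → ℝ} (h : ∀ y, 0 ≤ f y) :
    ENNReal.ofReal (avg f) = avg fun y => ENNReal.ofReal (f y) := by
  simp only [avg, NNReal.smul_def, smul_eq_mul, ENNReal.smul_def]
  rw [ENNReal.ofReal_mul (by positivity), ENNReal.ofReal_sum_of_nonneg fun y _ => h y]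
  simp

theorem avg_nonneg {f : Bits n → ℝ} (h : ∀ y, 0 ≤ f y) : 0 ≤ avg f := by
  simp only [avg, NNReal.smul_def, smul_eq_mul]
  have := Finset.sum_nonneg fun y (_ : y ∈ Finset.univ) => h y
  positivity

theorem ofReal_avg_complex (f : Bits n → ℝ) :
    ((avg f : ℝ) : ℂ) = avg fun y => (f y : ℂ) := by
  simp only [avg, NNReal.smul_def, smul_eq_mul, Complex.real_smul]
  push_cast
  rfl

/-- Exchanging the parts of two independent strings on `P` does not change an average. -/
theorem avg_avg_piecewise (P : Finset (Fin n)) (f : Bits n → Bits n → M) :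
    avg (fun x => avg fun y => f (P.piecewise x y) (P.piecewise y x))
      = avg fun x => avg fun y => f x y := by
  simp only [avg, ← Finset.smul_sum, ← Fintype.sum_prod_type']
  congr 2
  have hinv : Function.Involutive
      fun q : Bits n × Bits n => (P.piecewise q.1 q.2, P.piecewise q.2 q.1) := by
    rintro ⟨x, y⟩
    ext v <;> by_cases hv : v ∈ P <;> simp [hv]
  exact Equiv.sum_comp hinv.toPerm fun q : Bits n × Bits n => f q.1 q.2

theorem avg_update (v : Fin n) (f : Bits n → M) :
    avg f = (2 : ℝ≥0)⁻¹ • (avg (fun y => f (Function.update y v 0))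
      + avg fun y => f (Function.update y v 1)) := by
  have hinv : Function.Involutive
      fun q : Fin 2 × Bits n => (q.2 v, Function.update q.2 v q.1) := by
    rintro ⟨x, y⟩
    ext <;> simp
  have := Equiv.sum_comp hinv.toPerm fun q : Fin 2 × Bits n => f q.2
  rw [Fintype.sum_prod_type, Fintype.sum_prod_type] at this
  simp only [Function.Involutive.coe_toPerm, Fin.sum_univ_two] at this
  simp only [avg, ← smul_add]
  rw [this, ← two_smul ℝ≥0, smul_comm ((2 : ℝ≥0)⁻¹), smul_smul (2 : ℝ≥0)⁻¹ 2,
    inv_mul_cancel₀ two_ne_zero, one_smul]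

/-- To randomize a string on `P`, randomize the bit at `v` first. -/
theorem avg_piecewise_update {P : Finset (Fin n)} {v : Fin n} (hv : v ∈ P) (f : Bits n → M)
    (u : Bits n) :
    avg (fun y => f (P.piecewise y u))
      = (2 : ℝ≥0)⁻¹ • (avg (fun y => f ((P.erase v).piecewise y (Function.update u v 0)))
        + avg fun y => f ((P.erase v).piecewise y (Function.update u v 1))) := by
  rw [avg_update v]
  congr 2 <;>
  · congr 1
    funext y
    congr 1
    funext w
    by_cases hw : w = v
    · subst hw; simp [hv]
    · by_cases hP : w ∈ P <;> simp [hw, hP]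

theorem avg_prod {A : Type*} [CommSemiring A] [Algebra ℝ≥0 A] (f : Fin n → Fin 2 → A) :
    avg (fun y : Bits n => ∏ v, f v (y v)) = ∏ v, (2 : ℝ≥0)⁻¹ • (f v 0 + f v 1) := by
  have h := Finset.prod_univ_sum (fun _ : Fin n => (Finset.univ : Finset (Fin 2))) f
  simp only [Fintype.piFinset_univ, Fin.sum_univ_two] at h
  simp only [avg]
  rw [← h, Finset.prod_smul]
  simp

end Average

/-! ### Amplitudes of blocks of qubits -/

section Amplitude

variable {n : ℕ}

/-- The sign `(-1) ^ a`. -/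
def sgn (a : Fin 2) : ℂ := if a = 0 then 1 else -1

@[simp] theorem sgn_zero : sgn 0 = 1 := rfl

@[simp] theorem sgn_one : sgn 1 = -1 := rfl

theorem sgn_add (a b : Fin 2) : sgn (a + b) = sgn a * sgn b := by
  fin_cases a <;> fin_cases b <;> simp [sgn]

@[simp] theorem sgn_mul_self (a : Fin 2) : sgn a * sgn a = 1 := by
  fin_cases a <;> simp [sgn]

@[simp] theorem conj_sgn (a : Fin 2) : (starRingEnd ℂ) (sgn a) = sgn a := by
  fin_cases a <;> simp [sgn]

/-- The character `x ↦ (-1) ^ (∑ v ∈ P, b v * x v)`. -/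
def chi (P : Finset (Fin n)) (b x : Bits n) : ℂ := ∏ v ∈ P, sgn (b v * x v)

theorem chi_add_right (P : Finset (Fin n)) (b x y : Bits n) :
    chi P b (x + y) = chi P b x * chi P b y := by
  simp only [chi, Pi.add_apply, mul_add, sgn_add, Finset.prod_mul_distrib]

theorem chi_add_left (P : Finset (Fin n)) (b c x : Bits n) :
    chi P (b + c) x = chi P b x * chi P c x := by
  simp only [chi, Pi.add_apply, add_mul, sgn_add, Finset.prod_mul_distrib]

@[simp] theorem chi_mul_self (P : Finset (Fin n)) (b x : Bits n) : chi P b x * chi P b x = 1 := by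
  simp only [chi, ← Finset.prod_mul_distrib, sgn_mul_self, Finset.prod_const_one]

@[simp] theorem conj_chi (P : Finset (Fin n)) (b x : Bits n) :
    (starRingEnd ℂ) (chi P b x) = chi P b x := by
  simp [chi]

@[simp] theorem norm_chi (P : Finset (Fin n)) (b x : Bits n) : ‖chi P b x‖ = 1 := by
  have h : ‖chi P b x‖ * ‖chi P b x‖ = 1 := by rw [← norm_mul, chi_mul_self, norm_one]
  nlinarith [norm_nonneg (chi P b x)]

theorem chi_congr {P : Finset (Fin n)} {b b' x x' : Bits n} (hb : ∀ v ∈ P, b v = b' v)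
    (hx : ∀ v ∈ P, x v = x' v) : chi P b x = chi P b' x' :=
  Finset.prod_congr rfl fun v hv => by rw [hb v hv, hx v hv]

theorem chi_union {P Q : Finset (Fin n)} (h : Disjoint P Q) (b x : Bits n) :
    chi (P ∪ Q) b x = chi P b x * chi Q b x := Finset.prod_union h

/-- Orthogonality of characters. -/
theorem avg_chi_mul_chi (P : Finset (Fin n)) (x y : Bits n) :
    avg (fun b => chi P b x * chi P b y) = if ∀ v ∈ P, x v = y v then 1 else 0 := by
  have h : ∀ b : Bits n, chi P b x * chi P b y
      = ∏ v, if v ∈ P then sgn (b v * (x v + y v)) else 1 := by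
    intro b
    rw [← chi_add_right, chi, Finset.prod_ite_mem, Finset.univ_inter]
    rfl
  simp only [h]
  rw [avg_prod fun v a => if v ∈ P then sgn (a * (x v + y v)) else 1]
  have h2 : ∀ v, (2 : ℝ≥0)⁻¹ • ((if v ∈ P then sgn (0 * (x v + y v)) else 1)
      + if v ∈ P then sgn (1 * (x v + y v)) else 1) = if v ∈ P → x v = y v then 1 else 0 := by
    intro v
    by_cases hv : v ∈ P
    · have : ∀ a b : Fin 2, (2 : ℝ≥0)⁻¹ • (sgn (0 * (a + b)) + sgn (1 * (a + b)))
          = if a = b then 1 else 0 := by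
        intro a b
        fin_cases a <;> fin_cases b <;> simp [NNReal.smul_def, one_add_one_eq_two]
      rw [if_pos hv, if_pos hv, this]
      simp [hv]
    · simp [hv, NNReal.smul_def, one_add_one_eq_two]
  simp only [h2]
  rw [Finset.prod_ite_zero]
  simp

theorem avg_indicator_eq {A : Type*} [CommSemiring A] [Algebra ℝ≥0 A] (P : Finset (Fin n))
    (x : Bits n) :
    avg (fun y : Bits n => if ∀ v ∈ P, y v = x v then (1 : A) else 0)
      = ((2 : ℝ≥0)⁻¹ ^ P.card) • 1 := by
  have h : ∀ y : Bits n, (if ∀ v ∈ P, y v = x v then (1 : A) else 0)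
      = ∏ v, if v ∈ P → y v = x v then 1 else 0 := by
    intro y
    rw [Finset.prod_ite_zero]
    simp
  simp only [h]
  rw [avg_prod fun v a => if v ∈ P → a = x v then (1 : A) else 0]
  have h2 : ∀ v, (2 : ℝ≥0)⁻¹ • ((if v ∈ P → 0 = x v then (1 : A) else 0)
      + if v ∈ P → 1 = x v then 1 else 0) = if v ∈ P then (2 : ℝ≥0)⁻¹ • 1 else 1 := by
    intro v
    by_cases hv : v ∈ P
    · have : ∀ a : Fin 2, (if 0 = a then (1 : A) else 0) + (if 1 = a then 1 else 0) = 1 := by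
        intro a
        fin_cases a <;> simp
      simp [hv, this]
    · simp only [hv, false_imp_iff, if_true, if_false]
      rw [← two_smul ℝ≥0, smul_smul, inv_mul_cancel₀ two_ne_zero, one_smul]
  simp only [h2]
  rw [Finset.prod_ite_mem, Finset.univ_inter, Finset.prod_const, smul_pow, one_pow]

/-- The amplitude with which the qubits in `P`, prepared in the state `|+⟩` and followed by the
diagonal operator `G` with all other qubits in the basis state `u`, have the outcome `b`. -/
def amp (P : Finset (Fin n)) (G : Bits n → ℂ) (b u : Bits n) : ℂ :=
  avg fun y => chi P b y * G (P.piecewise y u)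

variable {G : Bits n → ℂ}

theorem amp_congr {P : Finset (Fin n)} {b b' : Bits n} (hb : ∀ v ∈ P, b v = b' v) (u : Bits n) :
    amp P G b u = amp P G b' u := by
  simp only [amp]
  congr 1
  funext y
  rw [chi_congr hb fun _ _ => rfl]

theorem amp_mul_conj (P : Finset (Fin n)) (G : Bits n → ℂ) (b u : Bits n) :
    ((‖amp P G b u‖ ^ 2 : ℝ) : ℂ) = avg fun x => avg fun y => chi P b x * chi P b y *
      (G (P.piecewise x u) * (starRingEnd ℂ) (G (P.piecewise y u))) := by
  rw [← Complex.normSq_eq_norm_sq, Complex.normSq_eq_conj_mul_self, mul_comm]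
  have h : (starRingEnd ℂ) (amp P G b u)
      = avg fun y => chi P b y * (starRingEnd ℂ) (G (P.piecewise y u)) := by
    simp only [amp, avg, NNReal.smul_def, Complex.real_smul, map_mul, map_sum, conj_chi,
      Complex.conj_ofReal]
  rw [h]
  conv_lhs => rw [amp]
  rw [← avg_mul_right]
  congr 1
  funext x
  rw [← avg_mul_left]
  congr 1
  funext y
  ring

theorem norm_avg_le_one {f : Bits n → ℂ} (h : ∀ y, ‖f y‖ ≤ 1) : ‖avg f‖ ≤ 1 := by
  have : ‖avg f‖ ≤ avg fun y => ‖f y‖ := by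
    simp only [avg, NNReal.smul_def]
    rw [norm_smul, Real.norm_of_nonneg (by positivity), smul_eq_mul]
    gcongr
    exact norm_sum_le _ _
  refine this.trans ?_
  rw [← avg_const (n := n) (1 : ℝ)]
  simp only [avg, NNReal.smul_def, smul_eq_mul]
  gcongr
  exact h _

theorem norm_amp_le_one (hG : ∀ x, ‖G x‖ = 1) (P : Finset (Fin n)) (b u : Bits n) :
    ‖amp P G b u‖ ≤ 1 :=
  norm_avg_le_one fun y => by simp [hG]

theorem self_mul_conj_of_norm_one {z : ℂ} (h : ‖z‖ = 1) : z * (starRingEnd ℂ) z = 1 := by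
  rw [mul_comm, ← Complex.normSq_eq_conj_mul_self, Complex.normSq_eq_norm_sq, h]
  simp

/-- A uniformly random outcome is accepted with probability `2 ^ (-s)` in a block of size `s`. -/
theorem avg_norm_amp_sq (hG : ∀ x, ‖G x‖ = 1) (P : Finset (Fin n)) (u : Bits n) :
    avg (fun b => ‖amp P G b u‖ ^ 2) = (2⁻¹ : ℝ) ^ P.card := by
  have h : ((avg fun b => ‖amp P G b u‖ ^ 2 : ℝ) : ℂ)
      = avg fun x => avg fun y => if ∀ v ∈ P, y v = x v then (1 : ℂ) else 0 := by
    rw [ofReal_avg_complex]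
    simp only [amp_mul_conj]
    rw [avg_comm]
    congr 1
    funext x
    rw [avg_comm]
    congr 1
    funext y
    rw [avg_mul_right, avg_chi_mul_chi]
    simp only [eq_comm (a := y _)]
    split_ifs with hxy
    · rw [show P.piecewise x u = P.piecewise y u from ?_, self_mul_conj_of_norm_one (hG _), one_mul]
      ext v
      by_cases hv : v ∈ P <;> simp [hv, hxy]
    · rw [zero_mul]
  simp only [avg_indicator_eq, avg_const] at h
  have h' : ((avg fun b => ‖amp P G b u‖ ^ 2 : ℝ) : ℂ) = (((2⁻¹ : ℝ) ^ P.card : ℝ) : ℂ) := by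
    rw [h]
    simp [NNReal.smul_def]
  exact_mod_cast h'

/-- Amplitudes multiply over two blocks that `G` does not couple. -/
theorem norm_amp_union (hG : ∀ x, ‖G x‖ = 1) {P Q : Finset (Fin n)} (hPQ : Disjoint P Q)
    (b u : Bits n) (hfac : ∀ y, G ((P ∪ Q).piecewise y u) * G u
      = G (P.piecewise y u) * G (Q.piecewise y u)) :
    ‖amp (P ∪ Q) G b u‖ = ‖amp P G b u‖ * ‖amp Q G b u‖ := by
  have hQP : ∀ v ∈ Q, v ∉ P := fun v hv hv' => Finset.disjoint_left.1 hPQ hv' hv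
  have h : amp (P ∪ Q) G b u * G u = amp P G b u * amp Q G b u := by
    have h1 : amp (P ∪ Q) G b u * G u = avg fun x : Bits n => avg fun y : Bits n =>
        (chi P b (P.piecewise x y) * G (P.piecewise (P.piecewise x y) u))
          * (chi Q b (P.piecewise x y) * G (Q.piecewise (P.piecewise x y) u)) := by
      have h2 := avg_avg_piecewise (M := ℂ) P fun x _ =>
        (chi P b x * G (P.piecewise x u)) * (chi Q b x * G (Q.piecewise x u))
      simp only [avg_const] at h2
      rw [h2, amp, ← avg_mul_right]
      congr 1
      funext y
      rw [chi_union hPQ, mul_assoc, hfac]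
      ring
    -- Both sides are averages over two strings, of which one is used on `P` and the other one on `Q`.
    rw [h1]
    conv_rhs => rw [amp, ← avg_mul_right]
    congr 1
    funext x
    rw [amp, ← avg_mul_left]
    congr 1
    funext y
    have e1 : P.piecewise (P.piecewise x y) u = P.piecewise x u := by
      ext v; by_cases hv : v ∈ P <;> simp [hv]
    have e2 : Q.piecewise (P.piecewise x y) u = Q.piecewise y u := by
      ext v; by_cases hv : v ∈ Q <;> simp [hv, hQP]
    rw [e1, e2, chi_congr (x := P.piecewise x y) (x' := x) (fun _ _ => rfl) (by simp +contextual),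
      chi_congr (x := P.piecewise x y) (x' := y) (P := Q) (fun _ _ => rfl)
        (by simp +contextual [hQP])]
  -- The amplitudes multiply only up to the phase `G u`.
  have h3 := congr_arg norm h
  rwa [norm_mul, norm_mul, hG, mul_one] at h3

/-- The outcome distribution when the qubits in `D` are dephased: they are replaced by uniformly
random bits, before and after the circuit. -/
theorem avg_dephased (D : Finset (Fin n)) (b c : Bits n) :
    (avg fun x => avg fun y => chi Finset.univ c x * chi Finset.univ c y *
      ((if ∀ v ∈ D, x v = y v then 1 else 0) * (G x * (starRingEnd ℂ) (G y))))
      = ((avg fun u : Bits n => avg fun B : Bits n =>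
        (if ∀ v ∈ D, B v = b v then (1 : ℝ) else 0) * ‖amp Dᶜ G c u‖ ^ 2 : ℝ) : ℂ) := by
  have split : ∀ f : Bits n → ℂ, avg f = avg fun u => avg fun x => f (Dᶜ.piecewise x u) := by
    intro f
    rw [avg_comm]
    simpa using (avg_avg_piecewise (M := ℂ) Dᶜ fun x _ => f x).symm
  -- The outcome on `D` has the probability `2 ^ (-|D|)`, as has the event that two strings agree on `D`.
  have h1 : (avg fun u : Bits n => avg fun B : Bits n =>
      (if ∀ v ∈ D, B v = b v then (1 : ℝ) else 0) * ‖amp Dᶜ G c u‖ ^ 2)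
      = ((2 : ℝ≥0)⁻¹ ^ D.card) • avg fun u : Bits n => ‖amp Dᶜ G c u‖ ^ 2 := by
    simp only [avg_mul_right, avg_indicator_eq, smul_mul_assoc, one_mul, avg_smul]
  rw [h1, NNReal.smul_def, smul_eq_mul, Complex.ofReal_mul, ofReal_avg_complex]
  simp only [amp_mul_conj]
  rw [← Complex.real_smul, ← NNReal.smul_def, split, ← avg_smul]
  congr 1
  funext u
  rw [← avg_smul]
  congr 1
  funext x
  rw [split, avg_comm, ← avg_smul]
  congr 1
  funext y
  have h2 : ∀ w : Bits n, chi Finset.univ c (Dᶜ.piecewise x u) * chi Finset.univ c (Dᶜ.piecewise y w)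
      * ((if ∀ v ∈ D, Dᶜ.piecewise x u v = Dᶜ.piecewise y w v then 1 else 0)
        * (G (Dᶜ.piecewise x u) * (starRingEnd ℂ) (G (Dᶜ.piecewise y w))))
      = (if ∀ v ∈ D, w v = u v then 1 else 0) * (chi Dᶜ c x * chi Dᶜ c y *
        (G (Dᶜ.piecewise x u) * (starRingEnd ℂ) (G (Dᶜ.piecewise y u)))) := by
    intro w
    have hc : (∀ v ∈ D, Dᶜ.piecewise x u v = Dᶜ.piecewise y w v) ↔ ∀ v ∈ D, w v = u v := by
      refine forall₂_congr fun v hv => ?_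
      simp [hv, eq_comm]
    simp only [hc]
    split_ifs with h
    · have e1 : Dᶜ.piecewise y w = Dᶜ.piecewise y u := by
        ext v; by_cases hv : v ∈ D <;> simp [hv, h]
      have e2 : ∀ x : Bits n, chi Finset.univ c (Dᶜ.piecewise x u) = chi Dᶜ c x * chi D c u := by
        intro x
        rw [show (Finset.univ : Finset (Fin n)) = Dᶜ ∪ D by rw [Finset.union_comm]; simp,
          chi_union (Finset.disjoint_left.2 fun v hv => by simpa using hv), chi_congr (x := Dᶜ.piecewise x u) (x' := x) (fun _ _ => rfl)
            (by simp +contextual), chi_congr (x := Dᶜ.piecewise x u) (x' := u) (P := D)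
            (fun _ _ => rfl) (by simp +contextual)]
      rw [e1, e2, e2]
      linear_combination (chi Dᶜ c x * chi Dᶜ c y * (G (Dᶜ.piecewise x u) *
        (starRingEnd ℂ) (G (Dᶜ.piecewise y u)))) * chi_mul_self D c u
    · simp
  simp only [h2]
  rw [avg_mul_right, avg_indicator_eq, smul_mul_assoc, one_mul]

end Amplitude

/-! ### Random noise patterns -/

/-- The noise on one qubit after one layer: whether the qubit is flipped, and whether it is
dephased. -/
abbrev Outcome : Type := Bool × Bool

/-- The outcome of the noise after every layer `t` on every qubit `v`. Only `t < d` and `v < n` matter;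
the natural numbers avoid bounds in the bookkeeping. -/
abbrev Pattern : Type := ℕ → ℕ → Outcome

/-- The pattern without noise. -/
def Pattern.none : Pattern := fun _ _ => (false, false)

/-- Changes the outcome at a position. -/
def Pattern.set (ω : Pattern) (i : ℕ × ℕ) (o : Outcome) : Pattern :=
  fun t v => if t = i.1 ∧ v = i.2 then o else ω t v

/-- The probabilities of the outcomes. The coherence `|0⟩⟨1|` of an unflipped qubit is multiplied by
`pI - pZ` and that of a flipped qubit by `pX - pY`; the rest of the weight is dephased. If `pX < pY`, a
flip without dephasing comes with a phase flip, which accounts for the sign of `pX - pY`. -/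
def PauliNoise.weight (N : PauliNoise) : Outcome → ℝ≥0
  | (false, false) => (1 - N.pX - N.pY - N.pZ - N.pZ).toNNReal
  | (false, true) => (2 * N.pZ).toNNReal
  | (true, false) => |N.pX - N.pY|.toNNReal
  | (true, true) => (2 * min N.pX N.pY).toNNReal

theorem sum_outcome {M : Type*} [AddCommMonoid M] (f : Outcome → M) :
    ∑ o, f o = f (false, false) + f (false, true) + (f (true, false) + f (true, true)) := by
  rw [Fintype.sum_prod_type, Fintype.sum_bool, Fintype.sum_bool, Fintype.sum_bool]
  rw [add_comm, add_comm (f (false, true)), add_comm (f (true, true))]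

theorem abs_sub_add_two_mul_min (a b : ℝ) : |a - b| + 2 * min a b = a + b := by
  rcases le_total a b with h | h
  · rw [min_eq_left h, abs_of_nonpos (by linarith)]; ring
  · rw [min_eq_right h, abs_of_nonneg (by linarith)]; ring

section Weight

variable (N : PauliNoise)

theorem PauliNoise.coe_weight_ff :
    (N.weight (false, false) : ℝ) = 1 - N.pX - N.pY - N.pZ - N.pZ :=
  Real.coe_toNNReal _ (by linarith [N.pX_nonneg, N.pY_nonneg, N.pZ_nonneg, N.half_le_pI])

theorem PauliNoise.coe_weight_ft : (N.weight (false, true) : ℝ) = 2 * N.pZ :=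
  Real.coe_toNNReal _ (by linarith [N.pZ_nonneg])

theorem PauliNoise.coe_weight_tf : (N.weight (true, false) : ℝ) = |N.pX - N.pY| :=
  Real.coe_toNNReal _ (abs_nonneg _)

theorem PauliNoise.coe_weight_tt : (N.weight (true, true) : ℝ) = 2 * min N.pX N.pY :=
  Real.coe_toNNReal _ (by have := N.pX_nonneg; have := N.pY_nonneg; positivity)

theorem PauliNoise.sum_weight : ∑ o, N.weight o = 1 := by
  rw [sum_outcome, ← NNReal.coe_inj]
  push_cast
  rw [N.coe_weight_ff, N.coe_weight_ft, N.coe_weight_tf, N.coe_weight_tt,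
    abs_sub_add_two_mul_min]
  ring

/-- The probability that a qubit is dephased is `2 * p`. -/
theorem PauliNoise.weight_not_dephased :
    ((N.weight (false, false) + N.weight (true, false) : ℝ≥0) : ℝ) = 1 - 2 * N.p := by
  push_cast
  rw [N.coe_weight_ff, N.coe_weight_tf, PauliNoise.p]
  linarith [abs_sub_add_two_mul_min N.pX N.pY]

end Weight

section NoiseAvg

variable (N : PauliNoise) {M : Type*} [AddCommMonoid M] [Module ℝ≥0 M]

/-- The expectation over the noise at the positions in a list, which is applied to a given
pattern. -/
def noiseAvg : List (ℕ × ℕ) → (Pattern → M) → Pattern → M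
  | [], f => f
  | i :: L, f => fun ω => ∑ o, N.weight o • noiseAvg L f (ω.set i o)

theorem noiseAvg_append (L L' : List (ℕ × ℕ)) (f : Pattern → M) :
    noiseAvg N (L ++ L') f = noiseAvg N L (noiseAvg N L' f) := by
  induction L with
  | nil => rfl
  | cons i L ih => simp only [List.cons_append, noiseAvg, ih]

theorem noiseAvg_const (L : List (ℕ × ℕ)) (a : M) (ω : Pattern) :
    noiseAvg N L (fun _ => a) ω = a := by
  induction L generalizing ω with
  | nil => rfl
  | cons i L ih => simp only [noiseAvg, ih, ← Finset.sum_smul, N.sum_weight, one_smul]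

theorem noiseAvg_add (L : List (ℕ × ℕ)) (f g : Pattern → M) (ω : Pattern) :
    noiseAvg N L (fun ω => f ω + g ω) ω = noiseAvg N L f ω + noiseAvg N L g ω := by
  induction L generalizing ω with
  | nil => rfl
  | cons i L ih => simp only [noiseAvg, ih, smul_add, Finset.sum_add_distrib]

theorem noiseAvg_sum {ι : Type*} (s : Finset ι) (L : List (ℕ × ℕ)) (f : ι → Pattern → M)
    (ω : Pattern) :
    noiseAvg N L (fun ω => ∑ i ∈ s, f i ω) ω = ∑ i ∈ s, noiseAvg N L (f i) ω := by
  classical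
  induction s using Finset.induction_on with
  | empty => simp [noiseAvg_const]
  | insert a s ha ih => simp only [Finset.sum_insert ha, noiseAvg_add, ih]

theorem noiseAvg_mul_left {A : Type*} [Semiring A] [Algebra ℝ≥0 A] (L : List (ℕ × ℕ)) (a : A)
    (f : Pattern → A) (ω : Pattern) :
    noiseAvg N L (fun ω => a * f ω) ω = a * noiseAvg N L f ω := by
  induction L generalizing ω with
  | nil => rfl
  | cons i L ih => simp only [noiseAvg, ih, Finset.mul_sum, mul_smul_comm]

theorem noiseAvg_mono {f g : Pattern → ℝ≥0∞} (h : ∀ ω, f ω ≤ g ω) (L : List (ℕ × ℕ))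
    (ω : Pattern) : noiseAvg N L f ω ≤ noiseAvg N L g ω := by
  induction L generalizing ω with
  | nil => exact h ω
  | cons i L ih =>
    simp only [noiseAvg]
    exact Finset.sum_le_sum fun o _ => by gcongr; exact ih _

theorem noiseAvg_nonneg {f : Pattern → ℝ} (h : ∀ ω, 0 ≤ f ω) (L : List (ℕ × ℕ)) (ω : Pattern) :
    0 ≤ noiseAvg N L f ω := by
  induction L generalizing ω with
  | nil => exact h ω
  | cons i L ih =>
    exact Finset.sum_nonneg fun o _ => smul_nonneg (zero_le) (ih _)

theorem ofReal_noiseAvg {f : Pattern → ℝ} (h : ∀ ω, 0 ≤ f ω) (L : List (ℕ × ℕ)) (ω : Pattern) :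
    ENNReal.ofReal (noiseAvg N L f ω) = noiseAvg N L (fun ω => ENNReal.ofReal (f ω)) ω := by
  induction L generalizing ω with
  | nil => rfl
  | cons i L ih =>
    simp only [noiseAvg, ← ih]
    rw [ENNReal.ofReal_sum_of_nonneg fun o _ => smul_nonneg zero_le (noiseAvg_nonneg N h L _)]
    refine Finset.sum_congr rfl fun o _ => ?_
    rw [NNReal.smul_def, smul_eq_mul, ENNReal.ofReal_mul (NNReal.coe_nonneg _)]
    simp [ENNReal.smul_def]

theorem Pattern.set_of_ne {ω : Pattern} {i : ℕ × ℕ} {o : Outcome} {t v : ℕ} (h : (t, v) ≠ i) :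
    ω.set i o t v = ω t v := by
  rw [Pattern.set, if_neg]
  rintro ⟨rfl, rfl⟩
  exact h rfl

/-- The expectation depends only on the patterns that differ from the given one at the positions in
the list. -/
theorem noiseAvg_congr {L : List (ℕ × ℕ)} {f g : Pattern → M} {ω : Pattern}
    (h : ∀ ω' : Pattern, (∀ t v, (t, v) ∉ L → ω' t v = ω t v) → f ω' = g ω') :
    noiseAvg N L f ω = noiseAvg N L g ω := by
  induction L generalizing ω with
  | nil => exact h ω fun _ _ _ => rfl
  | cons i L ih =>
    simp only [noiseAvg]
    refine Finset.sum_congr rfl fun o _ => ?_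
    rw [ih]
    intro ω' hω'
    refine h ω' fun t v htv => ?_
    rw [List.mem_cons, not_or] at htv
    rw [hω' t v htv.2, Pattern.set_of_ne htv.1]

/-- A map that preserves the mixtures of four states. -/
def PreservesMixtures {M' : Type*} [AddCommMonoid M'] [Module ℝ≥0 M'] (φ : M → M') : Prop :=
  ∀ (c : Outcome → ℝ≥0) (ρ : Outcome → M), φ (∑ o, c o • ρ o) = ∑ o, c o • φ (ρ o)

theorem PreservesMixtures.foldl {ι : Type*} {φ : M → ι → M}
    (h : ∀ i, PreservesMixtures fun ρ => φ ρ i) (L : List ι) :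
    PreservesMixtures fun ρ => L.foldl φ ρ := by
  induction L with
  | nil => exact fun _ _ => rfl
  | cons i L ih =>
    intro c ρ
    simp only [List.foldl_cons]
    exact (congrArg (fun ρ => L.foldl φ ρ) (h i c ρ)).trans (ih c fun o => φ (ρ o) i)

theorem PreservesMixtures.noiseAvg {M' : Type*} [AddCommMonoid M'] [Module ℝ≥0 M'] {φ : M → M'}
    (h : PreservesMixtures φ) (L : List (ℕ × ℕ)) (f : Pattern → M) (ω : Pattern) :
    φ (noiseAvg N L f ω) = NoisyIQP.noiseAvg N L (fun ω => φ (f ω)) ω := by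
  induction L generalizing ω with
  | nil => rfl
  | cons i L ih =>
    simp only [NoisyIQP.noiseAvg]
    rw [h]
    simp only [ih]

end NoiseAvg

/-! ### The output distribution as a mixture over noise patterns -/

theorem ofNat_add (a b : ℕ) : Fin.ofNat 2 (a + b) = Fin.ofNat 2 a + Fin.ofNat 2 b := by
  apply Fin.ext
  simp [Fin.ofNat, Fin.val_add]

section Mixture

variable {n d k : ℕ} (C : Circuit n d k) (N : PauliNoise)

/-- The number of flips of qubit `v` before layer `T`. -/
def Pattern.flips (ω : Pattern) (T v : ℕ) : ℕ := ∑ s ∈ Finset.range T, if (ω s v).1 then 1 else 0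

/-- The number of phase flips of qubit `v` in the first `d` layers. A flip without dephasing carries
a phase flip if `pX < pY`. -/
def Pattern.phases (N : PauliNoise) (ω : Pattern) (d v : ℕ) : ℕ := open Classical in
  ∑ s ∈ Finset.range d, if (ω s v).1 ∧ (ω s v).2 = false ∧ N.pX < N.pY then 1 else 0

/-- Qubit `v` is dephased in the first `d` layers. -/
def Pattern.Dephased (ω : Pattern) (d v : ℕ) : Prop := ∃ s < d, (ω s v).2 = true

/-- The flips before layer `T` as a bit string. -/
def Pattern.shift (ω : Pattern) (n T : ℕ) : Bits n := fun v => Fin.ofNat 2 (ω.flips T v)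

/-- The phase flips as a bit string. -/
def Pattern.sign (N : PauliNoise) (ω : Pattern) (n d : ℕ) : Bits n :=
  fun v => Fin.ofNat 2 (ω.phases N d v)

/-- The phase that the gates of layer `t` give to the basis state `x`. -/
def layerPhase (t : ℕ) (x : Bits n) : ℂ :=
  ((gatesAt C t).map fun g => g.diag fun i => x (g.qubit i)).prod

/-- The phase that the gates of the first `T` layers give to a basis state that has the value `x` at
first and is changed by the flips of the noise. -/
def phase (ω : Pattern) (T : ℕ) (x : Bits n) : ℂ :=
  ∏ t ∈ Finset.range T, layerPhase C t (x + ω.shift n t)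

open Classical in
/-- The state after `T` layers for a given noise pattern, if the outcomes of the noise from layer `T`
on are trivial. An entry with the indices `x`, `y` belongs to the initial basis states
`x + ω.shift n T`, `y + ω.shift n T`, which the flips have moved to `x`, `y`. The sign and the indicator
may refer to the whole pattern because they commute with the gates and the flips. -/
def patternState (ω : Pattern) (T : ℕ) : Op n := Matrix.of fun x y =>
  (2⁻¹ : ℂ) ^ n * (chi Finset.univ (ω.sign N n d) x * chi Finset.univ (ω.sign N n d) y)
    * (if ∀ v : Fin n, ω.Dephased d v → x v = y v then 1 else 0)
    * (phase C ω T (x + ω.shift n T) * (starRingEnd ℂ) (phase C ω T (y + ω.shift n T)))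

theorem norm_layerPhase (t : ℕ) (x : Bits n) : ‖layerPhase C t x‖ = 1 := by
  rw [layerPhase]
  induction gatesAt C t with
  | nil => simp
  | cons g L ih => simp [ih, g.norm_diag]

theorem norm_phase (ω : Pattern) (T : ℕ) (x : Bits n) : ‖phase C ω T x‖ = 1 := by
  simp [phase, norm_prod, norm_layerPhase]

/-- The bit string with a single one at `v`. -/
def unitBits (v : Fin n) : Bits n := Pi.single v 1

theorem eq_or_eq_add_unitBits {x z : Bits n} {v : Fin n} (h : ∀ w, w ≠ v → x w = z w) :
    z = x ∨ z = x + unitBits v := by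
  have hv : z v = x v ∨ z v = x v + 1 := by
    generalize x v = a
    generalize z v = b
    fin_cases a <;> fin_cases b <;> simp
  refine hv.imp (fun hv => ?_) fun hv => ?_ <;>
  · funext w
    by_cases hw : w = v
    · subst hw; simp [hv, unitBits]
    · simp [h w hw, unitBits, hw]

theorem onQubit_mul_apply (v : Fin n) (A : Matrix (Fin 2) (Fin 2) ℂ) (ρ : Op n) (x y : Bits n) :
    (onQubit v A * ρ) x y = A (x v) (x v) * ρ x y
      + A (x v) (x v + 1) * ρ (x + unitBits v) y := by
  have hv : (x + unitBits v) v = x v + 1 := by simp [unitBits]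
  have hw : ∀ w, w ≠ v → x w = (x + unitBits v) w := fun w hw => by simp [unitBits, hw]
  rw [Matrix.mul_apply, Fintype.sum_eq_add x (x + unitBits v)]
  · rw [onQubit, Matrix.of_apply, Matrix.of_apply, if_pos fun _ _ => rfl, if_pos hw, hv]
  · intro h
    have := congr_fun h v
    rw [hv] at this
    generalize x v = a at this
    fin_cases a <;> simp at this
  · rintro z ⟨h1, h2⟩
    simp only [onQubit, Matrix.of_apply]
    rw [if_neg, zero_mul]
    exact fun h => (eq_or_eq_add_unitBits h).elim h1 h2

theorem mul_onQubit_apply (v : Fin n) (A : Matrix (Fin 2) (Fin 2) ℂ) (ρ : Op n) (x y : Bits n) :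
    (ρ * onQubit v A) x y = ρ x y * A (y v) (y v)
      + ρ x (y + unitBits v) * A (y v + 1) (y v) := by
  have hv : (y + unitBits v) v = y v + 1 := by simp [unitBits]
  have hw : ∀ w, w ≠ v → (y + unitBits v) w = y w := fun w hw => by simp [unitBits, hw]
  rw [Matrix.mul_apply, Fintype.sum_eq_add y (y + unitBits v)]
  · rw [onQubit, Matrix.of_apply, Matrix.of_apply, if_pos fun _ _ => rfl, if_pos hw, hv]
  · intro h
    have := congr_fun h v
    rw [hv] at this
    generalize y v = a at this
    fin_cases a <;> simp at this
  · rintro z ⟨h1, h2⟩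
    simp only [onQubit, Matrix.of_apply]
    rw [if_neg, mul_zero]
    exact fun h => (eq_or_eq_add_unitBits fun w hw => (h w hw).symm).elim h1 h2

/-- The entries of a state after the noise on one qubit. -/
theorem channel_apply (v : Fin n) (ρ : Op n) (x y : Bits n) :
    N.channel v ρ x y = ((1 - N.pX - N.pY - N.pZ : ℝ) : ℂ) * ρ x y
      + (N.pX : ℂ) * ρ (x + unitBits v) (y + unitBits v)
      + (N.pY : ℂ) * (sgn (x v) * sgn (y v) * ρ (x + unitBits v) (y + unitBits v))
      + (N.pZ : ℂ) * (sgn (x v) * sgn (y v) * ρ x y) := by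
  have hv : ∀ z : Bits n, (z + unitBits v) v = z v + 1 := fun z => by simp [unitBits]
  simp only [PauliNoise.channel, Matrix.add_apply, Matrix.smul_apply, smul_eq_mul,
    onQubit_mul_apply, mul_onQubit_apply]
  generalize x v = a
  generalize y v = b
  generalize ρ (x + unitBits v) (y + unitBits v) = r
  fin_cases a <;> fin_cases b <;> simp [pauliX, pauliY, pauliZ, sgn] <;> ring_nf <;> simp

theorem preservesMixtures_channel (v : Fin n) :
    PreservesMixtures fun ρ : Op n => N.channel v ρ := by
  intro c ρ
  simp only [PauliNoise.channel, Matrix.mul_sum, Matrix.sum_mul, Finset.smul_sum,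
    Matrix.mul_smul, Matrix.smul_mul, ← Finset.sum_add_distrib, smul_add]
  refine Finset.sum_congr rfl fun o _ => ?_
  simp only [smul_comm (c o)]

theorem preservesMixtures_gate (g : DiagGate n) :
    PreservesMixtures fun ρ : Op n => g.channel ρ := by
  intro c ρ
  simp only [DiagGate.channel, Matrix.mul_sum, Matrix.sum_mul, Matrix.mul_smul, Matrix.smul_mul]

theorem preservesMixtures_noisyLayer (t : Fin d) :
    PreservesMixtures fun ρ : Op n => noisyLayer C N t ρ := by
  intro c ρ
  simp only [noisyLayer]
  exact (congrArg (fun ρ => (List.finRange n).foldl (fun σ v => N.channel v σ) ρ)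
    (PreservesMixtures.foldl (fun g => preservesMixtures_gate g) (C.layer t) c ρ)).trans
      (PreservesMixtures.foldl (fun v => preservesMixtures_channel N v) _ c _)

theorem foldl_gates_apply (L : List (DiagGate n)) (ρ : Op n) (x y : Bits n) :
    L.foldl (fun σ g => g.channel σ) ρ x y
      = (L.map fun g => g.diag fun i => x (g.qubit i)).prod * ρ x y
        * (starRingEnd ℂ) (L.map fun g => g.diag fun i => y (g.qubit i)).prod := by
  induction L generalizing ρ with
  | nil => simp
  | cons g L ih =>
    rw [List.foldl_cons, ih]
    simp only [DiagGate.channel, DiagGate.unitary, Matrix.diagonal_conjTranspose,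
      Matrix.mul_diagonal, Matrix.diagonal_mul, List.map_cons, List.prod_cons, map_mul,
      Pi.star_apply, starRingEnd_apply]
    ring

theorem phase_shift_congr {ω ω' : Pattern} {T : ℕ}
    (h : ∀ s, s + 1 < T → ∀ v : Fin n, ω s v = ω' s v) :
    phase C ω T = phase C ω' T := by
  funext x
  refine Finset.prod_congr rfl fun t ht => ?_
  congr 2
  funext v
  simp only [Pattern.shift, Pattern.flips]
  congr 1
  refine Finset.sum_congr rfl fun s hs => ?_
  rw [h s (by simp at ht hs; omega)]

/-- The gates of layer `T` multiply the phase by `layerPhase`; the shift is that of layer `T`, as no noise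
has occurred since. -/
theorem foldl_gates_patternState {ω : Pattern} {T : ℕ} (hω : ∀ v, ω T v = (false, false)) :
    (gatesAt C T).foldl (fun σ g => g.channel σ) (patternState C N ω T)
      = patternState C N ω (T + 1) := by
  have hs : ω.shift n (T + 1) = ω.shift n T := by
    funext v
    simp only [Pattern.shift, Pattern.flips]
    rw [Finset.sum_range_succ, hω]
    rfl
  have hz : ∀ x : Bits n, x + ω.shift n T + ω.shift n T = x := by
    intro x
    rw [add_assoc, show ω.shift n T + ω.shift n T = 0 from ?_, add_zero]
    funext v
    simp only [Pi.add_apply, Pi.zero_apply]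
    generalize ω.shift n T v = a
    fin_cases a <;> rfl
  ext x y
  rw [foldl_gates_apply, patternState, patternState, Matrix.of_apply, Matrix.of_apply, hs]
  have hp : ∀ x, phase C ω (T + 1) (x + ω.shift n T)
      = phase C ω T (x + ω.shift n T) * layerPhase C T x := by
    intro x
    rw [phase, Finset.prod_range_succ, hz]
    rfl
  rw [hp, hp, map_mul]
  simp only [layerPhase]
  ring

/-- Counting the layers with a certain outcome after a trivial outcome has been replaced. -/
theorem sum_range_set {ω : Pattern} {T v : ℕ} (hω : ω T v = (false, false)) (o : Outcome)
    (m w : ℕ) (p : Outcome → Prop) [DecidablePred p] (hp : ¬ p (false, false)) :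
    (∑ s ∈ Finset.range m, if p ((ω.set (T, v) o) s w) then 1 else 0)
      = (∑ s ∈ Finset.range m, if p (ω s w) then 1 else 0)
        + if w = v ∧ T < m ∧ p o then 1 else 0 := by
  by_cases h : w = v ∧ T < m
  · obtain ⟨rfl, hm⟩ := h
    rw [← Finset.add_sum_erase _ _ (Finset.mem_range.2 hm),
      ← Finset.add_sum_erase (Finset.range m) (fun s => if p (ω s w) then 1 else 0)
        (Finset.mem_range.2 hm)]
    simp only [hω, hp, if_false, zero_add, true_and, hm]
    rw [add_comm]
    congr 1
    · refine Finset.sum_congr rfl fun s hs => ?_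
      rw [Pattern.set_of_ne (by simp [(Finset.mem_erase.1 hs).1])]
    · simp [Pattern.set]
  · rw [if_neg fun h' => h ⟨h'.1, h'.2.1⟩, add_zero]
    refine Finset.sum_congr rfl fun s hs => ?_
    rw [Pattern.set_of_ne]
    rintro ⟨⟩
    exact h ⟨rfl, Finset.mem_range.1 hs⟩

/-- How the state changes when a trivial outcome is replaced by the outcome `o`. -/
theorem patternState_set {ω : Pattern} {T : ℕ} (hT : T < d) {v : Fin n}
    (hω : ω T v = (false, false)) (o : Outcome) (x y : Bits n) :
    patternState C N (ω.set (T, v) o) (T + 1) x y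
      = (if o.2 then if x v = y v then 1 else 0 else 1)
        * (if o.1 ∧ o.2 = false ∧ N.pX < N.pY then sgn (x v) * sgn (y v) else 1)
        * (if o.1 then patternState C N ω (T + 1) (x + unitBits v) (y + unitBits v)
          else patternState C N ω (T + 1) x y) := by
  classical
  have hsum : ∀ (m : ℕ) (w : Fin n) (p : Outcome → Prop) [DecidablePred p],
      ¬ p (false, false) → T < m →
      (∑ s ∈ Finset.range m, if p ((ω.set (T, v) o) s w) then 1 else 0)
        = (∑ s ∈ Finset.range m, if p (ω s w) then 1 else 0) + if w = v ∧ p o then 1 else 0 := by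
    intro m w p _ hp hm
    rw [sum_range_set hω o m w p hp]
    simp [hm, Fin.val_inj]
  have hshift : (ω.set (T, v) o).shift n (T + 1)
      = ω.shift n (T + 1) + if o.1 then unitBits v else 0 := by
    funext w
    simp only [Pattern.shift, Pattern.flips, Pi.add_apply]
    rw [hsum (T + 1) w (fun o => o.1 = true) (by simp) (by omega), ofNat_add]
    congr 1
    by_cases hw : w = v
    · subst hw; cases o.1 <;> simp [unitBits]
    · cases o.1 <;> simp [unitBits, hw]
  have hsign : (ω.set (T, v) o).sign N n d
      = ω.sign N n d + if o.1 ∧ o.2 = false ∧ N.pX < N.pY then unitBits v else 0 := by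
    funext w
    simp only [Pattern.sign, Pattern.phases, Pi.add_apply]
    rw [hsum d w (fun o => o.1 = true ∧ o.2 = false ∧ N.pX < N.pY) (by simp) hT, ofNat_add]
    congr 1
    by_cases hw : w = v
    · subst hw; split_ifs <;> simp_all [unitBits]
    · split_ifs <;> simp_all [unitBits]
  have hdeph : ∀ w : Fin n, (ω.set (T, v) o).Dephased d w
      ↔ ω.Dephased d w ∨ (w = v ∧ o.2 = true) := by
    intro w
    simp only [Pattern.Dephased]
    constructor
    · rintro ⟨s, hs, h⟩
      by_cases hsw : s = T ∧ w = v
      · exact Or.inr ⟨hsw.2, by simpa [Pattern.set, hsw.1, hsw.2] using h⟩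
      · rw [Pattern.set_of_ne (by simpa [Fin.val_inj] using hsw)] at h
        exact Or.inl ⟨s, hs, h⟩
    · rintro (⟨s, hs, h⟩ | ⟨rfl, h⟩)
      · refine ⟨s, hs, ?_⟩
        rw [Pattern.set_of_ne]
        · exact h
        · simp only [ne_eq, Prod.mk.injEq, Fin.val_inj]
          rintro ⟨rfl, rfl⟩
          simp [hω] at h
      · exact ⟨T, hT, by simpa [Pattern.set] using h⟩
  have hphase : phase C (ω.set (T, v) o) (T + 1) = phase C ω (T + 1) :=
    phase_shift_congr C fun s hs w => Pattern.set_of_ne (by simp; omega)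
  have hchi : ∀ (b : Bool) (x : Bits n), chi Finset.univ (if b then unitBits v else 0) x
      = if b then sgn (x v) else 1 := by
    intro b x
    cases b
    · simp [chi]
    · simp only [chi, if_true]
      rw [Finset.prod_eq_single v]
      · simp [unitBits]
      · intro w _ hw
        simp [unitBits, hw]
      · simp
  have hpair : chi Finset.univ (ω.sign N n d) (x + unitBits v)
      * chi Finset.univ (ω.sign N n d) (y + unitBits v)
      = chi Finset.univ (ω.sign N n d) x * chi Finset.univ (ω.sign N n d) y := by
    rw [chi_add_right, chi_add_right, mul_mul_mul_comm, chi_mul_self, mul_one]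
  have hchi' : ∀ x : Bits n, chi Finset.univ ((ω.set (T, v) o).sign N n d) x
      = chi Finset.univ (ω.sign N n d) x
        * if o.1 ∧ o.2 = false ∧ N.pX < N.pY then sgn (x v) else 1 := by
    intro x
    have := hchi (decide (o.1 = true ∧ o.2 = false ∧ N.pX < N.pY)) x
    simp only [decide_eq_true_eq] at this
    rw [hsign, chi_add_left, this]
  have hd' : (∀ w : Fin n, (ω.set (T, v) o).Dephased d w → x w = y w)
      ↔ (o.2 = true → x v = y v) ∧ ∀ w : Fin n, ω.Dephased d w → x w = y w := by
    simp only [hdeph]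
    grind
  have hd'' : (∀ w : Fin n, ω.Dephased d w → (x + unitBits v) w = (y + unitBits v) w)
      ↔ ∀ w : Fin n, ω.Dephased d w → x w = y w := by
    simp
  have hS : ∀ x : Bits n, x + (ω.shift n (T + 1) + unitBits v)
      = x + unitBits v + ω.shift n (T + 1) := fun x => by abel
  simp only [patternState, Matrix.of_apply, hchi', hd', hd'', hphase, hshift, hpair]
  have h1 : (if (o.2 = true → x v = y v) ∧ ∀ w : Fin n, ω.Dephased d w → x w = y w then (1 : ℂ)
      else 0) = (if o.2 then if x v = y v then 1 else 0 else 1)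
        * if ∀ w : Fin n, ω.Dephased d w → x w = y w then 1 else 0 := by
    by_cases h : o.2 = true <;> by_cases h' : x v = y v <;> simp [h, h']
  rw [h1]
  by_cases hc : o.1 ∧ o.2 = false ∧ N.pX < N.pY
  · simp only [hc, and_self, if_true, hS]
    ring
  · simp only [hc, if_false, mul_one]
    by_cases ho : o.1 = true
    · simp only [ho, if_true, hS]
      ring
    · simp only [ho, Bool.false_eq_true, if_false, add_zero]
      ring

/-- The noise on one qubit is the mixture of the four outcomes. -/
theorem channel_patternState {ω : Pattern} {T : ℕ} (hT : T < d) {v : Fin n}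
    (hω : ω T v = (false, false)) :
    N.channel v (patternState C N ω (T + 1))
      = ∑ o, N.weight o • patternState C N (ω.set (T, v) o) (T + 1) := by
  ext x y
  rw [channel_apply, Matrix.sum_apply, sum_outcome]
  simp only [Matrix.smul_apply, patternState_set C N hT hω, NNReal.smul_def, Complex.real_smul,
    N.coe_weight_ff, N.coe_weight_ft, N.coe_weight_tf, N.coe_weight_tt]
  generalize patternState C N ω (T + 1) x y = r
  generalize patternState C N ω (T + 1) (x + unitBits v) (y + unitBits v) = r'
  have hs : sgn (x v) * sgn (y v) = if x v = y v then 1 else -1 := by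
    generalize x v = a
    generalize y v = b
    fin_cases a <;> fin_cases b <;> simp
  rw [hs]
  rcases lt_or_ge N.pX N.pY with h | h
  · rw [abs_of_neg (sub_neg.2 h), min_eq_left h.le]
    split_ifs <;> simp_all <;> ring
  · rw [abs_of_nonneg (sub_nonneg.2 h), min_eq_right h]
    simp only [not_lt.2 h, and_false, if_false]
    split_ifs <;> simp_all <;> ring

/-- The positions of layer `t` from qubit `j` on, in the order of the noise. -/
def rowFrom (n t j : ℕ) : List (ℕ × ℕ) := (List.range' j (n - j)).map fun v => (t, v)

theorem rowFrom_of_lt {n j : ℕ} (t : ℕ) (h : j < n) :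
    rowFrom n t j = (t, j) :: rowFrom n t (j + 1) := by
  rw [rowFrom, show n - j = (n - (j + 1)) + 1 by omega, List.range'_succ]
  rfl

theorem rowFrom_self (n t : ℕ) : rowFrom n t n = [] := by simp [rowFrom]

theorem mem_rowFrom {n t j s v : ℕ} : (s, v) ∈ rowFrom n t j ↔ s = t ∧ j ≤ v ∧ v < n := by
  simp only [rowFrom, List.mem_map, List.mem_range'_1, Prod.mk.injEq]
  constructor
  · rintro ⟨a, ha, rfl, rfl⟩
    exact ⟨rfl, ha.1, by omega⟩
  · rintro ⟨rfl, h1, h2⟩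
    exact ⟨v, ⟨h1, by omega⟩, rfl, rfl⟩

/-- All positions from layer `t` on, in the order of the noise. -/
def positionsFrom (n d t : ℕ) : List (ℕ × ℕ) :=
  (List.range' t (d - t)).flatMap fun s => rowFrom n s 0

theorem positionsFrom_of_lt {n d t : ℕ} (h : t < d) :
    positionsFrom n d t = rowFrom n t 0 ++ positionsFrom n d (t + 1) := by
  rw [positionsFrom, show d - t = (d - (t + 1)) + 1 by omega, List.range'_succ]
  rfl

theorem positionsFrom_self (n d : ℕ) : positionsFrom n d d = [] := by simp [positionsFrom]

/-- The noise on the qubits from `j` on. -/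
theorem foldl_channel_patternState {T : ℕ} (hT : T < d) (j : ℕ) (hj : j ≤ n) (ω : Pattern)
    (hω : ∀ v, j ≤ v → ω T v = (false, false)) :
    ((List.finRange n).drop j).foldl (fun σ v => N.channel v σ) (patternState C N ω (T + 1))
      = noiseAvg N (rowFrom n T j) (fun ω => patternState C N ω (T + 1)) ω := by
  induction hr : n - j generalizing j ω with
  | zero =>
    obtain rfl : j = n := by omega
    rw [List.drop_of_length_le (by simp), rowFrom_self]
    rfl
  | succ r ih =>
    have hjn : j < n := by omega
    rw [List.drop_eq_getElem_cons (by simpa using hjn), List.foldl_cons, List.getElem_finRange,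
      channel_patternState C N hT (hω _ (by simp))]
    refine (PreservesMixtures.foldl (fun v => preservesMixtures_channel N v) _ _ _).trans ?_
    rw [rowFrom_of_lt T hjn, noiseAvg]
    refine Finset.sum_congr rfl fun o _ => ?_
    congr 1
    refine ih (j + 1) (by omega) _ (fun v hv => ?_) (by omega)
    rw [Pattern.set_of_ne (by simp; omega), hω v (by omega)]

theorem noisyLayer_patternState {T : ℕ} (hT : T < d) (ω : Pattern)
    (hω : ∀ v, ω T v = (false, false)) :
    noisyLayer C N ⟨T, hT⟩ (patternState C N ω T)
      = noiseAvg N (rowFrom n T 0) (fun ω => patternState C N ω (T + 1)) ω := by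
  have h := foldl_gates_patternState C N hω
  rw [gatesAt, dif_pos hT] at h
  rw [noisyLayer, h]
  simpa using foldl_channel_patternState C N hT 0 (zero_le) ω fun v _ => hω v

/-- The noisy layers from `T` on. -/
theorem foldl_noisyLayer_patternState (T : ℕ) (hT : T ≤ d) (ω : Pattern)
    (hω : ∀ t v, T ≤ t → ω t v = (false, false)) :
    ((List.finRange d).drop T).foldl (fun σ t => noisyLayer C N t σ) (patternState C N ω T)
      = noiseAvg N (positionsFrom n d T) (fun ω => patternState C N ω d) ω := by
  induction hr : d - T generalizing T ω with
  | zero =>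
    obtain rfl : T = d := by omega
    rw [List.drop_of_length_le (by simp), positionsFrom_self]
    rfl
  | succ r ih =>
    have hTd : T < d := by omega
    rw [List.drop_eq_getElem_cons (by simpa using hTd), List.foldl_cons, List.getElem_finRange,
      Fin.cast_mk, noisyLayer_patternState C N hTd ω (fun v => hω T v le_rfl),
      positionsFrom_of_lt hTd, noiseAvg_append]
    refine (PreservesMixtures.noiseAvg N (φ := fun ρ => ((List.finRange d).drop (T + 1)).foldl
      (fun σ t => noisyLayer C N t σ) ρ) (PreservesMixtures.foldl
        (fun t => preservesMixtures_noisyLayer C N t) _) _ _ _).trans ?_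
    refine noiseAvg_congr N fun ω' hω' => ih (T + 1) hTd ω' (fun t v ht => ?_) (by omega)
    rw [hω' t v (by rw [mem_rowFrom]; omega), hω t v (by omega)]

theorem patternState_none : patternState C N Pattern.none 0 = tensorPower n ketbraPlus := by
  have hz : (Pattern.none.sign N n d : Bits n) = 0 := by
    funext v
    simp [Pattern.sign, Pattern.phases, Pattern.none]
  have hD : ∀ v : Fin n, ¬ Pattern.none.Dephased d v := fun v => by
    simp [Pattern.Dephased, Pattern.none]
  have hK : ∀ a b, ketbraPlus a b = 2⁻¹ := fun a b => by
    fin_cases a <;> fin_cases b <;> simp [ketbraPlus]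
  ext x y
  simp [patternState, tensorPower, hz, hD, hK, chi, phase]

theorem noisyChannel_eq : noisyChannel C N (tensorPower n ketbraPlus)
    = noiseAvg N (positionsFrom n d 0) (fun ω => patternState C N ω d) Pattern.none := by
  rw [← patternState_none C N]
  exact foldl_noisyLayer_patternState C N 0 (zero_le) Pattern.none fun _ _ _ => rfl

/-- The probability of the outcome `b` in the state `ρ`. -/
def hadamardProb (b : Bits n) (ρ : Op n) : ℝ :=
  (Matrix.trace ((tensorPower n hadamard).conjTranspose * Matrix.single b b 1
    * tensorPower n hadamard * ρ)).re

theorem tensorPower_hadamard_apply (x y : Bits n) :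
    tensorPower n hadamard x y = ((Real.sqrt 2 : ℝ) : ℂ)⁻¹ ^ n * chi Finset.univ x y := by
  have h : ∀ a b, hadamard a b = ((Real.sqrt 2 : ℝ) : ℂ)⁻¹ * sgn (a * b) := fun a b => by
    fin_cases a <;> fin_cases b <;> simp [hadamard, sgn]
  simp [tensorPower, h, chi, Finset.prod_mul_distrib]

theorem hadamardProb_eq (b : Bits n) (ρ : Op n) :
    hadamardProb b ρ
      = ((2⁻¹ : ℂ) ^ n * ∑ x, ∑ y, chi Finset.univ b x * chi Finset.univ b y * ρ x y).re := by
  have hr : (starRingEnd ℂ) (((Real.sqrt 2 : ℝ) : ℂ)⁻¹ ^ n) * ((Real.sqrt 2 : ℝ) : ℂ)⁻¹ ^ n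
      = (2⁻¹ : ℂ) ^ n := by
    rw [← Complex.ofReal_inv, map_pow, Complex.conj_ofReal, ← mul_pow, ← Complex.ofReal_mul,
      ← mul_inv, Real.mul_self_sqrt (by norm_num)]
    norm_num
  have hM : ∀ x y, ((tensorPower n hadamard).conjTranspose * (Matrix.single b b 1 : Op n)
      * tensorPower n hadamard) x y
      = (2⁻¹ : ℂ) ^ n * (chi Finset.univ b x * chi Finset.univ b y) := by
    intro x y
    have h1 : ∀ z, ((tensorPower n hadamard).conjTranspose * Matrix.single b b (1 : ℂ)) x z
        = if b = z then (tensorPower n hadamard).conjTranspose x b else 0 := by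
      intro z
      simp [Matrix.mul_apply, Matrix.single_apply, ite_and]
    rw [Matrix.mul_apply]
    simp only [h1, ite_mul, zero_mul, Finset.sum_ite_eq, Finset.mem_univ, if_true,
      Matrix.conjTranspose_apply, tensorPower_hadamard_apply, ← starRingEnd_apply, map_mul,
      conj_chi]
    rw [← hr]
    ring
  rw [hadamardProb, Matrix.trace]
  congr 1
  simp only [Matrix.diag_apply, Matrix.mul_apply (N := ρ), hM]
  rw [Finset.sum_comm, Finset.mul_sum]
  refine Finset.sum_congr rfl fun x _ => ?_
  rw [Finset.mul_sum]
  refine Finset.sum_congr rfl fun y _ => ?_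
  ring

theorem preservesMixtures_hadamardProb (b : Bits n) :
    PreservesMixtures fun ρ : Op n => hadamardProb b ρ := by
  intro c ρ
  simp only [hadamardProb, Matrix.mul_sum, Matrix.mul_smul, Matrix.trace_sum, Matrix.trace_smul,
    Complex.re_sum, NNReal.smul_def, Complex.real_smul, Complex.re_ofReal_mul, smul_eq_mul]

/-- The probability of the outcome `b` for a given noise pattern. -/
def patternProb (ω : Pattern) (b : Bits n) : ℝ := hadamardProb b (patternState C N ω d)

/-- The output distribution is the mixture of the distributions for the noise patterns. -/
theorem outputProb_eq (b : Bits n) : outputProb C N b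
    = noiseAvg N (positionsFrom n d 0) (fun ω => patternProb C N ω b) Pattern.none := by
  rw [outputProb, noisyChannel_eq]
  exact PreservesMixtures.noiseAvg N (preservesMixtures_hadamardProb b) _ _ _

open Classical in
/-- The dephased qubits. -/
def Pattern.dephased (ω : Pattern) (n d : ℕ) : Finset (Fin n) :=
  Finset.univ.filter fun v => ω.Dephased d v

/-- Sampling for a given noise pattern: the strings `u` and `B` are the random bits that replace the
dephased qubits in the circuit and in the outcome. -/
theorem patternProb_eq (ω : Pattern) (b : Bits n) : patternProb C N ω b
    = avg fun u : Bits n => avg fun B : Bits n =>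
      (if ∀ v ∈ ω.dephased n d, B v = b v then (1 : ℝ) else 0)
        * ‖amp (ω.dephased n d)ᶜ (phase C ω d) (b + ω.sign N n d) u‖ ^ 2 := by
  classical
  set S := ω.shift n d with hS
  set z := b + ω.sign N n d with hz
  set F : Bits n → Bits n → ℂ := fun x y => chi Finset.univ z x * chi Finset.univ z y
    * ((if ∀ v ∈ ω.dephased n d, x v = y v then 1 else 0)
      * (phase C ω d x * (starRingEnd ℂ) (phase C ω d y))) with hF
  have hterm : ∀ x y, chi Finset.univ b x * chi Finset.univ b y * patternState C N ω d x y
      = (2⁻¹ : ℂ) ^ n * F (x + S) (y + S) := by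
    intro x y
    have h1 : chi Finset.univ z (x + S) * chi Finset.univ z (y + S)
        = chi Finset.univ z x * chi Finset.univ z y := by
      rw [chi_add_right, chi_add_right, mul_mul_mul_comm, chi_mul_self, mul_one]
    have h2 : (∀ v ∈ ω.dephased n d, (x + S) v = (y + S) v)
        ↔ ∀ v : Fin n, ω.Dephased d v → x v = y v := by
      simp [Pattern.dephased]
    rw [patternState, Matrix.of_apply]
    simp only [hF, h1]
    simp only [h2]
    rw [hz, chi_add_left, chi_add_left]
    ring
  have hconst : ∀ f : Bits n → ℂ, (2⁻¹ : ℂ) ^ n * ∑ x, f x = avg f := fun f => by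
    simp [avg, NNReal.smul_def]
  rw [patternProb, hadamardProb_eq]
  simp only [hterm, ← Finset.mul_sum, hconst]
  -- The total shift of the indices disappears in the averages.
  have h3 : ∀ x, (avg fun y => F x (y + S)) = avg (F x) := fun x => avg_add_right S (F x)
  simp only [h3]
  rw [avg_add_right S fun x => avg (F x)]
  simp only [hF]
  rw [avg_dephased (ω.dephased n d) b z, Complex.ofReal_re]

theorem patternProb_nonneg (ω : Pattern) (b : Bits n) : 0 ≤ patternProb C N ω b := by
  rw [patternProb_eq]
  refine avg_nonneg fun u => avg_nonneg fun B => ?_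
  split_ifs <;> simp

theorem sum_patternProb (ω : Pattern) : ∑ b, patternProb C N ω b = 1 := by
  have hsum : ∀ f : Bits n → ℝ, ∑ b, f b = 2 ^ n * avg f := fun f => by
    rw [avg, NNReal.smul_def, smul_eq_mul, ← mul_assoc]
    simp
  simp only [patternProb_eq]
  rw [hsum, avg_comm]
  simp only [avg_mul_right, avg_indicator_eq, smul_mul_assoc, one_mul, avg_smul]
  have h : ∀ u : Bits n, (avg fun b : Bits n =>
      ‖amp (ω.dephased n d)ᶜ (phase C ω d) (b + ω.sign N n d) u‖ ^ 2)
      = (2⁻¹ : ℝ) ^ (ω.dephased n d)ᶜ.card := fun u => by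
    rw [avg_add_right (ω.sign N n d) fun b =>
      ‖amp (ω.dephased n d)ᶜ (phase C ω d) b u‖ ^ 2, avg_norm_amp_sq (norm_phase C ω d)]
  simp only [h, avg_const]
  rw [NNReal.smul_def, smul_eq_mul]
  push_cast
  rw [← pow_add, Finset.card_add_card_compl, Fintype.card_fin, ← mul_pow]
  norm_num

theorem sum_outputProb : ∑ b, outputProb C N b = 1 := by
  simp only [outputProb_eq]
  rw [← noiseAvg_sum]
  simp only [sum_patternProb, noiseAvg_const]

theorem outputProb_nonneg (b : Bits n) : 0 ≤ outputProb C N b := by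
  rw [outputProb_eq]
  exact noiseAvg_nonneg N (fun ω => patternProb_nonneg C N ω b) _ _

end Mixture

/-! ### Evaluation of amplitudes by the program -/

/-- The first `n` cells of the array `a`, modulo two. -/
def Mem.bits (m : Mem) (n a : ℕ) : Bits n := fun v => Fin.ofNat 2 (m.nat a v)

section Evaluation

variable {n d k : ℕ} {C : Circuit n d k} {N : PauliNoise}

theorem holds_odd {e : NExp} {m : Mem} : (BExp.odd e).Holds C N m ↔ e.eval C m % 2 = 1 := by
  simp only [BExp.Holds, NExp.eval]
  omega

theorem holds_natEq {e f : NExp} {m : Mem} :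
    (BExp.natEq e f).Holds C N m ↔ e.eval C m = f.eval C m := by
  simp only [BExp.Holds]
  omega

theorem ofNat_eq_one_iff {a : ℕ} : Fin.ofNat 2 a = 1 ↔ a % 2 = 1 := by
  rw [← Fin.val_inj]
  simp [Fin.ofNat]

theorem ofNat_mod (a : ℕ) : Fin.ofNat 2 (a % 2) = Fin.ofNat 2 a := by
  apply Fin.ext
  simp [Fin.ofNat]

/-- The number with the binary digits `b 0, …, b (a - 1)` modulo two. -/
def ofDigits (b : ℕ → ℕ) (a : ℕ) : ℕ := ∑ i ∈ Finset.range a, b i % 2 * 2 ^ i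

theorem ofDigits_succ (b : ℕ → ℕ) (a : ℕ) :
    ofDigits b (a + 1) = ofDigits b a + b a % 2 * 2 ^ a := Finset.sum_range_succ _ _

theorem ofDigits_lt (b : ℕ → ℕ) (a : ℕ) : ofDigits b a < 2 ^ a := by
  induction a with
  | zero => simp [ofDigits]
  | succ a ih =>
    rw [ofDigits_succ, pow_succ]
    have : b a % 2 * 2 ^ a ≤ 1 * 2 ^ a := Nat.mul_le_mul_right _ (by omega)
    omega

theorem add_mul_pow_div_mod {x y c j a : ℕ} (hj : j < a) (hx : x = y + c * 2 ^ a) :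
    x / 2 ^ j % 2 = y / 2 ^ j % 2 := by
  obtain ⟨r, rfl⟩ := Nat.exists_eq_add_of_lt hj
  rw [hx, show c * 2 ^ (j + r + 1) = 2 ^ j * (2 * (c * 2 ^ r)) by ring,
    Nat.add_mul_div_left _ _ (by positivity), Nat.add_mul_mod_self_left]

/-- The number that the program computes selects the intended diagonal entry. -/
theorem bitsOf_ofDigits (b : ℕ → ℕ) (a : ℕ) (i : Fin a) :
    bitsOf a (ofDigits b a) i = Fin.ofNat 2 (b i) := by
  rw [bitsOf, ← ofNat_mod, ← ofNat_mod (b i)]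
  congr 1
  obtain ⟨i, hi⟩ := i
  simp only
  induction a with
  | zero => omega
  | succ a ih =>
    rcases Nat.lt_succ_iff_lt_or_eq.1 hi with h | rfl
    · rw [add_mul_pow_div_mod h (ofDigits_succ b a), ih h]
    · rw [ofDigits_succ, Nat.add_mul_div_right _ _ (by positivity),
        Nat.div_eq_of_lt (ofDigits_lt b i), zero_add, Nat.mod_mod]

theorem det_gateIndex {m : Mem} {g : DiagGate n} {t j tb : ℕ} (ht : m.nat 26 0 = t)
    (hj : m.nat 27 0 = j) (htb : m.nat 31 0 = tb) (hg : (gatesAt C t)[j]? = some g) :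
    Det C N gateIndex m (120 * n + 100) fun m' => bitsOf g.arity (m'.nat 29 0)
      = fun i => Fin.ofNat 2 (m.nat 5 (g.qubit i) + m.nat 3 (tb + g.qubit i)) := by
  have harity : g.arity ≤ n := by simpa using Fintype.card_le_of_embedding g.qubit
  set b : ℕ → ℕ := fun i => if h : i < g.arity then
    m.nat 5 (g.qubit ⟨i, h⟩) + m.nat 3 (tb + g.qubit ⟨i, h⟩) else 0 with hb
  unfold gateIndex
  refine (Det.setNat_seq (Det.setNat_seq (Det.for (c := 100) (M := g.arity)
    (I := fun i m' => m'.nat 30 0 = 2 ^ i ∧ m'.nat 29 0 = ofDigits b i)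
    rfl ?_ ?_ ?_ ?_))).mono ?_ ?_
  · intro m' hA
    simp [NExp.eval, hA.nat 26 rfl, hA.nat 27 rfl, ht, hj, readGate, hg]
  · simp [NExp.eval, ofDigits]
  · rintro i m' x ⟨h1, h2⟩
    simp [h1, h2]
  · rintro i hi m' hA him ⟨h1, h2⟩
    have hbi : (NExp.plus (.get 5 (.gateQubit (.var 26) (.var 27) (.var 28)))
        (.get 3 (.plus (.var 31) (.gateQubit (.var 26) (.var 27) (.var 28))))).eval C m' = b i := by
      simp [NExp.eval, hA.nat 26 rfl, hA.nat 27 rfl, hA.nat 31 rfl, hA.nat 5 rfl, hA.nat 3 rfl,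
        him, ht, hj, htb, readGate, hg, hi, hb]
    refine (Det.seq (c' := 7) (Det.ite (c := 7) (fun ho => ?_) fun ho => ?_)).cost_le (by
        simp only [BExp.cost, NExp.cost]; omega)
    · rw [holds_odd, hbi] at ho
      refine Det.setNat_le (by decide) (Det.setNat_le (by decide) ?_)
      simp [NExp.eval, h1, h2, ofDigits_succ, ho, pow_succ, mul_two]
    · rw [holds_odd, hbi] at ho
      have ho : b i % 2 = 0 := by omega
      refine Det.skip_le (by decide) (Det.setNat_le (by decide) ?_)
      simp [NExp.eval, h1, h2, ofDigits_succ, ho, pow_succ, mul_two]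
  · simp only [NExp.cost]
    nlinarith
  · rintro m' hA ⟨h1, h2⟩
    funext i
    rw [h2, bitsOf_ofDigits]
    simp [hb]

/-- The complex number in the real variables `2` and `3`. -/
def Mem.value (m : Mem) : ℂ := ⟨m.real 2 0, m.real 3 0⟩

theorem det_multiplyGate {m : Mem} {g : DiagGate n} {t j : ℕ} (ht : m.nat 26 0 = t)
    (hj : m.nat 27 0 = j) (hg : (gatesAt C t)[j]? = some g) :
    Det C N multiplyGate m (100 * n ^ 2 + 100) fun m' =>
      m'.value = m.value * g.diag (bitsOf g.arity (m.nat 29 0)) := by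
  unfold multiplyGate
  refine (Det.setReal_seq (Det.setReal_seq (Det.setReal ?_))).cost_le ?_
  · simp [RExp.eval, NExp.eval, ht, hj, readGate, hg, Mem.value, Complex.ext_iff]
  · simp only [RExp.cost, NExp.cost]
    omega

/-- The gates of a layer act on disjoint nonempty sets, so there are at most `n` of them. -/
theorem length_gatesAt_le (C : Circuit n d k) (t : ℕ) : (gatesAt C t).length ≤ n := by
  rw [gatesAt]
  split_ifs with h
  · have hinj : Function.Injective fun j : Fin (C.layer ⟨t, h⟩).length =>
        (C.layer ⟨t, h⟩)[j].qubit ⟨0, (C.layer ⟨t, h⟩)[j].arity_pos⟩ := by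
      intro i j hij
      by_contra hne
      have key : ∀ i j : Fin (C.layer ⟨t, h⟩).length, i < j →
          (C.layer ⟨t, h⟩)[i].qubit ⟨0, (C.layer ⟨t, h⟩)[i].arity_pos⟩
            ≠ (C.layer ⟨t, h⟩)[j].qubit ⟨0, (C.layer ⟨t, h⟩)[j].arity_pos⟩ := fun i j hlt heq =>
        Set.disjoint_left.1 (List.pairwise_iff_getElem.1 (C.disjoint ⟨t, h⟩) i j i.2 j.2 hlt)
          ⟨_, rfl⟩ ⟨_, heq.symm⟩
      rcases lt_or_gt_of_ne hne with hlt | hlt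
      · exact key i j hlt hij
      · exact key j i hlt hij.symm
    simpa using Fintype.card_le_of_injective _ hinj
  · simp

/-- The bits by which the string is shifted at layer `t`, as stored in array `3`. -/
def Mem.shift (m : Mem) (n t : ℕ) : Bits n := fun v => Fin.ofNat 2 (m.nat 3 (t * n + v))

theorem det_gateLoop {m : Mem} {t : ℕ} (ht : m.nat 26 0 = t) (htb : m.nat 31 0 = t * n)
    (hn : 1 ≤ n) :
    Det C N (.for 27 (.gateCount (.var 26)) (.seq gateIndex multiplyGate)) m (600 * n ^ 3)
      fun m' => m'.value = m.value * layerPhase C t (m.bits n 5 + m.shift n t) := by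
  set L := gatesAt C t with hL
  set f : DiagGate n → ℂ := fun g => g.diag fun i => (m.bits n 5 + m.shift n t) (g.qubit i) with hf
  refine (Det.for (c := 100 * n ^ 2 + 120 * n + 201) (M := L.length)
    (I := fun j m' => m'.value = m.value * ((L.take j).map f).prod)
    rfl ?_ ?_ ?_ ?_).mono ?_ ?_
  · intro m' hA
    simp [NExp.eval, hA.nat 26 rfl, ht, hL]
  · simp
  · intro j m' x h
    simpa [Mem.value] using h
  · intro j hj m' hA hjm hI
    have hg : (gatesAt C t)[j]? = some L[j] := by simp [hL]
    refine (Det.comp (det_gateIndex (t := t) (j := j) (tb := t * n) (by rw [hA.nat 26 rfl, ht]) hjm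
      (by rw [hA.nat 31 rfl, htb]) hg) (c' := 100 * n ^ 2 + 100) fun m₁ hA₁ h₁ => ?_).cost_le ?_
    · refine (det_multiplyGate (t := t) (j := j) (by rw [hA₁.nat 26 rfl, hA.nat 26 rfl, ht])
        (by rw [hA₁.nat 27 rfl, hjm]) hg).mono le_rfl fun m₂ hA₂ h₂ => ?_
      have hv : m₁.value = m'.value := by
        simp only [Mem.value, hA₁.real 2 rfl, hA₁.real 3 rfl]
      rw [h₂, hv, hI, h₁, List.take_add_one, List.getElem?_eq_getElem hj]
      simp only [Option.toList_some, List.map_append, List.map_cons, List.map_nil, List.prod_append,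
        List.prod_cons, List.prod_nil, mul_one, ← mul_assoc]
      congr 1
      simp only [hf, hA.nat 5 rfl, hA.nat 3 rfl, ofNat_add]
      rfl
    · omega
  · have h1 := length_gatesAt_le C t
    have h2 : (100 * n ^ 2 + 120 * n + 201 + (3 + 11)) * L.length
        ≤ (100 * n ^ 2 + 120 * n + 201 + (3 + 11)) * n := Nat.mul_le_mul_left _ h1
    have h3 : n * 1 ≤ n * n ^ 2 := Nat.mul_le_mul_left _ (Nat.one_le_pow _ _ hn)
    have h4 : n ^ 2 * 1 ≤ n ^ 2 * n := Nat.mul_le_mul_left _ hn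
    simp only [NExp.cost]
    nlinarith
  · intro m' hA h
    rw [List.take_length] at h
    exact h

theorem det_multiplyPhase {m : Mem} (hn : 1 ≤ n) (hd : 1 ≤ d) :
    Det C N multiplyPhase m (700 * d * n ^ 3) fun m' => m'.value
      = m.value * ∏ t ∈ Finset.range d, layerPhase C t (m.bits n 5 + m.shift n t) := by
  unfold multiplyPhase
  refine (Det.setNat_seq (Det.for (c := 600 * n ^ 3 + 7) (M := d)
    (I := fun j m' => m'.nat 31 0 = j * n ∧ m'.value
      = m.value * ∏ t ∈ Finset.range j, layerPhase C t (m.bits n 5 + m.shift n t))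
    rfl ?_ ?_ ?_ ?_)).mono ?_ ?_
  · intro m' hA
    rfl
  · simp [NExp.eval, Mem.value]
  · intro j m' x h
    simpa [Mem.value] using h
  · intro t ht m' hA htm hI
    refine (Det.comp (det_gateLoop htm hI.1 hn) fun m₁ hA₁ h₁ =>
      Det.setNat (Q := fun m' => _ ∧ _) ⟨?_, ?_⟩).cost_le ?_
    · simp [NExp.eval, hA₁.nat 31 rfl, hI.1, add_mul]
    · have hs : m'.bits n 5 = m.bits n 5 ∧ m'.shift n t = m.shift n t := by
        constructor
        · funext v
          simp only [Mem.bits, hA.nat 5 rfl]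
          rfl
        · funext v
          simp only [Mem.shift, hA.nat 3 rfl]
          rfl
      rw [Finset.prod_range_succ, ← mul_assoc, ← hI.2, ← hs.1, ← hs.2, ← h₁]
      simp [Mem.value]
    · simp only [NExp.cost]; omega
  · have h1 : 1 * 1 ≤ d * n ^ 3 := Nat.mul_le_mul hd (Nat.one_le_pow _ _ hn)
    have h2 : d * 1 ≤ d * n ^ 3 := Nat.mul_le_mul_left _ (Nat.one_le_pow _ _ hn)
    simp only [NExp.cost]
    nlinarith
  · exact fun m' _ h => h.2

end Evaluation

/-! ### Enumeration of the strings of a block -/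

section Enumeration

variable {n : ℕ}

/-- The elements of `P` below `j`. -/
def below (P : Finset (Fin n)) (j : ℕ) : Finset (Fin n) := P.filter fun w => (w : ℕ) < j

theorem below_succ_of_mem {P : Finset (Fin n)} {v : Fin n} (hv : v ∈ P) :
    below P (v + 1) = insert v (below P v) := by
  ext w
  simp only [below, Finset.mem_filter, Finset.mem_insert, Nat.lt_succ_iff_lt_or_eq, Fin.val_inj]
  grind

theorem below_succ_of_notMem {P : Finset (Fin n)} {v : Fin n} (hv : v ∉ P) :
    below P (v + 1) = below P v := by
  ext w
  simp only [below, Finset.mem_filter, Nat.lt_succ_iff_lt_or_eq, Fin.val_inj]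
  grind

theorem notMem_below_self (P : Finset (Fin n)) (v : Fin n) : v ∉ below P v := by
  simp [below]

@[simp] theorem below_zero (P : Finset (Fin n)) : below P 0 = ∅ := by simp [below]

@[simp] theorem below_self (P : Finset (Fin n)) : below P n = P := by simp [below]

/-- The string that has the binary digits of `X` on `P`, in increasing order, and coincides with `u`
elsewhere. -/
def decodeBits (P : Finset (Fin n)) (X : ℕ) (u : Bits n) : Bits n :=
  fun v => if v ∈ P then Fin.ofNat 2 (X / 2 ^ (below P v).card) else u v

/-- The digit with the number `P.card` belongs to an element above all elements of `P`. -/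
theorem decodeBits_insert {P : Finset (Fin n)} {a : Fin n} (ha : ∀ w ∈ P, w < a) {X : ℕ}
    (hX : X < 2 ^ P.card) (c : ℕ) (u : Bits n) :
    decodeBits (insert a P) (X + c * 2 ^ P.card) u
      = decodeBits P X (Function.update u a (Fin.ofNat 2 c)) := by
  have haP : a ∉ P := fun h => lt_irrefl _ (ha a h)
  have hbelow : ∀ w ≤ a, below (insert a P) w = below P w := by
    intro w hw
    ext z
    simp only [below, Finset.mem_filter, Finset.mem_insert]
    constructor
    · rintro ⟨rfl | h, h'⟩
      · exact absurd (Fin.lt_def.2 h') (not_lt.2 hw)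
      · exact ⟨h, h'⟩
    · exact fun h => ⟨Or.inr h.1, h.2⟩
  funext w
  by_cases hwa : w = a
  · subst hwa
    have h1 : (below P w).card = P.card := by
      congr 1
      exact Finset.filter_true_of_mem fun z hz => ha z hz
    rw [decodeBits, decodeBits, if_pos (by simp), if_neg haP, Function.update_self, hbelow w le_rfl,
      h1, Nat.add_mul_div_right _ _ (by positivity), Nat.div_eq_of_lt hX, zero_add]
  · by_cases hw : w ∈ P
    · have h2 : (below P w).card < P.card := by
        refine Finset.card_lt_card ⟨Finset.filter_subset _ _, fun h => ?_⟩
        exact notMem_below_self P w (h hw)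
      rw [decodeBits, decodeBits, if_pos (by simp [hw]), if_pos hw, hbelow w (ha w hw).le,
        ← ofNat_mod, add_mul_pow_div_mod h2 rfl, ofNat_mod]
    · rw [decodeBits, decodeBits, if_neg (by simp [hw, hwa]), if_neg hw, Function.update_of_ne hwa]

/-- Every string on `P` is enumerated exactly once. -/
theorem sum_decodeBits {M : Type*} [AddCommMonoid M] [Module ℝ≥0 M] (P : Finset (Fin n))
    (u : Bits n) (h : Bits n → M) :
    ∑ X ∈ Finset.range (2 ^ P.card), h (decodeBits P X u)
      = (2 : ℝ≥0) ^ P.card • avg fun y => h (P.piecewise y u) := by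
  induction P using Finset.induction_on_max generalizing u with
  | empty =>
    have : decodeBits ∅ 0 u = u := by funext v; simp [decodeBits]
    simp [this]
  | insert a P ha ih =>
    have haP : a ∉ P := fun h => lt_irrefl _ (ha a h)
    rw [Finset.card_insert_of_notMem haP, pow_succ, mul_two, Finset.sum_range_add]
    have h0 : ∀ X ∈ Finset.range (2 ^ P.card), h (decodeBits (insert a P) X u)
        = h (decodeBits P X (Function.update u a 0)) := by
      intro X hX
      have := decodeBits_insert ha (Finset.mem_range.1 hX) 0 u
      rw [zero_mul, add_zero] at this
      rw [this]
      rfl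
    have h1 : ∀ X ∈ Finset.range (2 ^ P.card), h (decodeBits (insert a P) (2 ^ P.card + X) u)
        = h (decodeBits P X (Function.update u a 1)) := by
      intro X hX
      have := decodeBits_insert ha (Finset.mem_range.1 hX) 1 u
      rw [one_mul, add_comm] at this
      rw [this]
      rfl
    rw [Finset.sum_congr rfl h0, Finset.sum_congr rfl h1, ih, ih,
      avg_piecewise_update (Finset.mem_insert_self a P), Finset.erase_insert haP, ← smul_add,
      smul_smul, pow_succ, mul_assoc, mul_inv_cancel₀ two_ne_zero, mul_one]

end Enumeration

section BlockAmplitude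

variable {n d k : ℕ} {C : Circuit n d k} {N : PauliNoise}

/-- The qubits whose label in array `2` is `l`. -/
def Mem.block (m : Mem) (n l : ℕ) : Finset (Fin n) := Finset.univ.filter fun v => m.nat 2 v = l

theorem Mem.mem_block {m : Mem} {l : ℕ} {v : Fin n} : v ∈ m.block n l ↔ m.nat 2 v = l := by
  simp [Mem.block]

/-- The phase that the gates give to a string, with the shifts stored in the memory. -/
def Mem.phase (C : Circuit n d k) (m : Mem) (x : Bits n) : ℂ :=
  ∏ t ∈ Finset.range d, layerPhase C t (x + m.shift n t)

theorem det_blockPowers {m : Mem} {l : ℕ} (hl : m.nat 19 0 = l) (hn : 1 ≤ n) :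
    Det C N blockPowers m (100 * n ^ 3) fun m' => m'.nat 21 0 = 2 ^ (m.block n l).card
      ∧ m'.real 6 0 = 4 ^ (m.block n l).card := by
  unfold blockPowers
  set P := m.block n l with hP
  refine (Det.setNat_seq (Det.setReal_seq (Det.for (c := 30 + 4 * n ^ 2) (M := n)
    (I := fun j m' => m'.nat 21 0 = 2 ^ (below P j).card ∧ m'.real 6 0 = 4 ^ (below P j).card)
    rfl ?_ ?_ ?_ ?_))).mono ?_ ?_
  · exact fun _ _ => rfl
  · simp [NExp.eval, RExp.eval]
  · intro j m' x h
    simpa using h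
  · intro j hj m' hA hjm hI
    have hmem : (BExp.natEq (.get 2 (.var 22)) (.var 19)).Holds C N m' ↔ (⟨j, hj⟩ : Fin n) ∈ P := by
      rw [holds_natEq, hP, Mem.mem_block]
      simp [NExp.eval, hjm, hA.nat 2 rfl, hA.nat 19 rfl, hl]
    refine (Det.ite (c := 10 + 4 * n ^ 2) (fun h => ?_) fun h => ?_).cost_le ?_
    · rw [hmem] at h
      have hc : (below P (j + 1)).card = (below P j).card + 1 := by
        rw [show j = ((⟨j, hj⟩ : Fin n) : ℕ) from rfl, below_succ_of_mem h,
          Finset.card_insert_of_notMem (notMem_below_self _ _)]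
      refine (Det.setNat_seq (Det.setReal (Q := fun m' => _ ∧ _) ⟨?_, ?_⟩)).cost_le ?_
      · simp [NExp.eval, hI.1, hc, pow_succ, mul_two]
      · simp [NExp.eval, RExp.eval, hI.2, hc, pow_succ, mul_comm]
      · simp only [NExp.cost, RExp.cost]; omega
    · rw [hmem] at h
      refine Det.skip_le (by omega) ?_
      have hc : below P (j + 1) = below P j := below_succ_of_notMem (v := ⟨j, hj⟩) h
      rwa [hc]
    · simp only [BExp.cost, NExp.cost]; omega
  · have h3 : n * 1 ≤ n * n ^ 2 := Nat.mul_le_mul_left _ (Nat.one_le_pow _ _ hn)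
    have h4 : n ^ 2 * 1 ≤ n ^ 2 * n := Nat.mul_le_mul_left _ hn
    simp only [NExp.cost, RExp.cost]
    nlinarith
  · intro m' _ h
    simpa using h

/-- The loop follows the digits in array `5` and variable `24`, and it accumulates the sign in the real
variables `2` and `3`. -/
theorem det_decode {m : Mem} {l X : ℕ} (hl : m.nat 19 0 = l) (hX : m.nat 23 0 = X) (hn : 1 ≤ n) :
    Det C N decode m (200 * n ^ 3) fun m' =>
      m'.bits n 5 = decodeBits (m.block n l) X (m.bits n 1)
      ∧ m'.value = chi (m.block n l) (m.bits n 0 + m.bits n 4)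
        (decodeBits (m.block n l) X (m.bits n 1)) := by
  unfold decode
  set P := m.block n l with hP
  set y := decodeBits P X (m.bits n 1) with hy
  set b := m.bits n 0 + m.bits n 4 with hb
  refine (Det.setNat_seq (Det.setReal_seq (Det.setReal_seq (Det.for (c := 100 + 4 * n ^ 2) (M := n)
    (I := fun j m' => (∀ v : Fin n, (v : ℕ) < j → Fin.ofNat 2 (m'.nat 5 v) = y v)
      ∧ m'.nat 24 0 = X / 2 ^ (below P j).card ∧ m'.value = chi (below P j) b y)
    rfl ?_ ?_ ?_ ?_)))).mono ?_ ?_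
  · exact fun _ _ => rfl
  · simp [NExp.eval, RExp.eval, hX, Mem.value, chi, Complex.ext_iff]
  · intro j m' x h
    simpa [Mem.value] using h
  · intro j hj m' hA hjm ⟨hI1, hI2, hI3⟩
    set v : Fin n := ⟨j, hj⟩ with hv
    have hmem : (BExp.natEq (.get 2 (.var 25)) (.var 19)).Holds C N m' ↔ v ∈ P := by
      rw [holds_natEq, hP, Mem.mem_block]
      simp [NExp.eval, hjm, hA.nat 2 rfl, hA.nat 19 rfl, hl, hv]
    have hlt : ∀ w : Fin n, (w : ℕ) < j + 1 → w ≠ v → (w : ℕ) < j := by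
      intro w hw hne
      rcases Nat.lt_succ_iff_lt_or_eq.1 hw with h | h
      · exact h
      · exact absurd (Fin.ext h) hne
    refine (Det.ite (c := 66 + 4 * n ^ 2) (fun h => ?_) fun h => ?_).cost_le ?_
    · rw [hmem] at h
      have hc : below P (j + 1) = insert v (below P j) := below_succ_of_mem h
      have hcard : (below P (j + 1)).card = (below P j).card + 1 := by
        rw [hc, Finset.card_insert_of_notMem (notMem_below_self P v)]
      have hyv : y v = Fin.ofNat 2 (m'.nat 24 0) := by
        rw [hI2, hy, decodeBits, if_pos h]
      have hbv : b v = Fin.ofNat 2 (m'.nat 0 j + m'.nat 4 j) := by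
        rw [hA.nat 0 rfl, hA.nat 4 rfl, ofNat_add]
        rfl
      have hchi : chi (below P (j + 1)) b y = sgn (b v * y v) * chi (below P j) b y := by
        rw [hc, chi, Finset.prod_insert (notMem_below_self P v)]
        rfl
      have hbits : ∀ w : Fin n, (w : ℕ) < j + 1 →
          Fin.ofNat 2 (Function.update (m'.nat 5) j (m'.nat 24 0 % 2) w) = y w := by
        intro w hw
        by_cases hwv : w = v
        · rw [hwv, hyv, hv, Function.update_self, ofNat_mod]
        · rw [Function.update_of_ne (fun h => hwv (Fin.ext h)), hI1 w (hlt w hw hwv)]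
      have hdiv : m'.nat 24 0 / 2 = X / 2 ^ (below P (j + 1)).card := by
        rw [hI2, hcard, pow_succ, Nat.div_div_eq_div_mul]
      have hpar : ∀ a : ℕ, a - (a / 2 + a / 2) = a % 2 := fun a => by omega
      have hodd : (BExp.and (.odd (.get 5 (.var 25)))
          (.odd (.plus (.get 0 (.var 25)) (.get 4 (.var 25))))).Holds C N
          ((m'.setNat 5 (NExp.eval C m' (.var 25)) (NExp.eval C m' (NExp.parity (.var 24)))).setNat
            24 0 (m'.nat 24 0 / 2)) ↔ y v = 1 ∧ b v = 1 := by
        rw [hyv, hbv, ofNat_eq_one_iff, ofNat_eq_one_iff]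
        refine and_congr (holds_odd.trans ?_) (holds_odd.trans ?_)
        · simp [NExp.eval, hjm, hpar]
        · simp [NExp.eval, hjm]
      refine (Det.setNat_seq (Det.setNat_seq (Det.ite (c := 2 + 4 * n ^ 2)
        (fun h' => ?_) fun h' => ?_))).cost_le ?_
      · refine Det.setReal_le ?_ ?_
        · simp only [NExp.cost, RExp.cost]; omega
        have h' := hodd.1 h'
        refine ⟨?_, ?_, ?_⟩
        · simpa [NExp.eval, hjm, hpar] using hbits
        · simpa [NExp.eval, hjm] using hdiv
        · rw [hchi, h'.1, h'.2, ← hI3]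
          have him : m'.real 3 0 = 0 := by
            rw [← Complex.conj_eq_iff_im.1 (conj_chi (below P j) b y), ← hI3]
            rfl
          simp [Mem.value, RExp.eval, NExp.eval, Complex.ext_iff, him]
      · have h' := fun h => h' (hodd.2 h)
        refine Det.skip_le (by omega) ⟨?_, ?_, ?_⟩
        · simpa [NExp.eval, hjm, hpar] using hbits
        · simpa [NExp.eval, hjm] using hdiv
        · have h1 : sgn (b v * y v) = 1 := by
            revert h'
            generalize b v = β
            generalize y v = γ
            fin_cases β <;> fin_cases γ <;> simp
          rw [hchi, h1, one_mul, ← hI3]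
          simp [Mem.value]
      · simp only [NExp.cost, BExp.cost]; omega
    · rw [hmem] at h
      have hc : below P (j + 1) = below P j := below_succ_of_notMem (v := ⟨j, hj⟩) h
      refine Det.setNat_le ?_ ⟨?_, ?_, ?_⟩
      · simp only [NExp.cost]; omega
      · intro w hw
        by_cases hwv : w = v
        · rw [hwv, hy, decodeBits, if_neg h]
          simp only [NExp.eval, hjm, Mem.setNat_nat, if_true, hv, Function.update_self,
            hA.nat 1 rfl]
          rfl
        · have := hI1 w (hlt w hw hwv)
          have hne : (w : ℕ) ≠ j := fun h => hwv (Fin.ext h)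
          simpa [NExp.eval, hjm, hne] using this
      · simpa [hc] using hI2
      · simpa [hc, Mem.value] using hI3
    · simp only [BExp.cost, NExp.cost]; omega
  · have h3 : n * 1 ≤ n * n ^ 2 := Nat.mul_le_mul_left _ (Nat.one_le_pow _ _ hn)
    have h4 : n ^ 2 * 1 ≤ n ^ 2 * n := Nat.mul_le_mul_left _ hn
    simp only [NExp.cost, RExp.cost]
    nlinarith
  · intro m' _ h
    rw [below_self] at h
    exact ⟨funext fun v => h.1 v v.2, h.2.2⟩

/-- The sum that the program evaluates is the amplitude up to normalization. -/
theorem chi_mul_phase_eq_sum (m : Mem) (P : Finset (Fin n)) (b u : Bits n) :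
    ∑ X ∈ Finset.range (2 ^ P.card), chi P b (decodeBits P X u) * m.phase C (decodeBits P X u)
      = 2 ^ P.card * amp P (m.phase C) b u := by
  rw [sum_decodeBits P u fun y => chi P b y * m.phase C y, amp, NNReal.smul_def, Complex.real_smul]
  push_cast
  congr 2
  funext y
  congr 1
  exact chi_congr (fun _ _ => rfl) fun v hv => by simp [hv]

/-- The complex number in the real variables `4` and `5`. -/
def Mem.total (m : Mem) : ℂ := ⟨m.real 4 0, m.real 5 0⟩

theorem det_blockAmplitude {m : Mem} {l : ℕ} (hl : m.nat 19 0 = l)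
    (hs : m.nat 21 0 = 2 ^ (m.block n l).card) (hn : 1 ≤ n) (hd : 1 ≤ d) :
    Det C N blockAmplitude m (1000 * (d * n ^ 3) * 2 ^ (m.block n l).card) fun m' =>
      m'.total = 2 ^ (m.block n l).card
        * amp (m.block n l) (m.phase C) (m.bits n 0 + m.bits n 4) (m.bits n 1) := by
  have h1 : 1 * 1 ≤ d * n ^ 3 := Nat.mul_le_mul hd (Nat.one_le_pow _ _ hn)
  have h2 : 1 * n ^ 3 ≤ d * n ^ 3 := Nat.mul_le_mul_right _ hd
  have h3 : n ^ 2 ≤ n ^ 3 := Nat.pow_le_pow_right hn (by norm_num)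
  unfold blockAmplitude
  set P := m.block n l with hP
  set b := m.bits n 0 + m.bits n 4 with hb
  refine (Det.setReal_seq (Det.setReal_seq (Det.for (c := 930 * (d * n ^ 3)) (M := 2 ^ P.card)
    (I := fun X m' => m'.total = ∑ X ∈ Finset.range X,
      chi P b (decodeBits P X (m.bits n 1)) * m.phase C (decodeBits P X (m.bits n 1)))
    rfl ?_ ?_ ?_ ?_))).mono ?_ ?_
  · intro m' hA
    simp [NExp.eval, hA.nat 21 rfl, hs]
  · simp [NExp.eval, RExp.eval, Mem.total, Complex.ext_iff]
  · intro j m' x h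
    simpa [Mem.total] using h
  · intro X hX m' hA hXm hI
    refine (Det.comp (det_decode (l := l) (X := X) (by simp [hA.nat 19 rfl, hl]) hXm hn)
      fun m₁ hA₁ h₁ => Det.comp (det_multiplyPhase hn hd)
      fun m₂ hA₂ h₂ => Det.setReal_seq (Det.setReal (Q := fun m' => _ = _) ?_)).cost_le ?_
    · have hblock : m'.block n l = P := by
        simp only [hP, Mem.block, hA.nat 2 rfl]
        rfl
      have hbits : ∀ a ∈ [0, 1, 4], m'.bits n a = m.bits n a := by
        intro a ha
        funext v
        simp only [List.mem_cons, List.not_mem_nil, or_false] at ha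
        rcases ha with rfl | rfl | rfl <;>
          simp only [Mem.bits, hA.nat 0 rfl, hA.nat 1 rfl, hA.nat 4 rfl] <;> rfl
      have hs : ∀ t, m₁.shift n t = m.shift n t := fun t => by
        funext v
        simp only [Mem.shift, hA₁.nat 3 rfl, hA.nat 3 rfl]
        rfl
      rw [hblock, hbits 0 (by simp), hbits 1 (by simp), hbits 4 (by simp), ← hb] at h₁
      simp only [hs, h₁.1, h₁.2] at h₂
      rw [Finset.sum_range_succ, ← hI, Mem.phase, ← h₂]
      simp [Mem.total, Mem.value, NExp.eval, RExp.eval, Complex.ext_iff, hA₂.real 4 rfl,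
        hA₂.real 5 rfl, hA₁.real 4 rfl, hA₁.real 5 rfl]
    · simp only [NExp.cost, RExp.cost]
      nlinarith
  · have h4 : 1 * 1 ≤ d * n ^ 3 * 2 ^ P.card := Nat.mul_le_mul (by omega) Nat.one_le_two_pow
    have h5 : d * n ^ 3 * 1 ≤ d * n ^ 3 * 2 ^ P.card := Nat.mul_le_mul_left _ Nat.one_le_two_pow
    have h6 : 1 * 2 ^ P.card ≤ d * n ^ 3 * 2 ^ P.card := Nat.mul_le_mul_right _ (by omega)
    simp only [NExp.cost, RExp.cost]
    nlinarith
  · intro m' _ h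
    rw [h, chi_mul_phase_eq_sum]

end BlockAmplitude

/-! ### Uniformly random strings and rejection sampling -/

section Flips

variable {n d k : ℕ} {C : Circuit n d k} {N : PauliNoise} {ε : ℝ≥0∞}

/-- The elements of `P` that are at least `j`. -/
def above (P : Finset (Fin n)) (j : ℕ) : Finset (Fin n) := P.filter fun w => j ≤ (w : ℕ)

@[simp] theorem above_zero (P : Finset (Fin n)) : above P 0 = P := by simp [above]

@[simp] theorem above_self (P : Finset (Fin n)) : above P n = ∅ := by
  simp [above, Finset.filter_eq_empty_iff]

theorem mem_above_self {P : Finset (Fin n)} {v : Fin n} (hv : v ∈ P) : v ∈ above P v := by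
  simp [above, hv]

theorem above_erase (P : Finset (Fin n)) (v : Fin n) :
    (above P v).erase v = above P (v + 1) := by
  ext w
  simp only [above, Finset.mem_erase, Finset.mem_filter, Nat.succ_le_iff, ne_eq, ← Fin.val_inj,
    lt_iff_le_and_ne]
  tauto

theorem above_succ_of_notMem {P : Finset (Fin n)} {v : Fin n} (hv : v ∉ P) :
    above P (v + 1) = above P v := by
  rw [← above_erase, Finset.erase_eq_of_notMem]
  simp [above, hv]

theorem Mem.bits_setNat_self (m : Mem) (a : ℕ) (v : Fin n) (x : ℕ) :
    (m.setNat a v x).bits n a = Function.update (m.bits n a) v (Fin.ofNat 2 x) := by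
  funext w
  by_cases h : w = v
  · subst h
    simp [Mem.bits]
  · have h' : (w : ℕ) ≠ v := fun e => h (Fin.ext e)
    simp [Mem.bits, h, h']

theorem Mem.bits_setNat_of_ne (m : Mem) {a a' : ℕ} (h : a' ≠ a) (i x : ℕ) :
    (m.setNat a i x).bits n a' = m.bits n a' := by
  funext w
  simp [Mem.bits, h]

/-- A loop that flips the cells of the array `a` at the qubits in `P`. -/
theorem ert_flips_le {a c : ℕ} {q : Prog} {X : Mem → ℝ≥0∞} {m₀ : Mem} {P : Finset (Fin n)}
    {g : Bits n → ℝ≥0∞} (ha : a ≠ 6) (hw : q.writesNat 6 = false) (hwa : q.writesNat a = true)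
    (hq : ∀ m, Agree (Prog.for 6 .numQubits q) m₀ m → ∀ v : Fin n, m.nat 6 0 = v →
      ∀ X, ert C N ε q X m ≤ ε * c
        + if v ∈ P then 2⁻¹ * (X (m.setNat a v 0) + X (m.setNat a v 1)) else X m)
    (hX : ∀ m, Agree (Prog.for 6 .numQubits q) m₀ m → X m ≤ g (m.bits n a)) :
    ert C N ε (Prog.for 6 .numQubits q) X m₀
      ≤ ε * ((c + 12) * n + 9 : ℕ) + avg fun y => g (P.piecewise y (m₀.bits n a)) := by
  refine (ert_for_le (M := n) (c := c) (I := fun _ _ => True)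
    -- The cells from `j` on are still to be randomized.
    (J := fun j m => avg fun y => g ((above P j).piecewise y (m.bits n a))) hw (fun _ _ => rfl)
    trivial (fun _ _ _ _ => trivial) ?_ ?_ ?_).trans ?_
  · intro j m x
    rw [Mem.bits_setNat_of_ne _ ha]
  · intro j hj m hA hjm _ X hX
    refine (hq m hA ⟨j, hj⟩ hjm X).trans (add_le_add le_rfl ?_)
    have hagree : ∀ x, Agree q m (m.setNat a j x) := fun x => ⟨fun a' ha' => by
      have : a' ≠ a := by rintro rfl; simp [hwa] at ha'
      simp [this], fun _ _ => rfl⟩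
    split_ifs with h
    · simp only
      rw [avg_piecewise_update (v := ⟨j, hj⟩) (mem_above_self h), above_erase,
        ENNReal.smul_def, smul_eq_mul, ENNReal.coe_inv two_ne_zero, ENNReal.coe_ofNat]
      refine mul_le_mul_right (add_le_add ((hX _ (hagree 0) trivial).trans (le_of_eq ?_))
        ((hX _ (hagree 1) trivial).trans (le_of_eq ?_))) _
      · rw [Mem.bits_setNat_self m a ⟨j, hj⟩]
        rfl
      · rw [Mem.bits_setNat_self m a ⟨j, hj⟩]
        rfl
    · refine (hX m (Agree.refl _ _) trivial).trans (le_of_eq ?_)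
      rw [show j + 1 = ((⟨j, hj⟩ : Fin n) : ℕ) + 1 from rfl, above_succ_of_notMem h]
  · intro m hA _
    rw [above_self]
    simpa using hX m hA
  · rw [above_zero]
    simp only [NExp.cost]
    exact le_of_eq (by congr 3)

theorem ert_flip (a : ℕ) (i : NExp) (X : Mem → ℝ≥0∞) (m : Mem) :
    ert C N ε (.flip a i) X m = ε * (i.cost + 1 : ℕ)
      + 2⁻¹ * (X (m.setNat a (i.eval C m) 0) + X (m.setNat a (i.eval C m) 1)) := rfl

theorem ert_flipAll_le {a : ℕ} {X : Mem → ℝ≥0∞} {m₀ : Mem} {g : Bits n → ℝ≥0∞} (ha : a ≠ 6)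
    (hX : ∀ m, Agree (flipAll a) m₀ m → X m ≤ g (m.bits n a)) :
    ert C N ε (flipAll a) X m₀ ≤ ε * (15 * n + 9 : ℕ) + avg g := by
  refine (ert_flips_le (c := 3) (P := Finset.univ) ha (by simp [Prog.writesNat, ha])
    (by simp [Prog.writesNat]) ?_ hX).trans (le_of_eq ?_)
  · intro m hA v hv X
    rw [if_pos (Finset.mem_univ v), ert_flip]
    simp [NExp.eval, NExp.cost, hv]
  · simp

theorem ert_flipBlock_le {l : ℕ} {X : Mem → ℝ≥0∞} {m₀ : Mem} {g : Bits n → ℝ≥0∞}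
    (hl : m₀.nat 19 0 = l) (hX : ∀ m, Agree flipBlock m₀ m → X m ≤ g (m.bits n 0)) :
    ert C N ε flipBlock X m₀
      ≤ ε * (31 * n + 9 : ℕ) + avg fun y => g ((m₀.block n l).piecewise y (m₀.bits n 0)) := by
  refine ert_flips_le (c := 19) (by norm_num) rfl rfl ?_ hX
  intro m hA v hv X
  have hmem : (BExp.natEq (.get 2 (.var 6)) (.var 19)).Holds C N m ↔ v ∈ m₀.block n l := by
    rw [holds_natEq, Mem.mem_block]
    simp [NExp.eval, hv, hA.nat 2 rfl, hA.nat 19 rfl, hl]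
  by_cases h : v ∈ m₀.block n l
  · rw [if_pos h]
    simp only [ert, if_pos (hmem.2 h), NExp.eval, hv]
    rw [← add_assoc, ← mul_add, ← Nat.cast_add]
    simp only [Prog.stepCost, BExp.cost, NExp.cost]
    gcongr
  · rw [if_neg h]
    simp only [ert, if_neg (mt hmem.1 h)]
    rw [← add_assoc, ← mul_add, ← Nat.cast_add]
    simp only [Prog.stepCost, BExp.cost, NExp.cost]
    gcongr
    norm_num

end Flips

section Rejection

variable {n d k : ℕ} {C : Circuit n d k} {N : PauliNoise} {ε : ℝ≥0∞}

/-- The probability to accept the string `b` in the block with the label `l`. -/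
def Mem.accept (C : Circuit n d k) (m : Mem) (l : ℕ) (b : Bits n) : ℝ :=
  ‖amp (m.block n l) (m.phase C) (b + m.bits n 4) (m.bits n 1)‖ ^ 2

theorem Mem.norm_phase (m : Mem) (x : Bits n) : ‖m.phase C x‖ = 1 := by
  simp [Mem.phase, norm_prod, norm_layerPhase]

theorem Mem.accept_nonneg (m : Mem) (l : ℕ) (b : Bits n) : 0 ≤ m.accept C l b := sq_nonneg _

theorem Mem.accept_le_one (m : Mem) (l : ℕ) (b : Bits n) : m.accept C l b ≤ 1 :=
  pow_le_one₀ (norm_nonneg _) (norm_amp_le_one m.norm_phase _ _ _)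

theorem Mem.accept_congr (m : Mem) {l : ℕ} {b b' : Bits n} (h : ∀ v ∈ m.block n l, b v = b' v) :
    m.accept C l b = m.accept C l b' := by
  rw [Mem.accept, Mem.accept, amp_congr]
  intro v hv
  rw [Pi.add_apply, Pi.add_apply, h v hv]

theorem Mem.avg_accept (m : Mem) (l : ℕ) :
    avg (m.accept C l) = (2⁻¹ : ℝ) ^ (m.block n l).card := by
  rw [← avg_norm_amp_sq (m.norm_phase (C := C)) (m.block n l) (m.bits n 1)]
  exact avg_add_right (m.bits n 4) fun b =>
    ‖amp (m.block n l) (m.phase C) b (m.bits n 1)‖ ^ 2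

theorem Mem.bits_congr {m m' : Mem} {a : ℕ} (h : m'.nat a = m.nat a) :
    m'.bits n a = m.bits n a := by
  funext v
  rw [Mem.bits, Mem.bits, h]

theorem Mem.block_congr {m m' : Mem} (h : m'.nat 2 = m.nat 2) (l : ℕ) :
    m'.block n l = m.block n l := by
  simp only [Mem.block, h]

theorem Mem.phase_congr {m m' : Mem} (h : m'.nat 3 = m.nat 3) : m'.phase C = m.phase C := by
  funext x
  simp only [Mem.phase]
  have : ∀ t, m'.shift n t = m.shift n t := fun t => by
    funext v
    rw [Mem.shift, Mem.shift, h]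
  simp only [this]

theorem Mem.accept_eq {m m' : Mem} (h1 : m'.nat 1 = m.nat 1) (h2 : m'.nat 2 = m.nat 2)
    (h3 : m'.nat 3 = m.nat 3) (h4 : m'.nat 4 = m.nat 4) (l : ℕ) :
    (m'.accept C l : Bits n → ℝ) = m.accept C l := by
  funext b
  rw [Mem.accept, Mem.accept, Mem.bits_congr h1, Mem.bits_congr h4, Mem.block_congr h2,
    Mem.phase_congr h3]

theorem ert_seq_le_of_det {p q : Prog} {X : Mem → ℝ≥0∞} {m : Mem} {c : ℕ} {Q : Mem → Prop}
    {e : ℝ≥0∞} (hp : Det C N p m c Q)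
    (hq : ∀ m', Agree p m m' → Q m' → ert C N ε q X m' ≤ e) :
    ert C N ε (.seq p q) X m ≤ ε * (c + 1 : ℕ) + e := by
  refine ert_seq_le ((add_le_add_right (hp.frame ε _ e fun m' h => hq m' h.1 h.2) _).trans
    (le_of_eq ?_))
  push_cast
  ring

/-- A random draw with the success probability `x`, followed by a program that looks at the result. -/
theorem ert_draw_le {e : RExp} {q : Prog} {X : Mem → ℝ≥0∞} {m : Mem} {x : ℝ} {c : ℕ}
    {a b : ℝ≥0∞} (hx : e.eval C N m = x) (h0 : 0 ≤ x) (h1 : x ≤ 1)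
    (hb : ∀ m', Agree (.seq (.assignReal 0 e) bernoulli) m m' → m'.real 0 0 < 1 →
      ert C N ε q X m' ≤ ε * c + b)
    (ha : ∀ m', Agree (.seq (.assignReal 0 e) bernoulli) m m' → ¬ m'.real 0 0 < 1 →
      ert C N ε q X m' ≤ ε * c + a) :
    ert C N ε (.seq (.assignReal 0 e) (.seq bernoulli q)) X m
      ≤ ε * (e.cost (n ^ 2) + 31 * n ^ 2 + 37 + c : ℕ)
        + (ENNReal.ofReal x * a + ENNReal.ofReal (1 - x) * b) := by
  have hsum : ENNReal.ofReal x + ENNReal.ofReal (1 - x) = 1 := by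
    rw [← ENNReal.ofReal_add h0 (by linarith)]; simp
  refine (ert_seq_le_of_det (Q := fun m' => m'.real 0 0 = x)
    (e := ε * (30 * n ^ 2 + 35 + c : ℕ)
      + (ENNReal.ofReal x * a + ENNReal.ofReal (1 - x) * b)) (Det.setReal ?_) ?_).trans ?_
  · simp [NExp.eval, hx]
  · rintro m₁ hA hr₁
    refine ert_seq_le ((add_le_add_right (ert_bernoulli_le (a := ε * c + a) (b := ε * c + b)
      (by rwa [hr₁]) (by rwa [hr₁]) fun m₂ hA₂ => ?_) _).trans ?_)
    · have hag : Agree (.seq (.assignReal 0 e) bernoulli) m m₂ := by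
        refine (hA.mono (fun a ha => ?_) fun a ha => ?_).trans
          (hA₂.mono (fun a ha => ?_) fun a ha => ?_) <;>
          simp only [Prog.writesNat, Prog.writesReal, Bool.or_eq_false_iff] at ha ⊢ <;>
          first | exact ha.1 | exact ha.2
      split_ifs with hlt
      · exact hb m₂ hag hlt
      · exact ha m₂ hag hlt
    · rw [hr₁]
      refine le_of_eq ?_
      calc _ = ε + ε * (30 * n ^ 2 + 34 : ℕ)
            + ((ENNReal.ofReal x + ENNReal.ofReal (1 - x)) * (ε * c))
            + (ENNReal.ofReal x * a + ENNReal.ofReal (1 - x) * b) := by ring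
        _ = _ := by rw [hsum]; push_cast; ring
  · rw [← add_assoc, ← mul_add, ← Nat.cast_add]
    refine add_le_add (mul_le_mul_right (Nat.cast_le.2 ?_) _) le_rfl
    simp only [NExp.cost]
    omega

/-- The second half of a round of rejection sampling: the pair `(4, 5)` of real variables holds the
sum of all contributions to the amplitude. -/
theorem ert_acceptance_le {X : Mem → ℝ≥0∞} {m : Mem} {r : ℝ} {a b : ℝ≥0∞}
    (h20 : m.nat 20 0 = 0) (h0 : 0 ≤ r) (h1 : r ≤ 1)
    (hr : (m.real 4 0 * m.real 4 0 + m.real 5 0 * m.real 5 0) / m.real 6 0 = r)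
    (ha : ∀ m', m'.nat 0 = m.nat 0 → m'.nat 20 0 = 1 → X m' ≤ a)
    (hb : ∀ m', m'.nat 0 = m.nat 0 → m'.nat 20 0 = 0 → X m' ≤ b) :
    ert C N ε (.seq (.assignReal 0 (.quot
        (.plus (.times (.var 4) (.var 4)) (.times (.var 5) (.var 5))) (.var 6)))
      (.seq bernoulli (.ite .failed .skip (.assign 20 (.const 1))))) X m
      ≤ ε * (50 * n ^ 2 + 60 : ℕ) + (ENNReal.ofReal r * a + ENNReal.ofReal (1 - r) * b) := by
  have hcost : (BExp.failed).cost (n ^ 2) + 1 + 5 ≤ 3 * n ^ 2 + 8 := by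
    simp only [BExp.cost, RExp.cost, NExp.cost]; omega
  refine (ert_draw_le (c := 3 * n ^ 2 + 8) (a := a) (b := b) (x := r) ?_ h0 h1
    (fun m₂ hA₂ hlt => ?_) fun m₂ hA₂ hlt => ?_).trans ?_
  · simp [RExp.eval, NExp.eval, hr]
  · refine ((Det.ite (c := 5) (Q := fun m' => m'.nat 0 = m.nat 0 ∧ m'.nat 20 0 = 0)
      (fun _ => Det.skip_le (by norm_num) ⟨hA₂.nat 0 rfl, ?_⟩) fun h => ?_).cost_le hcost) ε X b
      fun m' h => hb m' h.1 h.2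
    · rw [hA₂.nat 20 rfl, h20]
    · exact absurd (by simpa [BExp.Holds, RExp.eval, NExp.eval] using hlt) h
  · refine ((Det.ite (c := 5) (Q := fun m' => m'.nat 0 = m.nat 0 ∧ m'.nat 20 0 = 1)
      (fun h => ?_) fun _ => Det.setNat_le (by simp [NExp.cost]) ⟨?_, ?_⟩).cost_le hcost) ε X a
      fun m' h => ha m' h.1 h.2
    · exact absurd h (by simpa [BExp.Holds, RExp.eval, NExp.eval] using hlt)
    · simpa using hA₂.nat 0 rfl
    · simp [NExp.eval]
  · refine add_le_add (mul_le_mul_right (Nat.cast_le.2 ?_) _) le_rfl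
    simp only [RExp.cost, NExp.cost]
    omega

/-- One round of rejection sampling draws a uniformly random string for the block and accepts it with
the squared norm of its amplitude. -/
theorem ert_tryBlock_le {l : ℕ} {X : Mem → ℝ≥0∞} {m : Mem} {A B : Bits n → ℝ≥0∞}
    (hl : m.nat 19 0 = l) (h20 : m.nat 20 0 = 0) (hn : 1 ≤ n) (hd : 1 ≤ d)
    (hA : ∀ m', m'.nat 20 0 = 1 → X m' ≤ A (m'.bits n 0))
    (hB : ∀ m', m'.nat 20 0 = 0 → X m' ≤ B (m'.bits n 0)) :
    ert C N ε tryBlock X m ≤ ε * (1400 * (d * n ^ 3) * 2 ^ (m.block n l).card : ℕ)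
      + avg fun y => ENNReal.ofReal (m.accept C l y) * A ((m.block n l).piecewise y (m.bits n 0))
        + ENNReal.ofReal (1 - m.accept C l y) * B ((m.block n l).piecewise y (m.bits n 0)) := by
  set P := m.block n l with hP
  set g : Bits n → ℝ≥0∞ := fun y => ENNReal.ofReal (m.accept C l y) * A y
    + ENNReal.ofReal (1 - m.accept C l y) * B y with hg
  set c : ℕ := (100 * n ^ 3 + 1) + ((1000 * (d * n ^ 3) * 2 ^ P.card + 1) + (50 * n ^ 2 + 60))
    with hc
  unfold tryBlock
  refine ert_seq_le ((add_le_add_right (ert_flipBlock_le (g := fun y => ε * c + g y) hl ?_) _).trans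
    ?_)
  · intro m₁ hA₁
    have hP₁ : m₁.block n l = P := Mem.block_congr (hA₁.nat 2 rfl) l
    have hacc₁ : (m₁.accept C l : Bits n → ℝ) = m.accept C l :=
      Mem.accept_eq (hA₁.nat 1 rfl) (hA₁.nat 2 rfl) (hA₁.nat 3 rfl) (hA₁.nat 4 rfl) l
    have hl₁ : m₁.nat 19 0 = l := by rw [hA₁.nat 19 rfl, hl]
    refine (ert_seq_le_of_det (det_blockPowers hl₁ hn) (e := ε *
      ((1000 * (d * n ^ 3) * 2 ^ P.card + 1) + (50 * n ^ 2 + 60) : ℕ) + g (m₁.bits n 0))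
      fun m₂ hA₂ h₂ => ?_).trans (le_of_eq ?_)
    · have hP₂ : m₂.block n l = P := (Mem.block_congr (hA₂.nat 2 rfl) l).trans hP₁
      have hacc₂ : (m₂.accept C l : Bits n → ℝ) = m.accept C l :=
        (Mem.accept_eq (hA₂.nat 1 rfl) (hA₂.nat 2 rfl) (hA₂.nat 3 rfl) (hA₂.nat 4 rfl) l).trans
          hacc₁
      have hb₂ : m₂.bits n 0 = m₁.bits n 0 := Mem.bits_congr (hA₂.nat 0 rfl)
      rw [hP₁] at h₂
      have hamp := det_blockAmplitude (C := C) (N := N) (m := m₂) (l := l)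
        (by rw [hA₂.nat 19 rfl, hl₁]) (by rw [h₂.1, hP₂]) hn hd
      rw [hP₂] at hamp
      refine (ert_seq_le_of_det hamp (e := ε * (50 * n ^ 2 + 60 : ℕ) + g (m₁.bits n 0))
        fun m₃ hA₃ h₃ => ?_).trans (le_of_eq ?_)
      · refine ert_acceptance_le ?_ (m.accept_nonneg l _) (m.accept_le_one l _) ?_
          (fun m' h0 h1 => ?_) fun m' h0 h1 => ?_
        · rw [hA₃.nat 20 rfl, hA₂.nat 20 rfl, hA₁.nat 20 rfl, h20]
        · rw [← hacc₂, ← hb₂, Mem.accept, hP₂, hA₃.real 6 rfl, h₂.2,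
            div_eq_iff (by positivity)]
          have hsq : m₃.real 4 0 * m₃.real 4 0 + m₃.real 5 0 * m₃.real 5 0 = ‖m₃.total‖ ^ 2 := by
            rw [← Complex.normSq_eq_norm_sq, Complex.normSq_apply]
            rfl
          rw [hsq, h₃, norm_mul, mul_pow, mul_comm]
          congr 1
          rw [norm_pow, ← pow_mul, mul_comm, pow_mul]
          norm_num
        · have h := hA m' h1
          rwa [Mem.bits_congr h0, Mem.bits_congr (hA₃.nat 0 rfl), hb₂] at h
        · have h := hB m' h1
          rwa [Mem.bits_congr h0, Mem.bits_congr (hA₃.nat 0 rfl), hb₂] at h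
      · rw [← add_assoc, ← mul_add, ← Nat.cast_add]
    · rw [← add_assoc, ← mul_add, ← Nat.cast_add]
  · have hcost : 1 + (31 * n + 9) + c ≤ 1400 * (d * n ^ 3) * 2 ^ P.card := by
      have h1 : 1 * 1 ≤ d * n ^ 3 := Nat.mul_le_mul hd (Nat.one_le_pow _ _ hn)
      have h2 : 1 * n ^ 3 ≤ d * n ^ 3 := Nat.mul_le_mul_right _ hd
      have h3 : n ^ 2 ≤ n ^ 3 := Nat.pow_le_pow_right hn (by norm_num)
      have h4 : n ^ 1 ≤ n ^ 3 := Nat.pow_le_pow_right hn (by norm_num)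
      have h5 : d * n ^ 3 * 1 ≤ d * n ^ 3 * 2 ^ P.card := Nat.mul_le_mul_left _ Nat.one_le_two_pow
      rw [hc]
      nlinarith
    have hgP : ∀ y, g (P.piecewise y (m.bits n 0)) = ENNReal.ofReal (m.accept C l y)
        * A (P.piecewise y (m.bits n 0))
        + ENNReal.ofReal (1 - m.accept C l y) * B (P.piecewise y (m.bits n 0)) := by
      intro y
      rw [hg]
      simp only
      rw [m.accept_congr (b := P.piecewise y (m.bits n 0)) (b' := y) fun v hv => by
        simp [← hP] at hv
        simp [hv]]
    have e : (avg fun y => ε * c + g (P.piecewise y (m.bits n 0)))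
        = ε * c + avg fun y => ENNReal.ofReal (m.accept C l y) * A (P.piecewise y (m.bits n 0))
        + ENNReal.ofReal (1 - m.accept C l y) * B (P.piecewise y (m.bits n 0)) := by
      simp only [hgP]
      rw [avg_add, avg_const]
    calc _ = ε * (1 + (31 * n + 9) + c : ℕ)
          + avg fun y => ENNReal.ofReal (m.accept C l y) * A (P.piecewise y (m.bits n 0))
          + ENNReal.ofReal (1 - m.accept C l y) * B (P.piecewise y (m.bits n 0)) := by
          rw [← hP, e]
          push_cast
          ring
      _ ≤ _ := add_le_add (mul_le_mul_right (Nat.cast_le.2 hcost) _) le_rfl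

theorem avg_ofReal_accept (m : Mem) (l : ℕ) :
    avg (fun y : Bits n => ENNReal.ofReal (m.accept C l y)) = 2⁻¹ ^ (m.block n l).card := by
  rw [← ofReal_avg fun y => m.accept_nonneg l y, Mem.avg_accept, ENNReal.ofReal_pow (by norm_num),
    ENNReal.ofReal_inv_of_pos (by norm_num)]
  simp

theorem avg_ofReal_one_sub_accept (m : Mem) (l : ℕ) :
    2⁻¹ ^ (m.block n l).card + avg (fun y : Bits n => ENNReal.ofReal (1 - m.accept C l y)) = 1 := by
  rw [← avg_ofReal_accept (C := C) m l, ← avg_add, ← avg_const (n := n) (1 : ℝ≥0∞)]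
  congr 1
  funext y
  rw [← ENNReal.ofReal_add (m.accept_nonneg l y) (by linarith [m.accept_le_one (C := C) l y])]
  simp

/-- Rejection sampling draws a string for the block with a probability proportional to the squared
norm of its amplitude. -/
theorem ert_sampleBlock_le {l : ℕ} {X : Mem → ℝ≥0∞} {m : Mem} {A : Bits n → ℝ≥0∞}
    (hl : m.nat 19 0 = l) (hn : 1 ≤ n) (hd : 1 ≤ d)
    (hA : ∀ m', Agree sampleBlock m m' → X m' ≤ A (m'.bits n 0)) :
    ert C N ε sampleBlock X m ≤ ε * (1420 * (d * n ^ 3) * 4 ^ (m.block n l).card : ℕ)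
      + 2 ^ (m.block n l).card * avg fun y => ENNReal.ofReal (m.accept C l y)
        * A ((m.block n l).piecewise y (m.bits n 0)) := by
  classical
  set P := m.block n l with hP
  set w := avg fun y => ENNReal.ofReal (m.accept C l y) * A (P.piecewise y (m.bits n 0)) with hw
  -- `V` is the value before a round: a round and its test cost at most `c`, and it succeeds with
  -- probability `2 ^ (-s)`, so that `V = ε * c + 2 ^ (-s) * (ε * 5) + w + (1 - 2 ^ (-s)) * V`.
  set c : ℕ := 1400 * (d * n ^ 3) * 2 ^ P.card + 5 with hc
  set V : ℝ≥0∞ := ε * (c * 2 ^ P.card + 5 : ℕ) + 2 ^ P.card * w with hV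
  set Inv : Mem → Prop := fun m' => Agree sampleBlock m m' ∧
    ∀ v ∉ P, m'.bits n 0 v = m.bits n 0 v with hInv
  set Y : Mem → ℝ≥0∞ := fun m' => if Inv m' then
    (if m'.nat 20 0 = 0 then V else ε * 5 + A (m'.bits n 0)) else ⊤ with hY
  have key : ∀ m', ert C N ε (.while (.natLt (.var 20) (.const 1)) tryBlock) X m' ≤ Y m' := by
    refine ert_while_le (fun m' hm' hb => ?_) fun m' hm' hb => ?_
    · have hI : Inv m' := by
        by_contra h
        exact hm' (if_neg h)
      have h20 : m'.nat 20 0 = 0 := by simpa [BExp.Holds, NExp.eval] using hb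
      have hP' : m'.block n l = P := Mem.block_congr (hI.1.nat 2 rfl) l
      have hacc : (m'.accept C l : Bits n → ℝ) = m.accept C l :=
        Mem.accept_eq (hI.1.nat 1 rfl) (hI.1.nat 2 rfl) (hI.1.nat 3 rfl) (hI.1.nat 4 rfl) l
      have hpw : ∀ y, P.piecewise y (m'.bits n 0) = P.piecewise y (m.bits n 0) := by
        intro y
        funext v
        by_cases hv : v ∈ P
        · simp [hv]
        · simp [hv, hI.2 v hv]
      have htry := (ert_frame (C := C) (N := N) (ε := ε) (q := tryBlock) (X := Y) (m := m')
        (X' := fun m'' => if Agree tryBlock m' m'' then Y m'' else 0) fun m'' h =>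
          by rw [if_pos h]).trans (ert_tryBlock_le (l := l)
          (A := fun z => if ∀ v ∉ P, z v = m.bits n 0 v then ε * 5 + A z else ⊤)
          (B := fun z => if ∀ v ∉ P, z v = m.bits n 0 v then V else ⊤)
          (by rw [hI.1.nat 19 rfl, hl]) h20 hn hd (fun m'' h => ?_) fun m'' h => ?_)
      · have hoff : ∀ y, ∀ v ∉ P, P.piecewise y (m.bits n 0) v = m.bits n 0 v :=
          fun y v hv => by simp [hv]
        rw [hP', hacc] at htry
        simp only [hpw, if_pos (hoff _), avg_add, mul_add, avg_mul_right] at htry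
        have hYm : Y m' = V := by
          simp only [hY, if_pos hI, if_pos h20]
        rw [hYm]
        refine (add_le_add_right htry _).trans (le_of_eq ?_)
        have h1 := avg_ofReal_accept (C := C) m l
        have h2 := avg_ofReal_one_sub_accept (C := C) m l
        rw [← hP] at h1 h2
        rw [h1, ← hw]
        generalize avg (fun y : Bits n => ENNReal.ofReal (1 - m.accept C l y)) = η at h2 ⊢
        have h3 : (2⁻¹ : ℝ≥0∞) ^ P.card * 2 ^ P.card = 1 := by
          rw [← mul_pow, ENNReal.inv_mul_cancel two_ne_zero ENNReal.ofNat_ne_top, one_pow]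
        have h4 : (2⁻¹ : ℝ≥0∞) ^ P.card * V = ε * c + 2⁻¹ ^ P.card * (ε * 5) + w := by
          calc _ = (2⁻¹ : ℝ≥0∞) ^ P.card * 2 ^ P.card * (ε * c + w)
              + 2⁻¹ ^ P.card * (ε * 5) := by rw [hV]; push_cast; ring
            _ = _ := by rw [h3]; ring
        calc _ = (ε * c + 2⁻¹ ^ P.card * (ε * 5) + w) + η * V := by
              rw [hc]
              simp only [Prog.stepCost, BExp.cost, NExp.cost]
              push_cast
              ring
          _ = V := by rw [← h4, ← add_mul, h2, one_mul]
      all_goals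
        by_cases hag : Agree tryBlock m' m''
        · rw [if_pos hag]
          split_ifs with hoff
          · have hI' : Inv m'' := ⟨hI.1.trans (hag.mono (fun a ha => ?_) fun a ha => ?_), hoff⟩
            · simp [hY, if_pos hI', h]
            · exact (by simpa [sampleBlock, Prog.writesNat] using ha : _ ∧ _).2
            · simpa [sampleBlock, Prog.writesReal] using ha
          · exact le_top
        · rw [if_neg hag]
          exact zero_le
    · have hI : Inv m' := by
        by_contra h
        exact hm' (if_neg h)
      have h20 : m'.nat 20 0 ≠ 0 := by
        have : ¬ m'.nat 20 0 < 1 := by simpa [BExp.Holds, NExp.eval] using hb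
        omega
      simp only [hY, if_pos hI, if_neg h20]
      refine add_le_add (le_of_eq ?_) (hA m' hI.1)
      simp [Prog.stepCost, BExp.cost, NExp.cost]
  have h0 : Inv (m.setNat 20 0 0) := by
    refine ⟨⟨fun a ha => ?_, fun _ _ => rfl⟩, fun v _ => ?_⟩
    · have : a ≠ 20 := by rintro rfl; simp [sampleBlock, Prog.writesNat] at ha
      simp [this]
    · rw [Mem.bits_setNat_of_ne _ (by norm_num)]
  unfold sampleBlock
  refine ert_seq_le ?_
  have hcost : 1 + (3 + (c * 2 ^ P.card + 5)) ≤ 1420 * (d * n ^ 3) * 4 ^ P.card := by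
    have h1 : 1 * 1 ≤ d * n ^ 3 := Nat.mul_le_mul hd (Nat.one_le_pow _ _ hn)
    have h2 : 1 ≤ 2 ^ P.card := Nat.one_le_two_pow
    rw [show 4 ^ P.card = 2 ^ P.card * 2 ^ P.card by norm_num [← mul_pow]]
    have h3 : 1 * (1 * 2 ^ P.card) ≤ d * n ^ 3 * (2 ^ P.card * 2 ^ P.card) :=
      Nat.mul_le_mul (by omega) (Nat.mul_le_mul_right _ h2)
    have h4 : 1 * 1 ≤ d * n ^ 3 * (2 ^ P.card * 2 ^ P.card) :=
      Nat.mul_le_mul (by omega) (Nat.mul_le_mul h2 h2)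
    rw [hc]
    nlinarith
  calc _ = ε + (ε * 3 + ert C N ε (.while (.natLt (.var 20) (.const 1)) tryBlock) X
        (m.setNat 20 0 0)) := by
        simp [ert, Prog.stepCost, NExp.cost, NExp.eval]
    _ ≤ ε + (ε * 3 + V) := by
        gcongr
        refine (key _).trans (le_of_eq ?_)
        simp [hY, if_pos h0]
    _ = ε * (1 + (3 + (c * 2 ^ P.card + 5)) : ℕ) + 2 ^ P.card * w := by
        rw [hV]; push_cast; ring
    _ ≤ _ := add_le_add (mul_le_mul_right (Nat.cast_le.2 hcost) _) le_rfl

/-- Rejection sampling of all blocks: the outcome `b` is produced with the product of the squared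
norms of the amplitudes of the blocks, provided that the qubits without a block show `b`. -/
theorem ert_sampleBlocks_le {X : Mem → ℝ≥0∞} {m₀ : Mem} {κ : ℝ≥0∞} {b : Bits n} (hn : 1 ≤ n)
    (hd : 1 ≤ d) (hX : ∀ m, X m ≤ if m.bits n 0 = b then κ else 0) :
    ert C N ε (.for 19 .numQubits sampleBlock) X m₀
      ≤ ε * (12 * n + 9 + ∑ l ∈ Finset.range n, 1420 * (d * n ^ 3) * 4 ^ (m₀.block n l).card : ℕ)
        + (if ∀ v : Fin n, n ≤ m₀.nat 2 v → m₀.bits n 0 v = b v then 1 else 0)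
          * (κ * ∏ l ∈ Finset.range n, ENNReal.ofReal (m₀.accept C l b)) := by
  set T : ℕ → ℕ := fun l => ∑ l ∈ Finset.Ico l n, 1420 * (d * n ^ 3) * 4 ^ (m₀.block n l).card
    with hT
  set W : ℕ → ℝ≥0∞ := fun l => κ * ∏ l ∈ Finset.Ico l n, ENNReal.ofReal (m₀.accept C l b) with hW
  -- Before the block `l` is sampled, only the qubits in earlier blocks and those without a block hold
  -- their final values.
  set J : ℕ → Bits n → ℝ≥0∞ := fun l z => ε * T l
    + (if ∀ v : Fin n, m₀.nat 2 v < l ∨ n ≤ m₀.nat 2 v → z v = b v then 1 else 0) * W l with hJ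
  refine (ert_for_le (M := n) (c := 0) (I := fun _ _ => True) (J := fun l m => J l (m.bits n 0)) rfl
    (fun _ _ => rfl) trivial (fun _ _ _ _ => trivial) ?_ ?_ ?_).trans ?_
  · intro j m x
    rw [Mem.bits_setNat_of_ne _ (by norm_num)]
  · intro l hl m hA hlm _ X hX
    have hP : m.block n l = m₀.block n l := Mem.block_congr (hA.nat 2 rfl) l
    have hacc : (m.accept C l : Bits n → ℝ) = m₀.accept C l :=
      Mem.accept_eq (hA.nat 1 rfl) (hA.nat 2 rfl) (hA.nat 3 rfl) (hA.nat 4 rfl) l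
    refine (ert_sampleBlock_le hlm hn hd fun m' h => hX m' h trivial).trans ?_
    rw [hP, hacc]
    set P := m₀.block n l with hP₀
    set z := m.bits n 0 with hz
    have hterm : ∀ y, ENNReal.ofReal (m₀.accept C l y) * J (l + 1) (P.piecewise y z)
        = ENNReal.ofReal (m₀.accept C l y) * (ε * T (l + 1))
          + (if ∀ v ∈ P, y v = b v then 1 else 0) * ((if ∀ v : Fin n, m₀.nat 2 v < l
            ∨ n ≤ m₀.nat 2 v → z v = b v then 1 else 0)
            * (ENNReal.ofReal (m₀.accept C l b) * W (l + 1))) := by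
      intro y
      simp only [hJ, mul_add]
      congr 1
      by_cases hy : ∀ v ∈ P, y v = b v
      · have hiff : (∀ v : Fin n, m₀.nat 2 v < l + 1 ∨ n ≤ m₀.nat 2 v → P.piecewise y z v = b v)
            ↔ ∀ v : Fin n, m₀.nat 2 v < l ∨ n ≤ m₀.nat 2 v → z v = b v := by
          refine forall_congr' fun v => ?_
          by_cases hv : v ∈ P
          · have hv' := Mem.mem_block.1 hv
            simp only [Finset.piecewise_eq_of_mem _ _ _ hv, hy v hv]
            constructor
            · intro _ h; omega
            · exact fun _ _ => trivial
          · have hv' : m₀.nat 2 v ≠ l := fun h => hv (Mem.mem_block.2 h)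
            rw [Finset.piecewise_eq_of_notMem _ _ _ hv, Nat.lt_succ_iff_lt_or_eq]
            simp only [hv', or_false]
        rw [if_pos hy, m₀.accept_congr hy]
        simp only [hiff]
        ring
      · have hno : ¬ ∀ v : Fin n, m₀.nat 2 v < l + 1 ∨ n ≤ m₀.nat 2 v →
            P.piecewise y z v = b v := by
          intro h
          refine hy fun v hv => ?_
          have := h v (Or.inl (by rw [Mem.mem_block.1 hv]; omega))
          rwa [Finset.piecewise_eq_of_mem _ _ _ hv] at this
        rw [if_neg hno, if_neg hy]
        ring
    -- The string `b` is proposed with probability `2 ^ (-s)`, which cancels the expected number of rounds.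
    have h3 : (2 : ℝ≥0∞) ^ P.card * 2⁻¹ ^ P.card = 1 := by
      rw [← mul_pow, ENNReal.mul_inv_cancel two_ne_zero ENNReal.ofNat_ne_top, one_pow]
    have hind : avg (fun y : Bits n => if ∀ v ∈ P, y v = b v then (1 : ℝ≥0∞) else 0)
        = 2⁻¹ ^ P.card := by
      rw [avg_indicator_eq, ENNReal.smul_def]
      simp [ENNReal.coe_inv, ENNReal.inv_pow]
    have hTl : T l = 1420 * (d * n ^ 3) * 4 ^ P.card + T (l + 1) :=
      Finset.sum_eq_sum_Ico_succ_bot hl _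
    have hWl : W l = ENNReal.ofReal (m₀.accept C l b) * W (l + 1) := by
      simp only [hW]
      rw [Finset.prod_eq_prod_Ico_succ_bot hl]
      ring
    simp only [hterm]
    rw [avg_add, avg_mul_right, avg_mul_right, hind, avg_ofReal_accept, ← hP₀]
    simp only [hJ]
    rw [hTl, hWl]
    refine le_of_eq ?_
    generalize ENNReal.ofReal (m₀.accept C l b) * W (l + 1) = w
    calc _ = ε * (1420 * (d * n ^ 3) * 4 ^ P.card : ℕ) + (2 ^ P.card * 2⁻¹ ^ P.card)
          * (ε * T (l + 1) + (if ∀ v : Fin n, m₀.nat 2 v < l ∨ n ≤ m₀.nat 2 v → z v = b v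
            then 1 else 0) * w) := by ring
      _ = _ := by rw [h3]; push_cast; ring
  · intro m hA _
    refine (hX m).trans ?_
    split_ifs with h
    · simp [hJ, hW, h]
    · exact zero_le
  · simp only [hJ, hT, hW, Finset.range_eq_Ico, Nat.not_lt_zero, false_or, NExp.cost]
    rw [← add_assoc, ← mul_add, ← Nat.cast_add]

/-- The part of the program after the noise has been drawn and the blocks have been found. The first
random string `u` replaces the dephased qubits in the circuit, the second one gives their outcomes. -/
theorem ert_sampleOutcome_le {X : Mem → ℝ≥0∞} {m : Mem} {κ : ℝ≥0∞} {b : Bits n} (hn : 1 ≤ n)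
    (hd : 1 ≤ d) (hX : ∀ m, X m ≤ if m.bits n 0 = b then κ else 0) :
    ert C N ε (.seq (flipAll 1) (.seq (flipAll 0) (.for 19 .numQubits sampleBlock))) X m
      ≤ ε * (42 * n + 29 + ∑ l ∈ Finset.range n, 1420 * (d * n ^ 3) * 4 ^ (m.block n l).card : ℕ)
        + avg fun u : Bits n => avg fun z : Bits n =>
          (if ∀ v : Fin n, n ≤ m.nat 2 v → z v = b v then 1 else 0)
          * (κ * ∏ l ∈ Finset.range n, ENNReal.ofReal
            (‖amp (m.block n l) (m.phase C) (b + m.bits n 4) u‖ ^ 2)) := by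
  set S : ℕ := ∑ l ∈ Finset.range n, 1420 * (d * n ^ 3) * 4 ^ (m.block n l).card with hS
  set f : Bits n → Bits n → ℝ≥0∞ := fun u z =>
    (if ∀ v : Fin n, n ≤ m.nat 2 v → z v = b v then 1 else 0)
          * (κ * ∏ l ∈ Finset.range n, ENNReal.ofReal
            (‖amp (m.block n l) (m.phase C) (b + m.bits n 4) u‖ ^ 2)) with hf
  refine ert_seq_le ((add_le_add_right (ert_flipAll_le (by norm_num)
    (g := fun u => ε * (27 * n + 19 + S : ℕ) + avg (f u)) fun m₁ hA₁ => ?_) _).trans ?_)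
  · refine ert_seq_le ((add_le_add_right (ert_flipAll_le (by norm_num)
      (g := fun z => ε * (12 * n + 9 + S : ℕ) + f (m₁.bits n 1) z) fun m₂ hA₂ => ?_) _).trans ?_)
    · refine (ert_sampleBlocks_le hn hd hX).trans (le_of_eq ?_)
      have hP : ∀ l, m₂.block n l = m.block n l := fun l =>
        (Mem.block_congr (hA₂.nat 2 rfl) l).trans (Mem.block_congr (hA₁.nat 2 rfl) l)
      simp only [hf, Mem.accept, hP, hA₂.nat 2 rfl, hA₁.nat 2 rfl]
      rw [Mem.bits_congr (hA₂.nat 1 rfl), Mem.bits_congr (hA₂.nat 4 rfl),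
        Mem.bits_congr (hA₁.nat 4 rfl), Mem.phase_congr (hA₂.nat 3 rfl),
        Mem.phase_congr (hA₁.nat 3 rfl)]
    · rw [avg_add, avg_const]
      refine le_of_eq ?_
      push_cast
      ring
  · rw [avg_add, avg_const]
    refine le_of_eq ?_
    push_cast
    ring

end Rejection

/-! ### Sampling the noise -/

section NoiseLoop

variable {n d k : ℕ} {C : Circuit n d k} {N : PauliNoise} {ε : ℝ≥0∞}

/-- The effect of the outcome `o` of the noise, on the qubit in variable `9`, on the memory. -/
structure NoiseStep (N : PauliNoise) (n : ℕ) (o : Outcome) (m m' : Mem) : Prop where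
  counter : m'.nat 7 = m.nat 7
  flips : m'.nat 3 = Function.update (m.nat 3) (m.nat 7 0 + n)
    (m.nat 3 (m.nat 7 0) + if o.1 then 1 else 0)
  label : ∀ v, m'.nat 2 v = if v = m.nat 9 0 ∧ o.2 then n else m.nat 2 v
  phases : ∀ v, m'.nat 4 v
    = m.nat 4 v + if v = m.nat 9 0 ∧ o.1 ∧ o.2 = false ∧ N.pX < N.pY then 1 else 0

theorem cost_add_le {a b c : ℕ} (h : a + b ≤ c) (e : ℝ≥0∞) : ε * a + (ε * b + e) ≤ ε * c + e := by
  rw [← add_assoc, ← mul_add, ← Nat.cast_add]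
  exact add_le_add (mul_le_mul_right (Nat.cast_le.2 h) _) le_rfl

/-- A draw within one branch of an earlier draw: the joint probabilities are `u` and `v`. -/
theorem ofReal_mul_mix {x y u v : ℝ} (hx : 0 ≤ x) (hu : x * y = u) (hv : x * (1 - y) = v)
    (a b : ℝ≥0∞) :
    ENNReal.ofReal x * (ENNReal.ofReal y * a + ENNReal.ofReal (1 - y) * b)
      = ENNReal.ofReal u * a + ENNReal.ofReal v * b := by
  rw [← hu, ← hv, ENNReal.ofReal_mul hx, ENNReal.ofReal_mul hx]
  ring

theorem cost_succ_le {a c : ℕ} (h : 1 + a ≤ c) (e : ℝ≥0∞) : ε + (ε * a + e) ≤ ε * c + e := by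
  simpa using cost_add_le (ε := ε) (a := 1) h e

theorem holds_failed {m : Mem} : (BExp.failed).Holds C N m ↔ m.real 0 0 < 1 := by
  simp [BExp.Holds, RExp.eval, NExp.eval]

theorem ert_sampleNoise_of_not_flip_le {X : Mem → ℝ≥0∞} {m m₁ : Mem} {F : Outcome → ℝ≥0∞}
    (hA₁ : ∀ a, a ≠ 11 → m₁.nat a = m.nat a)
    (hX : ∀ o m', NoiseStep N n o m m' → X m' ≤ ε * (6 : ℕ) + F o) {y : ℝ} (hy0 : 0 ≤ y)
    (hy1 : y ≤ 1) (hy : (N.pZ + N.pZ) / (1 - N.pX - N.pY) = y) :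
    ert C N ε
      (.seq (.setNat 3 (.plus (.var 7) .numQubits) (.get 3 (.var 7))) <|
       .seq (.assignReal 0 (.quot (.plus .noiseZ .noiseZ)
          (.minus (.minus (.const 1) .noiseX) .noiseY))) <|
       .seq bernoulli <|
        .ite .failed .skip (.setNat 2 (.var 9) .numQubits)) X m₁
      ≤ ε * (50 * n ^ 2 + 120 : ℕ)
        + (ENNReal.ofReal y * F (false, true) + ENNReal.ofReal (1 - y) * F (false, false)) := by
  refine (ert_seq_le_of_det (Q := fun m₂ => m₂ = m₁.setNat 3 (m.nat 7 0 + n) (m.nat 3 (m.nat 7 0)))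
    (Det.setNat ?_) fun m₂ _ hm₂ => ert_draw_le (x := y) (a := F (false, true))
    (b := F (false, false)) (c := 3 * n ^ 2 + 20)
    ?_ hy0 hy1 (fun m₃ hA₃ hlt₃ => ?_) fun m₃ hA₃ hlt₃ => ?_).trans ?_
  · simp [NExp.eval, hA₁]
  · simp [RExp.eval, hy]
  · have := hX (false, false) m₃ ⟨by simp [hA₃.nat 7 rfl, hm₂, hA₁],
      by simp [hA₃.nat 3 rfl, hm₂, hA₁], by simp [hA₃.nat 2 rfl, hm₂, hA₁],
      by simp [hA₃.nat 4 rfl, hm₂, hA₁]⟩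
    simp only [ert, if_pos (holds_failed.2 hlt₃), Prog.stepCost]
    refine (add_le_add_right ((add_le_add_right this _).trans (cost_add_le le_rfl _)) _).trans
      (cost_add_le ?_ _)
    simp only [BExp.cost, RExp.cost, NExp.cost]
    omega
  · have := hX (false, true) (m₃.setNat 2 (m₃.nat 9 0) n) ⟨by simp [hA₃.nat 7 rfl, hm₂, hA₁],
      by simp [hA₃.nat 3 rfl, hm₂, hA₁],
      by simp [hA₃.nat 2 rfl, hA₃.nat 9 rfl, hm₂, hA₁, Function.update_apply],
      by simp [hA₃.nat 4 rfl, hm₂, hA₁]⟩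
    simp only [ert, if_neg (mt holds_failed.1 hlt₃), Prog.stepCost, NExp.eval]
    refine (add_le_add_right ((add_le_add_right this _).trans (cost_add_le le_rfl _)) _).trans
      (cost_add_le ?_ _)
    simp only [BExp.cost, RExp.cost, NExp.cost]
    omega
  · refine cost_add_le ?_ _
    simp only [RExp.cost, NExp.cost]
    omega

theorem ert_sampleNoise_of_flip_le {X : Mem → ℝ≥0∞} {m m₁ : Mem} {F : Outcome → ℝ≥0∞}
    (hA₁ : ∀ a, a ≠ 11 → m₁.nat a = m.nat a)
    (hX : ∀ o m', NoiseStep N n o m m' → X m' ≤ ε * (6 : ℕ) + F o) {y : ℝ} (hy0 : 0 ≤ y)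
    (hy1 : y ≤ 1) (hy : (min N.pX N.pY + min N.pX N.pY) / (N.pX + N.pY) = y) :
    ert C N ε
      (.seq (.setNat 3 (.plus (.var 7) .numQubits) (.plus (.get 3 (.var 7)) (.const 1))) <|
       .seq (.ite (.realLt .noiseX .noiseY) (.assignReal 1 .noiseX) (.assignReal 1 .noiseY)) <|
       .seq (.assignReal 0 (.quot (.plus (.var 1) (.var 1)) (.plus .noiseX .noiseY))) <|
       .seq bernoulli <|
        .ite .failed
          (.ite (.realLt .noiseX .noiseY)
            (.setNat 4 (.var 9) (.plus (.get 4 (.var 9)) (.const 1))) .skip)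
          (.setNat 2 (.var 9) .numQubits)) X m₁
      ≤ ε * (50 * n ^ 2 + 120 : ℕ)
        + (ENNReal.ofReal y * F (true, true) + ENNReal.ofReal (1 - y) * F (true, false)) := by
  refine (ert_seq_le_of_det (Q := fun m₂ => m₂ = m₁.setNat 3 (m.nat 7 0 + n)
    (m.nat 3 (m.nat 7 0) + 1)) (Det.setNat ?_) fun m₂ _ hm₂ => ert_seq_le_of_det
    (Q := fun m₃ => m₃.nat = m₂.nat ∧ m₃.real 1 0 = min N.pX N.pY)
    (Det.ite (c := 2 * n ^ 2 + 1) (fun hl => ?_) fun hl => ?_) fun m₃ _ hm₃ => ert_draw_le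
    (x := y) (a := F (true, true)) (b := F (true, false)) (c := 6 * n ^ 2 + 22)
    ?_ hy0 hy1 (fun m₄ hA₄ hlt₄ => ?_) fun m₄ hA₄ hlt₄ => ?_).trans ?_
  · simp [NExp.eval, hA₁]
  · refine Det.setReal_le ?_ ⟨rfl, ?_⟩
    · simp only [NExp.cost, RExp.cost]; omega
    · simp [NExp.eval, RExp.eval, min_eq_left (show N.pX < N.pY from hl).le]
  · refine Det.setReal_le ?_ ⟨rfl, ?_⟩
    · simp only [NExp.cost, RExp.cost]; omega
    · simp [NExp.eval, RExp.eval, min_eq_right (not_lt.1 (show ¬ N.pX < N.pY from hl))]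
  · simp [RExp.eval, NExp.eval, hm₃.2, hy]
  · have hn₄ : ∀ a, a ≠ 11 → m₄.nat a = m₂.nat a := fun a ha => by
      rw [hA₄.nat a (by simp [bernoulli, Prog.writesNat, ha.symm]), hm₃.1]
    by_cases hl : N.pX < N.pY
    · have := hX (true, false) (m₄.setNat 4 (m₄.nat 9 0) (m₄.nat 4 (m₄.nat 9 0) + 1))
        ⟨by simp [hn₄, hm₂, hA₁], by simp [hn₄, hm₂, hA₁], by simp [hn₄, hm₂, hA₁], fun v => by
          by_cases hv : v = m.nat 9 0 <;> simp [hn₄, hm₂, hA₁, hl, hv]⟩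
      have hl' : (BExp.realLt .noiseX .noiseY).Holds C N m₄ := hl
      simp only [ert, if_pos (holds_failed.2 hlt₄), if_pos hl', Prog.stepCost, NExp.eval]
      refine (add_le_add_right ((add_le_add_right ((add_le_add_right this _).trans
        (cost_add_le le_rfl _)) _).trans (cost_add_le le_rfl _)) _).trans (cost_add_le ?_ _)
      simp only [BExp.cost, RExp.cost, NExp.cost]
      omega
    · have := hX (true, false) m₄
        ⟨by simp [hn₄, hm₂, hA₁], by simp [hn₄, hm₂, hA₁], by simp [hn₄, hm₂, hA₁], fun v => by
          simp [hn₄, hm₂, hA₁, hl]⟩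
      have hl' : ¬ (BExp.realLt .noiseX .noiseY).Holds C N m₄ := hl
      simp only [ert, if_pos (holds_failed.2 hlt₄), if_neg hl', Prog.stepCost]
      refine (add_le_add_right ((add_le_add_right ((add_le_add_right this _).trans
        (cost_add_le le_rfl _)) _).trans (cost_add_le le_rfl _)) _).trans (cost_add_le ?_ _)
      simp only [BExp.cost, RExp.cost, NExp.cost]
      omega
  · have hn₄ : ∀ a, a ≠ 11 → m₄.nat a = m₂.nat a := fun a ha => by
      rw [hA₄.nat a (by simp [bernoulli, Prog.writesNat, ha.symm]), hm₃.1]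
    have := hX (true, true) (m₄.setNat 2 (m₄.nat 9 0) n)
      ⟨by simp [hn₄, hm₂, hA₁], by simp [hn₄, hm₂, hA₁],
      by simp [hn₄, hm₂, hA₁, Function.update_apply], by simp [hn₄, hm₂, hA₁]⟩
    simp only [ert, if_neg (mt holds_failed.1 hlt₄), Prog.stepCost, NExp.eval]
    refine (add_le_add_right ((add_le_add_right this _).trans (cost_add_le le_rfl _)) _).trans
      (cost_add_le ?_ _)
    simp only [BExp.cost, RExp.cost, NExp.cost]
    omega
  · refine (add_le_add_right (cost_add_le le_rfl _) _).trans (cost_add_le ?_ _)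
    simp only [BExp.cost, RExp.cost, NExp.cost]
    omega

/-- The noise on one qubit after one layer has the distribution `N.weight`. -/
theorem ert_sampleNoise_le {X : Mem → ℝ≥0∞} {m : Mem} {F : Outcome → ℝ≥0∞}
    (hX : ∀ o m', NoiseStep N n o m m' → X (m'.setNat 7 0 (m.nat 7 0 + 1)) ≤ F o) :
    ert C N ε sampleNoise X m ≤ ε * (100 * n ^ 2 + 200 : ℕ) + ∑ o, N.weight o • F o := by
  have hpX := N.pX_nonneg
  have hpY := N.pY_nonneg
  have hpZ := N.pZ_nonneg
  have hpI := N.half_le_pI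
  have hX' : ∀ o m', NoiseStep N n o m m' →
      ert C N ε (.assign 7 (.plus (.var 7) (.const 1))) X m' ≤ ε * (6 : ℕ) + F o := by
    intro o m' h
    simp only [ert, Prog.stepCost, NExp.cost, NExp.eval, h.counter]
    exact add_le_add le_rfl (hX o _ h)
  set x := N.pX + N.pY with hx
  set y₀ := (N.pZ + N.pZ) / (1 - N.pX - N.pY) with hy₀
  set y₁ := (min N.pX N.pY + min N.pX N.pY) / (N.pX + N.pY) with hy₁
  have hden : 0 < 1 - N.pX - N.pY := by linarith
  have h1x : 0 ≤ 1 - x := by rw [hx]; linarith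
  have hy₀0 : 0 ≤ y₀ := by positivity
  have hy₀1 : y₀ ≤ 1 := by rw [hy₀, div_le_one hden]; linarith
  have hy₁0 : 0 ≤ y₁ := by positivity
  have hmin : min N.pX N.pY + min N.pX N.pY ≤ N.pX + N.pY :=
    add_le_add (min_le_left _ _) (min_le_right _ _)
  have hy₁1 : y₁ ≤ 1 := div_le_one_of_le₀ hmin (by positivity)
  have e1 : x * y₁ = N.weight (true, true) := by
    rw [N.coe_weight_tt, hy₁, hx]
    rcases (add_nonneg hpX hpY).eq_or_lt with h | h
    · rw [← h]
      have : 0 ≤ min N.pX N.pY := le_min hpX hpY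
      linarith
    · field_simp
      ring
  have e2 : x * (1 - y₁) = N.weight (true, false) := by
    rw [mul_sub, e1, N.coe_weight_tt, N.coe_weight_tf, hx]
    linarith [abs_sub_add_two_mul_min N.pX N.pY]
  have e3 : (1 - x) * y₀ = N.weight (false, true) := by
    rw [N.coe_weight_ft, hy₀, hx, show 1 - (N.pX + N.pY) = 1 - N.pX - N.pY by ring]
    field_simp
    ring
  have e4 : (1 - x) * (1 - y₀) = N.weight (false, false) := by
    rw [mul_sub, e3, N.coe_weight_ff, N.coe_weight_ft, hx]
    ring
  unfold sampleNoise
  refine (ert_draw_le (x := x) (c := 53 * n ^ 2 + 140)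
    (a := ENNReal.ofReal y₁ * F (true, true) + ENNReal.ofReal (1 - y₁) * F (true, false))
    (b := ENNReal.ofReal y₀ * F (false, true) + ENNReal.ofReal (1 - y₀) * F (false, false))
    rfl (by positivity) (by linarith) (fun m₁ hA₁ hlt => ?_) fun m₁ hA₁ hlt => ?_).trans ?_
  · refine ert_seq_le ?_
    rw [ert, if_pos (holds_failed.2 hlt)]
    refine (add_le_add_right ((add_le_add_right (ert_sampleNoise_of_not_flip_le (fun a ha => ?_)
      hX' hy₀0 hy₀1 hy₀.symm) _).trans (cost_add_le le_rfl _)) _).trans ?_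
    · exact hA₁.nat a (by simp [bernoulli, Prog.writesNat, ha.symm])
    · refine cost_succ_le ?_ _
      simp only [Prog.stepCost, BExp.cost, RExp.cost, NExp.cost]
      omega
  · refine ert_seq_le ?_
    rw [ert, if_neg (mt holds_failed.1 hlt)]
    refine (add_le_add_right ((add_le_add_right (ert_sampleNoise_of_flip_le (fun a ha => ?_)
      hX' hy₁0 hy₁1 hy₁.symm) _).trans (cost_add_le le_rfl _)) _).trans ?_
    · exact hA₁.nat a (by simp [bernoulli, Prog.writesNat, ha.symm])
    · refine cost_succ_le ?_ _
      simp only [Prog.stepCost, BExp.cost, RExp.cost, NExp.cost]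
      omega
  · have hw : ∀ o a, N.weight o • a = ENNReal.ofReal (N.weight o) * a := fun o a => by
      rw [ENNReal.ofReal_coe_nnreal]; rfl
    simp only [sum_outcome, hw]
    rw [ofReal_mul_mix (by positivity) e1 e2, ofReal_mul_mix h1x e3 e4]
    refine add_le_add (mul_le_mul_right (Nat.cast_le.2 ?_) _) (le_of_eq (by ring))
    simp only [RExp.cost]
    omega

/-- The memory holds the noise pattern `ω`, which is complete up to qubit `j` after layer `t`. -/
structure NoiseState (N : PauliNoise) (n d t j : ℕ) (ω : Pattern) (m : Mem) : Prop where
  counter : m.nat 7 0 = t * n + j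
  flips : ∀ s v, v < n → s * n + v < t * n + j + n → m.nat 3 (s * n + v) = ω.flips s v
  label : ∀ v < n, (ω.Dephased d v → m.nat 2 v = n) ∧ (¬ ω.Dephased d v → m.nat 2 v = v)
  phases : ∀ v < n, m.nat 4 v = ω.phases N d v
  clean : ∀ s v, t < s ∨ t = s ∧ j ≤ v → ω s v = (false, false)

theorem NoiseState.congr {t j : ℕ} {ω : Pattern} {m m' : Mem} (h : NoiseState N n d t j ω m)
    (h2 : m'.nat 2 = m.nat 2) (h3 : m'.nat 3 = m.nat 3) (h4 : m'.nat 4 = m.nat 4)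
    (h7 : m'.nat 7 = m.nat 7) : NoiseState N n d t j ω m' :=
  ⟨by rw [h7, h.counter], by rw [h3]; exact h.flips, by rw [h2]; exact h.label,
    by rw [h4]; exact h.phases, h.clean⟩

theorem NoiseState.next_row {t : ℕ} {ω : Pattern} {m : Mem} (h : NoiseState N n d t n ω m) :
    NoiseState N n d (t + 1) 0 ω m :=
  ⟨by rw [h.counter]; ring, fun s v hv hs => h.flips s v hv (by linarith), h.label, h.phases,
    fun s v hs => h.clean s v (by omega)⟩

/-- Drawing the next outcome extends the pattern in the memory. -/
theorem NoiseState.step {t j : ℕ} {ω : Pattern} {m m' : Mem} {o : Outcome}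
    (h : NoiseState N n d t j ω m) (hj : j < n) (ht : t < d) (h9 : m.nat 9 0 = j)
    (hs : NoiseStep N n o m m') :
    NoiseState N n d t (j + 1) (ω.set (t, j) o) (m'.setNat 7 0 (m.nat 7 0 + 1)) := by
  classical
  have hω : ω t j = (false, false) := h.clean t j (Or.inr ⟨rfl, le_rfl⟩)
  have hflips : ∀ s v, (ω.set (t, j) o).flips s v
      = ω.flips s v + if v = j ∧ t < s ∧ o.1 = true then 1 else 0 := fun s v =>
    sum_range_set hω o s v (fun o => o.1 = true) (by simp)
  have hdeph : ∀ v, (ω.set (t, j) o).Dephased d v ↔ ω.Dephased d v ∨ v = j ∧ o.2 = true := by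
    intro v
    constructor
    · rintro ⟨s, hs, hs'⟩
      by_cases hst : s = t ∧ v = j
      · right
        simpa [Pattern.set, hst] using hs'
      · left
        refine ⟨s, hs, ?_⟩
        rwa [Pattern.set_of_ne (by simpa using hst)] at hs'
    · rintro (⟨s, hs, hs'⟩ | ⟨rfl, h2⟩)
      · refine ⟨s, hs, ?_⟩
        rw [Pattern.set_of_ne]
        · exact hs'
        · rintro ⟨⟩
          simp [hω] at hs'
      · exact ⟨t, ht, by simpa [Pattern.set] using h2⟩
  refine ⟨?_, ?_, ?_, ?_, ?_⟩
  · simp [h.counter, add_assoc]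
  · intro s v hv hsv
    have hval : (m'.setNat 7 0 (m.nat 7 0 + 1)).nat 3 = m'.nat 3 := by simp
    rw [hval, hs.flips, h.counter, hflips]
    by_cases heq : s * n + v = t * n + j + n
    · have hst : s = t + 1 := by
        have h1 : (s * n + v) / n = s := by
          rw [mul_comm, Nat.mul_add_div (by omega), Nat.div_eq_of_lt hv, add_zero]
        have h2 : (t * n + j + n) / n = t + 1 := by
          rw [show t * n + j + n = n * (t + 1) + j by ring, Nat.mul_add_div (by omega),
            Nat.div_eq_of_lt hj, add_zero]
        rw [← h1, heq, h2]
      have hvj : v = j := by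
        rw [hst, add_mul, one_mul] at heq
        omega
      rw [heq, Function.update_self, h.flips t j hj (by omega), hst, hvj]
      have : ω.flips (t + 1) j = ω.flips t j := by
        rw [Pattern.flips, Finset.sum_range_succ, hω]
        simp [Pattern.flips]
      simp [this]
    · rw [Function.update_of_ne heq, h.flips s v hv (by omega), if_neg, add_zero]
      rintro ⟨rfl, hts, -⟩
      have : (t + 1) * n ≤ s * n := Nat.mul_le_mul_right _ hts
      rw [add_mul, one_mul] at this
      omega
  · intro v hv
    have hval : (m'.setNat 7 0 (m.nat 7 0 + 1)).nat 2 = m'.nat 2 := by simp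
    rw [hval, hs.label, h9, hdeph]
    obtain ⟨h1, h2⟩ := h.label v hv
    by_cases hvj : v = j ∧ o.2 = true
    · simp [hvj]
    · simpa [hvj] using ⟨h1, h2⟩
  · intro v hv
    have hval : (m'.setNat 7 0 (m.nat 7 0 + 1)).nat 4 = m'.nat 4 := by simp
    rw [hval, hs.phases, h9, h.phases v hv, Pattern.phases, Pattern.phases, sum_range_set hω o d v
      (fun o => o.1 = true ∧ o.2 = false ∧ N.pX < N.pY) (by simp)]
    simp only [ht, true_and]
  · intro s v hsv
    rw [Pattern.set_of_ne]
    · exact h.clean s v (by omega)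
    · rintro ⟨⟩
      omega

theorem ert_noiseRow_le {t : ℕ} {X : Mem → ℝ≥0∞} {m₀ : Mem} {F : Pattern → ℝ≥0∞} {ω : Pattern}
    (ht : t < d) (h : NoiseState N n d t 0 ω m₀)
    (hX : ∀ ω m, NoiseState N n d t n ω m → X m ≤ F ω) :
    ert C N ε (.for 9 .numQubits sampleNoise) X m₀
      ≤ ε * ((100 * n ^ 2 + 212) * n + 9 : ℕ) + noiseAvg N (rowFrom n t 0) F ω := by
  refine (ert_for_le (M := n) (c := 100 * n ^ 2 + 200) (I := fun _ _ => True)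
    -- The infimum runs over the patterns that the memory may hold, and it is `⊤` if there is none.
    (J := fun j m => ⨅ ω, ⨅ (_ : NoiseState N n d t j ω m), noiseAvg N (rowFrom n t j) F ω) rfl
    (fun _ _ => rfl) trivial (fun _ _ _ _ => trivial) ?_ ?_ ?_).trans
      (add_le_add le_rfl (iInf₂_le_of_le ω h le_rfl))
  · intro j m x
    have : ∀ ω, NoiseState N n d t j ω (m.setNat 9 0 x) ↔ NoiseState N n d t j ω m := fun ω =>
      ⟨fun h => h.congr (by simp) (by simp) (by simp) (by simp),
        fun h => h.congr (by simp) (by simp) (by simp) (by simp)⟩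
    simp only [this]
  · intro j hj m hA hjm _ X hX
    simp only [ENNReal.add_iInf]
    refine le_iInf₂ fun ω hω => ?_
    rw [rowFrom_of_lt t hj]
    refine (ert_frame (X' := fun m' => ⨅ ω, ⨅ (_ : NoiseState N n d t (j + 1) ω m'),
      noiseAvg N (rowFrom n t (j + 1)) F ω) fun m' h => hX m' h trivial).trans
      (ert_sampleNoise_le fun o m' hm' => iInf₂_le_of_le (ω.set (t, j) o)
        (hω.step hj ht hjm hm') le_rfl)
  · exact fun m _ _ => le_iInf₂ fun ω hω => by simpa [rowFrom_self, noiseAvg] using hX ω m hω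

/-- The program draws the noise pattern from its distribution. -/
theorem ert_noisePhase_le {X : Mem → ℝ≥0∞} {F : Pattern → ℝ≥0∞} (hn : 1 ≤ n) (hd : 1 ≤ d)
    (hX : ∀ ω m, NoiseState N n d d 0 ω m → X m ≤ F ω) :
    ert C N ε noisePhase X Mem.zero
      ≤ ε * (400 * (d * n ^ 3) : ℕ) + noiseAvg N (positionsFrom n d 0) F Pattern.none := by
  unfold noisePhase
  refine (ert_seq_le_of_det (Q := fun m => NoiseState N n d 0 0 Pattern.none m) ((Det.for (c := 5)
    (M := n) (I := fun j m => (∀ v < j, m.nat 2 v = v) ∧ m.nat 3 = (fun _ => 0)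
      ∧ m.nat 4 = (fun _ => 0) ∧ m.nat 7 = fun _ => 0) rfl (fun _ _ => rfl) ?_ ?_ ?_).mono le_rfl ?_)
    (e := ε * ((100 * n ^ 3 + 212 * n + 21) * d + 9 : ℕ)
      + noiseAvg N (positionsFrom n d 0) F Pattern.none) fun m₀ _ h₀ => ?_).trans ?_
  · exact ⟨by simp, rfl, rfl, rfl⟩
  · intro j m x h
    simpa using h
  · intro j hj m _ hjm hI
    refine Det.setNat_le (by simp [NExp.cost]) ⟨fun v hv => ?_, ?_⟩
    · rcases Nat.lt_succ_iff_lt_or_eq.1 hv with h | h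
      · simp [NExp.eval, hjm, h.ne, hI.1 v h]
      · simp [NExp.eval, hjm, h]
    · simpa using hI.2
  · rintro m - ⟨h2, h3, h4, h7⟩
    have hnd : ∀ v, ¬ Pattern.none.Dephased d v := fun v => by
      simp [Pattern.Dephased, Pattern.none]
    refine ⟨by simp [h7], fun s v _ _ => ?_, fun v hv => ⟨fun h => absurd h (hnd v), fun _ => h2 v hv⟩,
      fun v _ => ?_, fun _ _ _ => rfl⟩
    · simp [h3, Pattern.flips, Pattern.none]
    · simp [h4, Pattern.phases, Pattern.none]
  · refine (ert_for_le (M := d) (c := 100 * n ^ 3 + 212 * n + 9) (I := fun _ _ => True)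
      (J := fun t m => ⨅ ω, ⨅ (_ : NoiseState N n d t 0 ω m), noiseAvg N (positionsFrom n d t) F ω)
      rfl (fun _ _ => rfl) trivial (fun _ _ _ _ => trivial) ?_ ?_ ?_).trans
        (add_le_add (le_of_eq ?_) (iInf₂_le_of_le _ h₀ le_rfl))
    · intro j m x
      have : ∀ ω, NoiseState N n d j 0 ω (m.setNat 8 0 x) ↔ NoiseState N n d j 0 ω m := fun ω =>
        ⟨fun h => h.congr (by simp) (by simp) (by simp) (by simp),
          fun h => h.congr (by simp) (by simp) (by simp) (by simp)⟩
      simp only [this]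
    · intro t ht m hA htm _ X hX
      simp only [ENNReal.add_iInf]
      refine le_iInf₂ fun ω hω => ?_
      rw [positionsFrom_of_lt ht, noiseAvg_append]
      refine (ert_frame (X' := fun m' => ⨅ ω, ⨅ (_ : NoiseState N n d (t + 1) 0 ω m'),
        noiseAvg N (positionsFrom n d (t + 1)) F ω) fun m' h => hX m' h trivial).trans
        ((ert_noiseRow_le ht hω fun ω' m' hm' => iInf₂_le_of_le ω' hm'.next_row le_rfl).trans
          (le_of_eq ?_))
      congr 3
      ring
    · exact fun m _ _ => le_iInf₂ fun ω hω => by simpa [positionsFrom_self, noiseAvg] using hX ω m hω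
    · simp only [NExp.cost]
  · refine cost_add_le ?_ _
    have h1 : 1 * 1 ≤ d * n ^ 3 := Nat.mul_le_mul hd (Nat.one_le_pow _ _ hn)
    have h2 : d * 1 ≤ d * n ^ 3 := Nat.mul_le_mul_left _ (Nat.one_le_pow _ _ hn)
    have h4 : n ^ 1 ≤ n ^ 3 := Nat.pow_le_pow_right hn (by norm_num)
    have h5 : 1 * n ^ 3 ≤ d * n ^ 3 := Nat.mul_le_mul_right _ hd
    have h6 : d * n ^ 1 ≤ d * n ^ 3 := Nat.mul_le_mul_left _ h4
    simp only [NExp.cost]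
    nlinarith

end NoiseLoop

/-! ### Connected components -/

section Merge

variable {n d k : ℕ} {C : Circuit n d k} {N : PauliNoise}

/-- The partition of the labelled qubits in `m'` arises from that in `m` by merging blocks, and it
stays finer than the relation `r` if it was so. -/
structure Coarser (r : Fin n → Fin n → Prop) (m m' : Mem) : Prop where
  eq : ∀ v w : Fin n, m.nat 2 v = m.nat 2 w → m'.nat 2 v = m'.nat 2 w
  lt : ∀ v : Fin n, m'.nat 2 v < n ↔ m.nat 2 v < n
  sound : (∀ v w : Fin n, m.nat 2 v = m.nat 2 w → m.nat 2 v < n → r v w) →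
    ∀ v w : Fin n, m'.nat 2 v = m'.nat 2 w → m'.nat 2 v < n → r v w

theorem Coarser.refl (r : Fin n → Fin n → Prop) (m : Mem) : Coarser r m m :=
  ⟨fun _ _ h => h, fun _ => Iff.rfl, fun h => h⟩

theorem Coarser.trans {r : Fin n → Fin n → Prop} {m m' m'' : Mem} (h : Coarser r m m')
    (h' : Coarser r m' m'') : Coarser r m m'' :=
  ⟨fun v w e => h'.eq v w (h.eq v w e), fun v => (h'.lt v).trans (h.lt v),
    fun hs => h'.sound (h.sound hs)⟩

theorem Coarser.congr {r : Fin n → Fin n → Prop} {m m₁ m₂ : Mem} (h : Coarser r m m₁)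
    (h2 : m₂.nat 2 = m₁.nat 2) : Coarser r m m₂ :=
  ⟨by rw [h2]; exact h.eq, by rw [h2]; exact h.lt, by rw [h2]; exact h.sound⟩

/-- The labels of the qubits `v` and `w`, if both have one, agree. -/
def Merged (v w : Fin n) (m : Mem) : Prop :=
  m.nat 2 v < n → m.nat 2 w < n → m.nat 2 v = m.nat 2 w

theorem Merged.coarser {r : Fin n → Fin n → Prop} {v w : Fin n} {m m' : Mem} (h : Merged v w m)
    (h' : Coarser r m m') : Merged v w m' :=
  fun hv hw => h'.eq v w (h ((h'.lt v).1 hv) ((h'.lt w).1 hw))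

/-- A loop whose rounds merge blocks; the property that round `j` establishes has to persist when
blocks are merged later. -/
theorem det_for_coarser {r : Fin n → Fin n → Prop} {a M c c' : ℕ} {e : NExp} {q : Prog} {m₀ : Mem}
    {P : ℕ → Mem → Prop} (ha : a ≠ 2) (hw : q.writesNat a = false)
    (he : ∀ m, Agree (Prog.for a e q) m₀ m → e.eval C m = M)
    (hP : ∀ j m m', P j m → Coarser r m m' → P j m')
    (hq : ∀ j < M, ∀ m, Agree (Prog.for a e q) m₀ m → m.nat a 0 = j → Coarser r m₀ m →
      Det C N q m c fun m' => Coarser r m m' ∧ P j m')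
    (hc : (c + e.cost + 11) * M + e.cost + 8 ≤ c') :
    Det C N (Prog.for a e q) m₀ c' fun m' => Coarser r m₀ m' ∧ ∀ j < M, P j m' := by
  refine (Det.for (M := M) (c := c) (I := fun j m => Coarser r m₀ m ∧ ∀ i < j, P i m) hw he
    ⟨Coarser.refl _ _, fun i hi => absurd hi (Nat.not_lt_zero i)⟩ ?_ ?_).cost_le hc
  · rintro j m x ⟨h, hj⟩
    have h2 : (m.setNat a 0 x).nat 2 = m.nat 2 := by simp [ha.symm]
    exact ⟨h.congr h2, fun i hi => hP i m _ (hj i hi) ((Coarser.refl r m).congr h2)⟩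
  · rintro j hj m hA hjm ⟨h, hPj⟩
    refine (hq j hj m hA hjm h).mono le_rfl fun m' _ h' => ⟨h.trans h'.1, fun i hi => ?_⟩
    rcases Nat.lt_succ_iff_lt_or_eq.1 hi with hi | rfl
    · exact hP i m m' (hPj i hi) h'.1
    · exact h'.2

theorem det_relabel {m : Mem} {x y : ℕ} (hx : m.nat 17 0 = x) (hy : m.nat 18 0 = y) :
    Det C N relabel m (40 * n + 9) fun m' =>
      ∀ v < n, m'.nat 2 v = if m.nat 2 v = x then y else m.nat 2 v := by
  refine (Det.for (c := 21) (M := n) (I := fun j m' => (∀ v < j, m'.nat 2 v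
    = if m.nat 2 v = x then y else m.nat 2 v) ∧ ∀ v, j ≤ v → m'.nat 2 v = m.nat 2 v) rfl
    (fun _ _ => rfl) ?_ ?_ ?_).mono ?_ fun m' _ h => h.1
  · simp
  · intro j m' z h
    simpa using h
  · rintro j hj m' hA hjm ⟨h1, h2⟩
    have hmem : (BExp.natEq (.get 2 (.var 16)) (.var 17)).Holds C N m' ↔ m.nat 2 j = x := by
      rw [holds_natEq]
      simp [NExp.eval, hjm, hA.nat 17 rfl, hx, h2 j le_rfl]
    have hlt : ∀ v, v < j + 1 → v ≠ j → v < j := fun v _ _ => by omega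
    refine (Det.ite (c := 5) (fun h => ?_) fun h => ?_).cost_le (by
      simp only [BExp.cost, NExp.cost]; omega)
    · rw [hmem] at h
      refine Det.setNat_le (by simp [NExp.cost]) ⟨fun v hv => ?_, fun v hv => ?_⟩
      · by_cases hvj : v = j
        · simp [NExp.eval, hjm, hA.nat 18 rfl, hy, hvj, h]
        · simp [NExp.eval, hjm, hvj, h1 v (hlt v hv hvj)]
      · simp [NExp.eval, hjm, show v ≠ j by omega, h2 v (by omega)]
    · rw [hmem] at h
      refine Det.skip_le (by norm_num) ⟨fun v hv => ?_, fun v hv => h2 v (by omega)⟩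
      by_cases hvj : v = j
      · rw [hvj, h2 j le_rfl, if_neg h]
      · exact h1 v (hlt v hv hvj)
  · simp only [NExp.cost]
    omega

/-- The body of the merging loops gives two qubits of a gate the same label, if both have one. -/
theorem det_mergePair {r : Fin n → Fin n → Prop} (hr : Equivalence r) {m : Mem} {t j i i' : ℕ}
    {g : DiagGate n} (ht : m.nat 12 0 = t) (hj : m.nat 13 0 = j) (hi : m.nat 14 0 = i)
    (hi' : m.nat 15 0 = i') (hg : (gatesAt C t)[j]? = some g) (hig : i < g.arity)
    (hig' : i' < g.arity) (hn : 1 ≤ n)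
    (hrel : m.nat 2 (g.qubit ⟨i, hig⟩) < n → m.nat 2 (g.qubit ⟨i', hig'⟩) < n →
      r (g.qubit ⟨i, hig⟩) (g.qubit ⟨i', hig'⟩)) :
    Det C N (.seq (.assign 17 (.get 2 (.gateQubit (.var 12) (.var 13) (.var 14)))) <|
      .seq (.assign 18 (.get 2 (.gateQubit (.var 12) (.var 13) (.var 15)))) <|
      .ite (.and (.natLt (.var 17) .numQubits) (.natLt (.var 18) .numQubits)) relabel .skip) m
      (100 * n) fun m' => Coarser r m m' ∧ Merged (g.qubit ⟨i, hig⟩) (g.qubit ⟨i', hig'⟩) m' := by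
  set v := g.qubit ⟨i, hig⟩ with hv
  set w := g.qubit ⟨i', hig'⟩ with hw
  refine (Det.comp (c := 10) (c' := 40 * n + 31) (P := fun m₁ => m₁.nat 17 0 = m.nat 2 v)
    (Det.setNat_le (by simp [NExp.cost]) ?_) fun m₁ hA₁ h₁ => (Det.comp (c := 10)
      (c' := 40 * n + 20) (P := fun m₂ => m₂.nat 18 0 = m.nat 2 w)
      (Det.setNat_le (by simp [NExp.cost]) ?_) fun m₂ hA₂ h₂ =>
        (Det.ite (c := 40 * n + 9) (fun h => ?_) fun h => ?_).cost_le ?_).cost_le ?_).cost_le ?_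
  · simp [NExp.eval, ht, hj, hi, readGate, hg, hig, hv]
  · simp [NExp.eval, hA₁.nat 12 rfl, hA₁.nat 13 rfl, hA₁.nat 15 rfl, hA₁.nat 2 rfl, ht, hj, hi',
      readGate, hg, hig', hw]
  · have hL : ∀ u, m₂.nat 2 u = m.nat 2 u := fun u => by rw [hA₂.nat 2 rfl, hA₁.nat 2 rfl]
    have h17 : m₂.nat 17 0 = m.nat 2 v := by rw [hA₂.nat 17 rfl, h₁]
    have hlt : m.nat 2 v < n ∧ m.nat 2 w < n := by
      simpa [BExp.Holds, NExp.eval, h17, h₂] using h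
    have hvw := hrel hlt.1 hlt.2
    refine (det_relabel h17 h₂).mono le_rfl fun m' _ h' => ?_
    have hL' : ∀ u : Fin n, m'.nat 2 u = if m.nat 2 u = m.nat 2 v then m.nat 2 w else m.nat 2 u :=
      fun u => by rw [h' u u.2, hL]
    refine ⟨⟨fun u u' e => ?_, fun u => ?_, fun hs u u' e hu => ?_⟩, fun _ _ => ?_⟩
    · rw [hL', hL', e]
    · rw [hL']
      split_ifs with hu
      · rw [hu]
        exact iff_of_true hlt.2 hlt.1
      · exact Iff.rfl
    · rw [hL'] at hu
      rw [hL', hL'] at e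
      split_ifs at e hu with h1 h2 h2
      · exact hs u u' (h1.trans h2.symm) (by rw [h1]; exact hlt.1)
      · exact hr.trans (hs u v h1 (by rw [h1]; exact hlt.1)) (hr.trans hvw (hs w u' e hlt.2))
      · exact hr.trans (hs u w e hu) (hr.trans (hr.symm hvw) (hs v u' h2.symm hlt.1))
      · exact hs u u' e hu
    · rw [hL', hL', if_pos rfl]
      split_ifs <;> rfl
  · have hL : m₂.nat 2 = m.nat 2 := by rw [hA₂.nat 2 rfl, hA₁.nat 2 rfl]
    have h17 : m₂.nat 17 0 = m.nat 2 v := by rw [hA₂.nat 17 rfl, h₁]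
    refine Det.skip_le (by omega) ⟨(Coarser.refl r m).congr hL, fun h1 h2 => absurd ?_ h⟩
    rw [hL] at h1 h2
    simp [BExp.Holds, NExp.eval, h17, h₂, h1, h2]
  · simp only [BExp.cost, NExp.cost]; omega
  · omega
  · omega

/-- After merging, the blocks are the classes of the equivalence relation that is generated by the
pairs of labelled qubits in common gates. -/
theorem det_mergePhase {r : Fin n → Fin n → Prop} (hr : Equivalence r) {m : Mem}
    (hn : 1 ≤ n) (hd : 1 ≤ d)
    (hrel : ∀ t, ∀ g ∈ gatesAt C t, ∀ i i', m.nat 2 (g.qubit i) < n → m.nat 2 (g.qubit i') < n →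
      r (g.qubit i) (g.qubit i')) :
    Det C N mergePhase m (300 * (d * n ^ 4)) fun m' => Coarser r m m' ∧ ∀ t < d,
      ∀ g ∈ gatesAt C t, ∀ i i', Merged (g.qubit i) (g.qubit i') m' := by
  have h1 : 1 ≤ n ^ 2 := Nat.one_le_pow _ _ hn
  have h2 : 1 ≤ n ^ 3 := Nat.one_le_pow _ _ hn
  have h3 : 1 ≤ n ^ 4 := Nat.one_le_pow _ _ hn
  unfold mergePhase
  refine (det_for_coarser (r := r) (M := d) (c := 250 * n ^ 4) (P := fun t m' =>
    ∀ j < (gatesAt C t).length, ∀ g, (gatesAt C t)[j]? = some g → ∀ i < g.arity, ∀ i' < g.arity,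
      ∀ hi hi', Merged (g.qubit ⟨i, hi⟩) (g.qubit ⟨i', hi'⟩) m') (by norm_num) rfl (fun _ _ => rfl)
    ?_ ?_ le_rfl).mono ?_ ?_
  · exact fun t m m' h h' j hj g hg i hi i' hi' hi₁ hi₂ => (h j hj g hg i hi i' hi' hi₁ hi₂).coarser h'
  · intro t ht m₁ hA₁ ht₁ hc₁
    refine det_for_coarser (r := r) (M := (gatesAt C t).length) (c := 210 * n ^ 3) (P := fun j m' =>
      ∀ g, (gatesAt C t)[j]? = some g → ∀ i < g.arity, ∀ i' < g.arity,
      ∀ hi hi', Merged (g.qubit ⟨i, hi⟩) (g.qubit ⟨i', hi'⟩) m') (by norm_num) rfl ?_ ?_ ?_ ?_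
    · intro m' hA
      simp [NExp.eval, hA.nat 12 rfl, ht₁]
    · exact fun j m m' h h' g hg i hi i' hi' hi₁ hi₂ => (h g hg i hi i' hi' hi₁ hi₂).coarser h'
    · intro j hj m₂ hA₂ hj₂ hc₂
      set g := (gatesAt C t)[j] with hgdef
      have hg : (gatesAt C t)[j]? = some g := by simp [g]
      have harity : g.arity ≤ n := by simpa using Fintype.card_le_of_embedding g.qubit
      refine (det_for_coarser (r := r) (M := g.arity) (c := 160 * n ^ 2) (P := fun i m' =>
        ∀ i' < g.arity, ∀ hi hi', Merged (g.qubit ⟨i, hi⟩) (g.qubit ⟨i', hi'⟩) m')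
        (by norm_num) rfl ?_ ?_ ?_ ?_).mono le_rfl ?_
      · intro m' hA
        simp [NExp.eval, hA.nat 12 rfl, hA.nat 13 rfl, hA₂.nat 12 rfl, ht₁, hj₂, readGate, hg]
      · exact fun i m m' h h' i' hi' hi₁ hi₂ => (h i' hi' hi₁ hi₂).coarser h'
      · intro i hi m₃ hA₃ hi₃ hc₃
        refine (det_for_coarser (r := r) (M := g.arity) (c := 100 * n) (P := fun i' m' =>
          ∀ hi', Merged (g.qubit ⟨i, hi⟩) (g.qubit ⟨i', hi'⟩) m')
          (by norm_num) rfl ?_ ?_ ?_ ?_).mono le_rfl ?_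
        · intro m' hA
          simp [NExp.eval, hA.nat 12 rfl, hA.nat 13 rfl, hA₃.nat 12 rfl, hA₃.nat 13 rfl,
            hA₂.nat 12 rfl, ht₁, hj₂, readGate, hg]
        · exact fun i m m' h h' hi₁ => (h hi₁).coarser h'
        · intro i' hi' m₄ hA₄ hi₄ hc₄
          have hcm := ((hc₁.trans hc₂).trans hc₃).trans hc₄
          refine (det_mergePair hr (t := t) (j := j) ?_ ?_ ?_ hi₄ hg hi hi' hn fun hl hl' => ?_).mono
            le_rfl fun m' _ h => ⟨h.1, fun _ => h.2⟩
          · rw [hA₄.nat 12 rfl, hA₃.nat 12 rfl, hA₂.nat 12 rfl, ht₁]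
          · rw [hA₄.nat 13 rfl, hA₃.nat 13 rfl, hj₂]
          · rw [hA₄.nat 14 rfl, hi₃]
          · exact hrel t g (List.getElem_mem hj) _ _ ((hcm.lt _).1 hl) ((hcm.lt _).1 hl')
        · simp only [NExp.cost]
          nlinarith
        · exact fun m' _ h => ⟨h.1, fun i' hi' _ hi₂ => h.2 i' hi' hi₂⟩
      · have : (160 * n ^ 2 + 5 + 11) * g.arity ≤ (160 * n ^ 2 + 5 + 11) * n :=
          Nat.mul_le_mul_left _ harity
        have h4 : n * 1 ≤ n * n ^ 2 := Nat.mul_le_mul_left _ h1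
        simp only [NExp.cost]
        nlinarith
      · rintro m' - ⟨h, h'⟩
        refine ⟨h, fun g' hg' i hi i' hi' hi₁ hi₂ => ?_⟩
        obtain rfl : g = g' := Option.some.inj (hg.symm.trans hg')
        exact h' i hi i' hi' hi₁ hi₂
    · have := length_gatesAt_le C t
      have : (210 * n ^ 3 + 3 + 11) * (gatesAt C t).length ≤ (210 * n ^ 3 + 3 + 11) * n :=
        Nat.mul_le_mul_left _ this
      have h4 : n * 1 ≤ n * n ^ 3 := Nat.mul_le_mul_left _ h2
      simp only [NExp.cost]
      nlinarith
  · have h4 : 1 * 1 ≤ d * n ^ 4 := Nat.mul_le_mul hd h3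
    have h5 : d * 1 ≤ d * n ^ 4 := Nat.mul_le_mul_left _ h3
    simp only [NExp.cost]
    nlinarith
  · rintro m' - ⟨h, h'⟩
    refine ⟨h, fun t ht g hg i i' => ?_⟩
    obtain ⟨j, hj, rfl⟩ := List.getElem_of_mem hg
    exact h' t ht j hj _ (by simp) i i.2 i' i'.2 _ _

end Merge

/-! ### Factorization over the blocks -/

section Factorization

variable {n d k : ℕ} {C : Circuit n d k} {N : PauliNoise}

theorem amp_empty (G : Bits n → ℂ) (b u : Bits n) : amp ∅ G b u = G u := by
  simp [amp, chi]

/-- If no gate acts on both `P` and `Q`, the phase depends on the two parts independently. -/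
theorem phase_piecewise_union {ω : Pattern} {P Q : Finset (Fin n)}
    (h : ∀ t < d, ∀ g ∈ gatesAt C t, (∀ i, g.qubit i ∉ P) ∨ ∀ i, g.qubit i ∉ Q) (y u : Bits n) :
    phase C ω d ((P ∪ Q).piecewise y u) * phase C ω d u
      = phase C ω d (P.piecewise y u) * phase C ω d (Q.piecewise y u) := by
  simp only [phase, ← Finset.prod_mul_distrib]
  refine Finset.prod_congr rfl fun t ht => ?_
  simp only [layerPhase, ← List.prod_map_mul]
  congr 1
  refine List.map_congr_left fun g hg => ?_
  have e : ∀ x x' : Bits n, (∀ i, x (g.qubit i) = x' (g.qubit i)) →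
      (fun i => (x + ω.shift n t) (g.qubit i)) = fun i => (x' + ω.shift n t) (g.qubit i) :=
    fun x x' hx => funext fun i => by rw [Pi.add_apply, Pi.add_apply, hx]
  rcases h t (Finset.mem_range.1 ht) g hg with hP | hQ
  · rw [e ((P ∪ Q).piecewise y u) (Q.piecewise y u) fun i => by
        by_cases hQ : g.qubit i ∈ Q <;> simp [hP i, hQ],
      e (P.piecewise y u) u fun i => by simp [hP i], mul_comm]
  · rw [e ((P ∪ Q).piecewise y u) (P.piecewise y u) fun i => by
        by_cases hP : g.qubit i ∈ P <;> simp [hP, hQ i],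
      e (Q.piecewise y u) u fun i => by simp [hQ i]]

/-- The amplitude factorizes over blocks that no gate connects. -/
theorem prod_norm_amp_block {ω : Pattern} {m : Mem}
    (hm : ∀ t < d, ∀ g ∈ gatesAt C t, ∀ i i', Merged (g.qubit i) (g.qubit i') m) (b u : Bits n) :
    ∏ l ∈ Finset.range n, ‖amp (m.block n l) (phase C ω d) b u‖ ^ 2
      = ‖amp (Finset.univ.filter fun v : Fin n => m.nat 2 v < n) (phase C ω d) b u‖ ^ 2 := by
  suffices h : ∀ j ≤ n, ∏ l ∈ Finset.range j, ‖amp (m.block n l) (phase C ω d) b u‖ ^ 2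
      = ‖amp (Finset.univ.filter fun v : Fin n => m.nat 2 v < j) (phase C ω d) b u‖ ^ 2 from
    h n le_rfl
  intro j
  induction j with
  | zero => simp [amp_empty, norm_phase]
  | succ j ih =>
    intro hj
    have hunion : (Finset.univ.filter fun v : Fin n => m.nat 2 v < j + 1)
        = (Finset.univ.filter fun v : Fin n => m.nat 2 v < j) ∪ m.block n j := by
      ext v
      simp only [Finset.mem_filter, Finset.mem_univ, true_and, Finset.mem_union, Mem.mem_block]
      omega
    have hdisj : Disjoint (Finset.univ.filter fun v : Fin n => m.nat 2 v < j) (m.block n j) := by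
      rw [Finset.disjoint_left]
      intro v hv hv'
      rw [Mem.mem_block] at hv'
      simp only [Finset.mem_filter] at hv
      omega
    rw [Finset.prod_range_succ, ih (by omega), hunion,
      norm_amp_union (norm_phase C ω d) hdisj b u (phase_piecewise_union ?_ · u), mul_pow]
    intro t ht g hg
    by_contra! hcon
    obtain ⟨⟨i, hi⟩, i', hi'⟩ := hcon
    have h1 : m.nat 2 (g.qubit i) < j := by simpa using hi
    have h2 := Mem.mem_block.1 hi'
    have := hm t ht g hg i i' (by omega) (by omega)
    omega

theorem NoiseState.phase_eq {ω : Pattern} {m : Mem} (h : NoiseState N n d d 0 ω m) :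
    m.phase C = phase C ω d := by
  funext x
  refine Finset.prod_congr rfl fun t ht => ?_
  congr 2
  funext v
  have : (t + 1) * n ≤ d * n := Nat.mul_le_mul_right _ (Finset.mem_range.1 ht)
  rw [add_mul, one_mul] at this
  rw [Mem.shift, Pattern.shift, h.flips t v v.2 (by have := v.2; omega)]

theorem NoiseState.bits_eq {ω : Pattern} {m : Mem} (h : NoiseState N n d d 0 ω m) :
    m.bits n 4 = ω.sign N n d := by
  funext v
  rw [Mem.bits, Pattern.sign, h.phases v v.2]

theorem NoiseState.label_lt {ω : Pattern} {m : Mem} (h : NoiseState N n d d 0 ω m) (v : Fin n) :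
    m.nat 2 v < n ↔ v ∈ (ω.dephased n d)ᶜ := by
  obtain ⟨h1, h2⟩ := h.label v v.2
  by_cases hv : ω.Dephased d v
  · simp [h1 hv, Pattern.dephased, hv]
  · simp [h2 hv, Pattern.dephased, hv]

end Factorization

/-! ### Percolation -/

section Percolation

variable {n d k : ℕ} {C : Circuit n d k} {N : PauliNoise}

/-- Two qubits lie in a common gate. -/
def Touch (C : Circuit n d k) (v w : Fin n) : Prop :=
  ∃ t, ∃ g ∈ gatesAt C t, ∃ i i', g.qubit i = v ∧ g.qubit i' = w

/-- Steps between elements of `S` that lie in a common gate. -/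
def StepIn (C : Circuit n d k) (S : Finset (Fin n)) (v w : Fin n) : Prop :=
  Touch C v w ∧ v ∈ S ∧ w ∈ S

theorem Touch.symm {v w : Fin n} (h : Touch C v w) : Touch C w v := by
  obtain ⟨t, g, hg, i, i', h, h'⟩ := h
  exact ⟨t, g, hg, i', i, h', h⟩

theorem equivalence_reflTransGen_stepIn (S : Finset (Fin n)) :
    Equivalence (Relation.ReflTransGen (StepIn C S)) :=
  have : Std.Symm (StepIn C S) := ⟨fun _ _ h => ⟨h.1.symm, h.2.2, h.2.1⟩⟩
  ⟨fun _ => Relation.ReflTransGen.refl, fun h => Std.Symm.symm _ _ h, fun h h' => h.trans h'⟩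

/-- Every element of `S` is connected within `S` to an element of `R`. -/
def RootedIn (C : Circuit n d k) (R S : Finset (Fin n)) : Prop :=
  ∀ s ∈ S, ∃ r ∈ R, r ∈ S ∧ Relation.ReflTransGen (StepIn C S) r s

open Classical in
/-- The qubits that lie in a common gate with `v`. -/
def neighbors (C : Circuit n d k) (v : Fin n) : Finset (Fin n) := Finset.univ.filter (Touch C v)

/-- When the root `r` is removed, its neighbours become roots. -/
theorem RootedIn.of_insert {R S U : Finset (Fin n)} {r : Fin n} (hr : r ∉ S) (hSU : S ⊆ U)
    (h : RootedIn C R (insert r S)) : RootedIn C ((R.erase r ∪ neighbors C r) ∩ U) S := by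
  intro s hs
  obtain ⟨r₀, hr₀, -, hpath⟩ := h s (Finset.mem_insert_of_mem hs)
  have key : ∀ s, Relation.ReflTransGen (StepIn C (insert r S)) r₀ s → s ∈ S →
      ∃ r' ∈ (R.erase r ∪ neighbors C r) ∩ U, r' ∈ S
        ∧ Relation.ReflTransGen (StepIn C S) r' s := by
    intro s hpath
    induction hpath with
    | refl =>
      intro hs
      have hne : r₀ ≠ r := fun e => hr (e ▸ hs)
      exact ⟨r₀, by simp [hne, hr₀, hSU hs], hs, .refl⟩
    | @tail v w _ hstep ih =>
      intro hw
      by_cases hv : v = r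
      · subst hv
        exact ⟨w, by simp [neighbors, hstep.1, hSU hw], hw, .refl⟩
      · have hvS : v ∈ S := (Finset.mem_insert.1 hstep.2.1).resolve_left hv
        obtain ⟨r', h1, h2, h3⟩ := ih hvS
        exact ⟨r', h1, h2, h3.tail ⟨hstep.1, hvS, hw⟩⟩
  exact key s hpath hs

theorem RootedIn.erase {R S : Finset (Fin n)} {r : Fin n} (hr : r ∉ S) (h : RootedIn C R S) :
    RootedIn C (R.erase r) S := by
  intro s hs
  obtain ⟨r₀, h1, h2, h3⟩ := h s hs
  exact ⟨r₀, Finset.mem_erase.2 ⟨fun e => hr (e ▸ h2), h1⟩, h2, h3⟩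

open Classical in
/-- A bound for the weighted number of sets that are connected to the roots. If a root `r` belongs to
the set, it is traded for a factor `a` and its neighbours as new roots, and otherwise it is dropped; so
the bound `x ^ R.card` is inductive as soon as `1 + a * x ^ Δ ≤ x`. -/
theorem sum_rootedIn_le {Δ : ℕ} (hΔ : ∀ v, (neighbors C v).card ≤ Δ) {a x : ℝ≥0∞}
    (h1 : 1 ≤ x) (hx : 1 + a * x ^ Δ ≤ x) (U R : Finset (Fin n)) (hRU : R ⊆ U) :
    ∑ S ∈ U.powerset, (if RootedIn C R S then a ^ S.card else 0) ≤ x ^ R.card := by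
  induction hu : U.card generalizing U R with
  | zero =>
    obtain rfl := Finset.card_eq_zero.1 hu
    obtain rfl := Finset.subset_empty.1 hRU
    simp only [Finset.powerset_empty, Finset.sum_singleton, Finset.card_empty, pow_zero]
    split_ifs <;> simp
  | succ m ih =>
    rcases R.eq_empty_or_nonempty with rfl | ⟨r, hr⟩
    · have : ∀ S ∈ U.powerset, S ≠ ∅ → (if RootedIn C ∅ S then a ^ S.card else 0) = 0 := by
        intro S _ hS
        obtain ⟨s, hs⟩ := Finset.nonempty_iff_ne_empty.2 hS
        rw [if_neg]
        intro h
        obtain ⟨r, hr, -⟩ := h s hs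
        simp at hr
      rw [Finset.sum_eq_single_of_mem ∅ (by simp) this]
      split_ifs <;> simp
    · have hcard : (U.erase r).card = m := by rw [Finset.card_erase_of_mem (hRU hr), hu]; rfl
      have hR : (R.erase r).card + 1 = R.card := Finset.card_erase_add_one hr
      rw [← Finset.insert_erase (hRU hr), Finset.sum_powerset_insert (Finset.notMem_erase r U)]
      have i1 : ∑ S ∈ (U.erase r).powerset, (if RootedIn C R S then a ^ S.card else 0)
          ≤ x ^ (R.erase r).card := by
        refine le_trans (Finset.sum_le_sum fun S hS => ?_)
          (ih (U.erase r) (R.erase r) (Finset.erase_subset_erase r hRU) hcard)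
        have hrS : r ∉ S := fun h => Finset.notMem_erase r U (Finset.mem_powerset.1 hS h)
        split_ifs with h h'
        · exact le_rfl
        · exact absurd (h.erase hrS) h'
        · exact zero_le
        · exact le_rfl
      have i2 : ∑ S ∈ (U.erase r).powerset,
          (if RootedIn C R (insert r S) then a ^ (insert r S).card else 0)
          ≤ a * (x ^ (R.erase r).card * x ^ Δ) := by
        set R' := (R.erase r ∪ neighbors C r) ∩ U.erase r with hR'
        have hR'card : R'.card ≤ (R.erase r).card + Δ :=
          (Finset.card_le_card Finset.inter_subset_left).trans
            ((Finset.card_union_le _ _).trans (Nat.add_le_add_left (hΔ r) _))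
        calc _ ≤ ∑ S ∈ (U.erase r).powerset, a * (if RootedIn C R' S then a ^ S.card else 0) := by
              refine Finset.sum_le_sum fun S hS => ?_
              have hSU := Finset.mem_powerset.1 hS
              have hrS : r ∉ S := fun h => Finset.notMem_erase r U (hSU h)
              split_ifs with h h'
              · rw [Finset.card_insert_of_notMem hrS, pow_succ, mul_comm]
              · exact absurd (h.of_insert hrS hSU) h'
              · exact zero_le
              · exact zero_le
          _ ≤ a * x ^ R'.card := by
              rw [← Finset.mul_sum]
              gcongr
              exact ih (U.erase r) R' Finset.inter_subset_right hcard
          _ ≤ a * (x ^ (R.erase r).card * x ^ Δ) := by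
              rw [← pow_add]
              gcongr
      calc _ ≤ x ^ (R.erase r).card + a * (x ^ (R.erase r).card * x ^ Δ) := add_le_add i1 i2
        _ = x ^ (R.erase r).card * (1 + a * x ^ Δ) := by ring
        _ ≤ x ^ (R.erase r).card * x := by gcongr
        _ = x ^ R.card := by rw [← hR, pow_succ]

/-- In every layer, at most one gate acts on a given qubit. -/
theorem card_neighbors_le (C : Circuit n d k) (v : Fin n) : (neighbors C v).card ≤ d * k := by
  classical
  have hsub : neighbors C v ⊆ Finset.univ.biUnion fun t : Fin d =>
      Finset.univ.filter fun w => ∃ g ∈ C.layer t, ∃ i i', g.qubit i = v ∧ g.qubit i' = w := by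
    intro w hw
    simp only [neighbors, Finset.mem_filter, Finset.mem_univ, true_and] at hw
    obtain ⟨t, g, hg, h⟩ := hw
    rw [gatesAt] at hg
    split_ifs at hg with ht
    · simp only [Finset.mem_biUnion, Finset.mem_univ, Finset.mem_filter, true_and]
      exact ⟨⟨t, ht⟩, g, hg, h⟩
    · simp at hg
  refine (Finset.card_le_card hsub).trans ((Finset.card_biUnion_le).trans ?_)
  refine (Finset.sum_le_card_nsmul _ _ k fun t _ => ?_).trans (by simp)
  by_cases hex : ∃ g ∈ C.layer t, ∃ i, g.qubit i = v
  · obtain ⟨g, hg, i, hi⟩ := hex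
    have hsub' : (Finset.univ.filter fun w => ∃ g ∈ C.layer t, ∃ i i', g.qubit i = v
        ∧ g.qubit i' = w) ⊆ Finset.univ.image g.qubit := by
      intro w hw
      simp only [Finset.mem_filter, Finset.mem_univ, true_and] at hw
      obtain ⟨g', hg', i₁, i', hi₁, hi'⟩ := hw
      have hgg : g = g' := by
        by_contra hne
        have : Std.Symm fun g h : DiagGate n =>
          Disjoint (Set.range g.qubit) (Set.range h.qubit) := ⟨fun _ _ h => h.symm⟩
        exact Set.disjoint_left.1 ((C.disjoint t).forall hg hg' hne) ⟨i, hi⟩ ⟨i₁, hi₁⟩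
      subst hgg
      simp only [Finset.mem_image, Finset.mem_univ, true_and]
      exact ⟨i', hi'⟩
    exact (Finset.card_le_card hsub').trans (Finset.card_image_le.trans
      (by simpa using C.isLocal t g hg))
  · rw [Finset.card_eq_zero.2]
    · exact zero_le
    · rw [Finset.filter_eq_empty_iff]
      rintro w - ⟨g, hg, i, i', hi, -⟩
      exact hex ⟨g, hg, i, hi⟩

end Percolation

/-! ### The expected size of the blocks -/

section BlockSize

variable {n d k : ℕ} {C : Circuit n d k} (N : PauliNoise)

/-- The outcomes at different positions are independent. -/
theorem noiseAvg_prod (f : ℕ × ℕ → Outcome → ℝ≥0∞) (L : List (ℕ × ℕ)) (hL : L.Nodup) (ω : Pattern) :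
    noiseAvg N L (fun ω => (L.map fun i => f i (ω i.1 i.2)).prod) ω
      = (L.map fun i => ∑ o, N.weight o • f i o).prod := by
  induction L generalizing ω with
  | nil => rfl
  | cons i L ih =>
    obtain ⟨hi, hL⟩ := List.nodup_cons.1 hL
    simp only [noiseAvg, List.map_cons, List.prod_cons, Finset.sum_mul]
    refine Finset.sum_congr rfl fun o _ => ?_
    have h : noiseAvg N L (fun ω => f i (ω i.1 i.2) * (L.map fun i => f i (ω i.1 i.2)).prod)
        (ω.set i o) = noiseAvg N L (fun ω => f i o * (L.map fun i => f i (ω i.1 i.2)).prod)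
        (ω.set i o) := by
      refine noiseAvg_congr N fun ω' hω' => ?_
      have : ω' i.1 i.2 = o := by
        rw [hω' i.1 i.2 hi]
        simp [Pattern.set]
      rw [this]
    rw [h, noiseAvg_mul_left, ih hL, smul_mul_assoc]

theorem mem_positionsFrom {n d t v : ℕ} : (t, v) ∈ positionsFrom n d 0 ↔ t < d ∧ v < n := by
  simp [positionsFrom, mem_rowFrom]

theorem nodup_positionsFrom (n d : ℕ) : (positionsFrom n d 0).Nodup := by
  rw [positionsFrom, List.nodup_flatMap]
  constructor
  · intro s _
    exact List.Nodup.map (fun a b h => (Prod.mk.inj h).2) List.nodup_range'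
  · refine (List.nodup_range' (s := 0) (n := d - 0)).imp fun {a b} hab => ?_
    rintro ⟨s, v⟩ h1 h2
    rw [mem_rowFrom] at h1 h2
    exact hab (h1.1.symm.trans h2.1)

theorem prod_positionsFrom (n d : ℕ) (f : ℕ → ℝ≥0∞) :
    ((positionsFrom n d 0).map fun i => f i.2).prod = (∏ v : Fin n, f v) ^ d := by
  have hrow : ∀ t, ((rowFrom n t 0).map fun i => f i.2).prod = ∏ v : Fin n, f v := by
    intro t
    rw [rowFrom, List.map_map, Nat.sub_zero, ← List.range_eq_range',
      Fin.prod_univ_eq_prod_range (fun v => f v) n]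
    rfl
  rw [positionsFrom, List.map_flatMap, List.flatMap_def, List.prod_flatten, List.map_map]
  simp only [Function.comp_def, hrow, List.map_const', List.prod_replicate, List.length_range',
    Nat.sub_zero]

open Classical in
/-- The probability that no qubit of `S` is dephased is at most `(1 - 2 * p) ^ (d * S.card)`. -/
theorem noiseAvg_not_dephased_le (S : Finset (Fin n)) :
    noiseAvg N (positionsFrom n d 0)
      (fun ω => if ∀ v ∈ S, ¬ ω.Dephased d v then (1 : ℝ≥0∞) else 0) Pattern.none
      ≤ ((N.weight (false, false) + N.weight (true, false) : ℝ≥0) : ℝ≥0∞) ^ (d * S.card) := by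
  set T : Finset ℕ := S.image Fin.val with hT
  set f : ℕ × ℕ → Outcome → ℝ≥0∞ := fun i o => if i.2 ∈ T ∧ o.2 = true then 0 else 1 with hf
  refine (noiseAvg_mono N (g := fun ω => ((positionsFrom n d 0).map fun i =>
    f i (ω i.1 i.2)).prod) (fun ω => ?_) _ _).trans ?_
  · split_ifs with h
    · refine le_of_eq (Eq.symm (List.prod_eq_one ?_))
      intro z hz
      obtain ⟨⟨t, v⟩, hi, rfl⟩ := List.mem_map.1 hz
      rw [mem_positionsFrom] at hi
      simp only [hf]
      rw [if_neg]
      rintro ⟨hv, ho⟩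
      obtain ⟨w, hw, rfl⟩ := Finset.mem_image.1 hv
      exact h w hw ⟨t, hi.1, ho⟩
    · exact zero_le
  · rw [noiseAvg_prod N f _ (nodup_positionsFrom n d)]
    have hq : ∀ i : ℕ × ℕ, ∑ o, N.weight o • f i o = (fun v => if v ∈ T then
        ((N.weight (false, false) + N.weight (true, false) : ℝ≥0) : ℝ≥0∞) else 1) i.2 := by
      intro i
      have h1 := N.sum_weight
      rw [sum_outcome] at h1 ⊢
      by_cases hi : i.2 ∈ T
      · simp [hf, hi, ENNReal.smul_def]
      · simp [hf, hi, ENNReal.smul_def, ← ENNReal.coe_add, h1]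
    simp only [hq]
    rw [prod_positionsFrom n d fun v => if v ∈ T then
        ((N.weight (false, false) + N.weight (true, false) : ℝ≥0) : ℝ≥0∞) else 1]
    have hmem : ∀ v : Fin n, (v : ℕ) ∈ T ↔ v ∈ S := fun v => by simp [hT, Fin.val_inj]
    simp only [hmem]
    rw [Finset.prod_ite_mem, Finset.univ_inter, Finset.prod_const, ← pow_mul, mul_comm]

open Classical in
/-- The sum of `4 ^ S.card` over all qubits `v` and all sets `S` of qubits that are not dephased and that
are connected to `v` within `S`. If `v` is not dephased, its component is one of these sets. -/
def clusterSum (C : Circuit n d k) (ω : Pattern) : ℝ≥0∞ :=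
  ∑ v : Fin n, ∑ S : Finset (Fin n), (if RootedIn C {v} S then 4 ^ S.card else 0)
    * if ∀ w ∈ S, ¬ ω.Dephased d w then 1 else 0

/-- A qubit contributes the weight `4 * q ^ d` to a connected set, where `q` is the probability not to
be dephased by one layer. -/
theorem noiseAvg_clusterSum_le {x : ℝ≥0∞} (h1 : 1 ≤ x)
    (hx : 1 + 4 * ((N.weight (false, false) + N.weight (true, false) : ℝ≥0) : ℝ≥0∞) ^ d
      * x ^ (d * k) ≤ x) :
    noiseAvg N (positionsFrom n d 0) (clusterSum C) Pattern.none ≤ n * x := by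
  classical
  set q : ℝ≥0∞ := ((N.weight (false, false) + N.weight (true, false) : ℝ≥0) : ℝ≥0∞) with hq
  unfold clusterSum
  simp only [noiseAvg_sum, noiseAvg_mul_left]
  calc _ ≤ ∑ v : Fin n, x := by
        refine Finset.sum_le_sum fun v _ => ?_
        refine le_trans (Finset.sum_le_sum fun S _ => ?_)
          ((sum_rootedIn_le (card_neighbors_le C) h1 hx Finset.univ {v}
            (Finset.subset_univ _)).trans (by simp))
        refine (mul_le_mul_right (noiseAvg_not_dephased_le N S) _).trans (le_of_eq ?_)
        split_ifs
        · rw [pow_mul, ← mul_pow]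
        · simp
    _ = n * x := by simp

/-- The blocks are contained in the components of the qubits that are not dephased. -/
theorem sum_four_pow_block_le {ω : Pattern} {m : Mem}
    (hlt : ∀ v : Fin n, m.nat 2 v < n ↔ v ∈ (ω.dephased n d)ᶜ)
    (hs : ∀ v w : Fin n, m.nat 2 v = m.nat 2 w → m.nat 2 v < n →
      Relation.ReflTransGen (StepIn C (ω.dephased n d)ᶜ) v w) :
    ((∑ l ∈ Finset.range n, 4 ^ (m.block n l).card : ℕ) : ℝ≥0∞) ≤ n + clusterSum C ω := by
  classical
  set A := (ω.dephased n d)ᶜ with hA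
  set f : Fin n → ℝ≥0∞ := fun v => ∑ S : Finset (Fin n),
    (if RootedIn C {v} S then 4 ^ S.card else 0) * if ∀ w ∈ S, ¬ ω.Dephased d w then 1 else 0 with hf
  have hblock : ∀ l < n, (4 : ℝ≥0∞) ^ (m.block n l).card ≤ 1 + ∑ v ∈ m.block n l, f v := by
    intro l hl
    rcases (m.block n l).eq_empty_or_nonempty with h | ⟨v, hv⟩
    · simp [h]
    · set S : Finset (Fin n) := A.filter fun w => Relation.ReflTransGen (StepIn C A) v w with hS
      have hvl := Mem.mem_block.1 hv
      have hvA : v ∈ A := (hlt v).1 (by omega)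
      have hsub : m.block n l ⊆ S := by
        intro w hw
        have hwl := Mem.mem_block.1 hw
        exact Finset.mem_filter.2 ⟨(hlt w).1 (by omega), hs v w (by omega) (by omega)⟩
      have hroot : RootedIn C {v} S := by
        intro s hsS
        refine ⟨v, Finset.mem_singleton_self v, hsub hv, ?_⟩
        have key : ∀ w, Relation.ReflTransGen (StepIn C A) v w →
            Relation.ReflTransGen (StepIn C S) v w := by
          intro w hw
          induction hw with
          | refl => exact .refl
          | tail h1 h2 ih =>
            exact ih.tail ⟨h2.1, Finset.mem_filter.2 ⟨h2.2.1, h1⟩,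
              Finset.mem_filter.2 ⟨h2.2.2, h1.tail h2⟩⟩
        exact key s (Finset.mem_filter.1 hsS).2
      have halive : ∀ w ∈ S, ¬ ω.Dephased d w := by
        intro w hw
        have := (Finset.mem_filter.1 hw).1
        simpa [hA, Pattern.dephased] using this
      calc (4 : ℝ≥0∞) ^ (m.block n l).card ≤ 4 ^ S.card :=
            pow_le_pow_right₀ (by norm_num) (Finset.card_le_card hsub)
        _ ≤ f v := by
            refine le_trans ?_ (Finset.single_le_sum (f := fun S : Finset (Fin n) =>
              (if RootedIn C {v} S then (4 : ℝ≥0∞) ^ S.card else 0)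
                * if ∀ w ∈ S, ¬ ω.Dephased d w then 1 else 0) (fun _ _ => zero_le)
              (Finset.mem_univ S))
            rw [if_pos hroot, if_pos halive, mul_one]
        _ ≤ 1 + ∑ v ∈ m.block n l, f v :=
            (Finset.single_le_sum (f := f) (fun _ _ => zero_le) hv).trans le_add_self
  push_cast
  calc _ ≤ ∑ l ∈ Finset.range n, (1 + ∑ v ∈ m.block n l, f v) :=
        Finset.sum_le_sum fun l hl => hblock l (Finset.mem_range.1 hl)
    _ = n + ∑ l ∈ Finset.range n, ∑ v : Fin n, if m.nat 2 v = l then f v else 0 := by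
        rw [Finset.sum_add_distrib]
        simp [Mem.block, Finset.sum_filter]
    _ ≤ n + clusterSum C ω := by
        rw [Finset.sum_comm]
        refine add_le_add_right (Finset.sum_le_sum fun v _ => ?_) _
        rw [Finset.sum_ite_eq]
        split_ifs
        · exact le_rfl
        · exact zero_le

end BlockSize

/-! ### The depth threshold -/

section Threshold

/-- The depth threshold. The factor `5` makes `(1 - 2 * p) ^ d` small in comparison with `1 / (d * k)`. -/
def depthThreshold (p : ℝ) (k : ℕ) : ℕ := ⌈5 * (p⁻¹ * Real.log (k * p⁻¹))⌉₊

variable {p : ℝ} {k : ℕ}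

theorem one_le_inv_mul_log (h0 : 0 < p) (h1 : p ≤ 1 / 2) (hk : 1 ≤ k) :
    1 ≤ p⁻¹ * Real.log (k * p⁻¹) := by
  have hp : 2 ≤ p⁻¹ := by
    rw [le_inv_comm₀ (by norm_num) h0]
    linarith
  have hk' : (1 : ℝ) ≤ k := by exact_mod_cast hk
  have hlog : Real.log 2 ≤ Real.log (k * p⁻¹) :=
    Real.log_le_log (by norm_num) (by nlinarith)
  have := Real.log_two_gt_d9
  nlinarith

theorem depthThreshold_le (h0 : 0 < p) (h1 : p ≤ 1 / 2) (hk : 1 ≤ k) :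
    (depthThreshold p k : ℝ) ≤ 6 * (p⁻¹ * Real.log (k * p⁻¹)) := by
  have h := one_le_inv_mul_log h0 h1 hk
  have := (Nat.ceil_lt_add_one (a := 5 * (p⁻¹ * Real.log (k * p⁻¹))) (by linarith)).le
  rw [depthThreshold]
  linarith

theorem one_le_depthThreshold (h0 : 0 < p) (h1 : p ≤ 1 / 2) (hk : 1 ≤ k) :
    1 ≤ depthThreshold p k := by
  have h := one_le_inv_mul_log h0 h1 hk
  rw [depthThreshold, Nat.one_le_ceil_iff]
  linarith

/-- Above the threshold, the expected number of neighbours that are not dephased is at most `1 / 16`. -/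
theorem exp_mul_le_half (h0 : 0 < p) (h1 : p ≤ 1 / 2) (hk : 1 ≤ k) {d : ℕ}
    (hd : depthThreshold p k ≤ d) : 8 * (d * k * (1 - 2 * p) ^ d) ≤ 1 / 2 := by
  have hk' : (1 : ℝ) ≤ k := by exact_mod_cast hk
  have hp : 2 ≤ p⁻¹ := by
    rw [le_inv_comm₀ (by norm_num) h0]
    linarith
  have hkp : 0 < k * p⁻¹ := by positivity
  -- In terms of `y = p * d`, the three factors are `d * k ≤ exp y * exp (y / 5)`,
  -- `(1 - 2 * p) ^ d ≤ exp (-2 * y)`, and `exp (-(4 / 5) * y) ≤ 1 / 16`, since `y ≥ 5 * log 2`.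
  set y : ℝ := p * d with hy
  have hyL : 5 * Real.log (k * p⁻¹) ≤ y := by
    have : 5 * (p⁻¹ * Real.log (k * p⁻¹)) ≤ d :=
      (Nat.le_ceil _).trans (by exact_mod_cast hd)
    calc 5 * Real.log (k * p⁻¹) = p * (5 * (p⁻¹ * Real.log (k * p⁻¹))) := by field_simp
      _ ≤ p * d := by gcongr
  have hlog : Real.log 2 ≤ Real.log (k * p⁻¹) :=
    Real.log_le_log (by norm_num) (by nlinarith)
  have e1 : d * k ≤ Real.exp y * Real.exp (y / 5) := by
    have hd' : (d : ℝ) * k = y * (k * p⁻¹) := by rw [hy]; field_simp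
    rw [hd']
    have h2 : (k : ℝ) * p⁻¹ ≤ Real.exp (y / 5) := by
      rw [← Real.log_le_iff_le_exp hkp]
      linarith
    have h3 : y ≤ Real.exp y := by linarith [Real.add_one_le_exp y]
    gcongr
  have e2 : (1 - 2 * p) ^ d ≤ Real.exp (-2 * y) := by
    calc (1 - 2 * p) ^ d ≤ Real.exp (-(2 * p)) ^ d := by
          gcongr
          · linarith
          · linarith [Real.add_one_le_exp (-(2 * p))]
      _ = Real.exp (-2 * y) := by rw [← Real.exp_nat_mul, hy]; congr 1; ring
  have e3 : Real.exp (-(4 / 5 * y)) ≤ 1 / 16 := by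
    have h4 : Real.exp (-(4 * Real.log 2)) = 1 / 16 := by
      rw [Real.exp_neg, show 4 * Real.log 2 = ((4 : ℕ) : ℝ) * Real.log 2 by norm_num,
        Real.exp_nat_mul, Real.exp_log (by norm_num)]
      norm_num
    rw [← h4]
    exact Real.exp_le_exp.2 (by linarith)
  calc 8 * (d * k * (1 - 2 * p) ^ d)
      ≤ 8 * (Real.exp y * Real.exp (y / 5) * Real.exp (-2 * y)) := by
        gcongr
        · exact pow_nonneg (by linarith) _
    _ = 8 * Real.exp (-(4 / 5 * y)) := by
        rw [← Real.exp_add, ← Real.exp_add]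
        congr 2
        ring
    _ ≤ 1 / 2 := by linarith

/-- The condition for the convergence of the sum over connected sets holds with the bound `2`. -/
theorem growth_le {d : ℕ} {q : ℝ} (h0 : 0 ≤ q) (hdk : 1 ≤ d * k)
    (hq : 8 * (d * k * q ^ d) ≤ 1 / 2) :
    1 + 4 * q ^ d * (1 + 8 * q ^ d) ^ (d * k) ≤ 1 + 8 * q ^ d ∧ 1 + 8 * q ^ d ≤ 2 := by
  have hqd : 0 ≤ q ^ d := pow_nonneg h0 d
  have hdk' : (1 : ℝ) ≤ d * k := by exact_mod_cast hdk
  have h2 : (1 + 8 * q ^ d) ^ (d * k) ≤ 2 := by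
    calc (1 + 8 * q ^ d) ^ (d * k) ≤ Real.exp (8 * q ^ d) ^ (d * k) := by
          gcongr
          linarith [Real.add_one_le_exp (8 * q ^ d)]
      _ = Real.exp (8 * (d * k * q ^ d)) := by
          rw [← Real.exp_nat_mul]; congr 1; push_cast; ring
      _ ≤ Real.exp (Real.log 2) := Real.exp_le_exp.2 (by linarith [Real.log_two_gt_d9])
      _ = 2 := Real.exp_log (by norm_num)
  constructor <;> nlinarith

end Threshold

/-! ### The sampling program as a whole -/

section Sampler

variable {n d k : ℕ} {C : Circuit n d k} {N : PauliNoise} {ε : ℝ≥0∞}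

theorem PauliNoise.p_le_half (N : PauliNoise) : N.p ≤ 1 / 2 := by
  have := min_le_left N.pX N.pY
  rw [PauliNoise.p]
  linarith [N.half_le_pI, N.pY_nonneg]

/-- Above the depth threshold, the components have bounded expected exponential size. -/
theorem noiseAvg_clusterSum_le_two_mul (hk : 1 ≤ k) (h0 : 0 < N.p)
    (hd : depthThreshold N.p k ≤ d) :
    noiseAvg N (positionsFrom n d 0) (clusterSum C) Pattern.none ≤ n * 2 := by
  have h1 := N.p_le_half
  set q : ℝ := 1 - 2 * N.p with hq
  have hq0 : 0 ≤ q := by linarith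
  have hqd : 0 ≤ q ^ d := pow_nonneg hq0 d
  obtain ⟨h2, h3⟩ := growth_le hq0
    (Nat.mul_le_mul ((one_le_depthThreshold h0 h1 hk).trans hd) hk)
    (exp_mul_le_half h0 h1 hk hd)
  have hw : ((N.weight (false, false) + N.weight (true, false) : ℝ≥0) : ℝ≥0∞)
      = ENNReal.ofReal q := by
    rw [hq, ← N.weight_not_dephased, ENNReal.ofReal_coe_nnreal]
  refine (noiseAvg_clusterSum_le N (x := ENNReal.ofReal (1 + 8 * q ^ d)) ?_ ?_).trans
    (mul_le_mul_right ?_ _)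
  · rw [ENNReal.one_le_ofReal]
    linarith
  · rw [hw, ← ENNReal.ofReal_pow hq0, ← ENNReal.ofReal_pow (by positivity),
      ← ENNReal.ofReal_ofNat 4, ← ENNReal.ofReal_mul (by norm_num),
      ← ENNReal.ofReal_mul (by positivity), ← ENNReal.ofReal_one,
      ← ENNReal.ofReal_add (by norm_num) (by positivity)]
    exact ENNReal.ofReal_le_ofReal h2
  · rw [← ENNReal.ofReal_ofNat 2]
    exact ENNReal.ofReal_le_ofReal h3

/-- Before blocks are merged, every undephased qubit is its own block. -/
theorem NoiseState.eq_of_label_eq {ω : Pattern} {m : Mem} (h : NoiseState N n d d 0 ω m)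
    {v w : Fin n} (hvw : m.nat 2 v = m.nat 2 w) (hv : m.nat 2 v < n) : v = w := by
  have key : ∀ v : Fin n, m.nat 2 v < n → m.nat 2 v = v := fun v hv =>
    (h.label v v.2).2 fun hω => hv.ne ((h.label v v.2).1 hω)
  exact Fin.ext (by rw [← key v hv, hvw, key w (hvw ▸ hv)])

/-- The part of the program after the noise pattern `ω` has been drawn. -/
theorem ert_mergePhase_sampleOutcome_le {X : Mem → ℝ≥0∞} {ω : Pattern} {m : Mem} {κ : ℝ≥0∞}
    {b : Bits n} (hn : 1 ≤ n) (hd : 1 ≤ d) (hm : NoiseState N n d d 0 ω m)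
    (hX : ∀ m, X m ≤ if m.bits n 0 = b then κ else 0) :
    ert C N ε (.seq mergePhase
      (.seq (flipAll 1) (.seq (flipAll 0) (.for 19 .numQubits sampleBlock)))) X m
      ≤ ε * (400 * (d * n ^ 4) : ℕ) + (ε * (1420 * (d * n ^ 3) : ℕ) * (n + clusterSum C ω)
        + κ * ENNReal.ofReal (patternProb C N ω b)) := by
  have hlt := hm.label_lt
  refine (ert_seq_le_of_det (det_mergePhase (r := Relation.ReflTransGen
    (StepIn C (ω.dephased n d)ᶜ)) (equivalence_reflTransGen_stepIn _) hn hd ?_)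
    (e := ε * (42 * n + 29 : ℕ) + (ε * (1420 * (d * n ^ 3) : ℕ) * (n + clusterSum C ω)
        + κ * ENNReal.ofReal (patternProb C N ω b))) ?_).trans (cost_add_le ?_ _)
  · intro t g hg i i' hi hi'
    exact .single ⟨⟨t, g, hg, i, i', rfl, rfl⟩, (hlt _).1 hi, (hlt _).1 hi'⟩
  · rintro m' hA ⟨hco, hme⟩
    have hlt' : ∀ v : Fin n, m'.nat 2 v < n ↔ v ∈ (ω.dephased n d)ᶜ :=
      fun v => (hco.lt v).trans (hlt v)
    have hsum := sum_four_pow_block_le (C := C) hlt' (hco.sound fun v w h h' => by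
      rw [hm.eq_of_label_eq h h'])
    have hfilter : (Finset.univ.filter fun v : Fin n => m'.nat 2 v < n) = (ω.dephased n d)ᶜ := by
      ext v
      simp [hlt' v]
    refine (ert_sampleOutcome_le hn hd hX).trans ?_
    rw [← add_assoc]
    refine add_le_add ?_ (le_of_eq ?_)
    · rw [← Finset.mul_sum, Nat.cast_add, Nat.cast_mul (1420 * (d * n ^ 3)), mul_add, ← mul_assoc]
      exact add_le_add_right (mul_le_mul_right hsum _) _
    · rw [patternProb_eq, ofReal_avg fun u => avg_nonneg fun z => by positivity, ← avg_mul_left]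
      congr 1
      funext u
      rw [ofReal_avg fun z => by positivity, ← avg_mul_left]
      congr 1
      funext z
      rw [← ENNReal.ofReal_prod_of_nonneg fun _ _ => by positivity, Mem.phase_congr (hA.nat 3 rfl),
        hm.phase_eq, Mem.bits_congr (hA.nat 4 rfl), hm.bits_eq, prod_norm_amp_block hme, hfilter]
      have hiff : (∀ v : Fin n, n ≤ m'.nat 2 v → z v = b v)
          ↔ ∀ v ∈ ω.dephased n d, z v = b v := by
        refine forall_congr' fun v => ?_
        rw [← not_lt, hlt' v, Finset.mem_compl, not_not]
      by_cases hz : ∀ v ∈ ω.dephased n d, z v = b v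
      · rw [if_pos (hiff.2 hz), if_pos hz, one_mul, one_mul]
      · rw [if_neg (mt hiff.1 hz), if_neg hz]
        simp
  · have h1 : 1 * n ≤ d * n ^ 4 := Nat.mul_le_mul hd (Nat.le_self_pow (by norm_num) n)
    omega

/-- The expected cost of the program and the probability of the outcome `b`, in one bound: the choices
`κ = 0` and `ε = 0` isolate them. -/
theorem ert_sampler_le {X : Mem → ℝ≥0∞} {κ : ℝ≥0∞} {b : Bits n} (hn : 1 ≤ n) (hk : 1 ≤ k)
    (h0 : 0 < N.p) (hd : depthThreshold N.p k ≤ d)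
    (hX : ∀ m, X m ≤ if m.bits n 0 = b then κ else 0) :
    ert C N ε sampler X Mem.zero
      ≤ ε * (6000 * (d * n ^ 5) : ℕ) + κ * ENNReal.ofReal (outputProb C N b) := by
  have hd1 : 1 ≤ d := (one_le_depthThreshold h0 N.p_le_half hk).trans hd
  refine ert_seq_le ((add_le_add_right (ert_noisePhase_le hn hd1 (F := fun ω =>
    ε * (400 * (d * n ^ 4) : ℕ) + (ε * (1420 * (d * n ^ 3) : ℕ) * (n + clusterSum C ω)
        + κ * ENNReal.ofReal (patternProb C N ω b))) fun ω m hm =>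
    ert_mergePhase_sampleOutcome_le hn hd1 hm hX) _).trans ?_)
  simp only [noiseAvg_add, noiseAvg_const, noiseAvg_mul_left]
  rw [← ofReal_noiseAvg N fun ω => patternProb_nonneg C N ω b, ← outputProb_eq]
  have hnn : (n : ℝ≥0∞) + noiseAvg N (positionsFrom n d 0) (clusterSum C) Pattern.none
      ≤ (3 * n : ℕ) := by
    refine (add_le_add_right (noiseAvg_clusterSum_le_two_mul hk h0 hd) _).trans (le_of_eq ?_)
    push_cast
    ring
  calc _ ≤ ε + (ε * (400 * (d * n ^ 3) : ℕ) + (ε * (400 * (d * n ^ 4) : ℕ)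
        + (ε * (1420 * (d * n ^ 3) : ℕ) * (3 * n : ℕ)
          + κ * ENNReal.ofReal (outputProb C N b)))) := by
        gcongr
    _ = ε * (1 + 400 * (d * n ^ 3) + 400 * (d * n ^ 4) + 1420 * (d * n ^ 3) * (3 * n) : ℕ)
        + κ * ENNReal.ofReal (outputProb C N b) := by
        push_cast
        ring
    _ ≤ _ := by
        refine add_le_add (mul_le_mul_right (Nat.cast_le.2 ?_) _) le_rfl
        have h3 : d * n ^ 3 ≤ d * n ^ 5 :=
          Nat.mul_le_mul_left _ (Nat.pow_le_pow_right hn (by norm_num))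
        have h4 : d * n ^ 4 ≤ d * n ^ 5 :=
          Nat.mul_le_mul_left _ (Nat.pow_le_pow_right hn (by norm_num))
        have h5 : 1 * 1 ≤ d * n ^ 5 := Nat.mul_le_mul hd1 (Nat.one_le_pow _ _ hn)
        have h6 : 1420 * (d * n ^ 3) * (3 * n) = 4260 * (d * n ^ 4) := by ring
        omega

/-- The output array only ever holds bits. -/
theorem preserves_sampler : sampler.Preserves C N fun m => ∀ i, m.nat 0 i ≤ 1 := by
  simp only [sampler, noisePhase, sampleNoise, bernoulli, mergePhase, relabel, flipAll, sampleBlock,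
    tryBlock, flipBlock, blockPowers, blockAmplitude, decode, multiplyPhase, gateIndex,
    multiplyGate, Prog.for, Prog.Preserves]
  simp +contextual [Function.update_apply]
  grind

end Sampler

/-! ### Almost sure termination -/

section Termination

variable {n d k : ℕ} {C : Circuit n d k} {N : PauliNoise}

theorem one_le_stepCost {w : ℕ} (hw : 1 ≤ w) (q : Prog) : 1 ≤ q.stepCost w := by
  cases q <;> simp only [Prog.stepCost] <;> omega

/-- A machine that has not halted pays at least `1` for the next step, so the expected cost of this step
bounds the probability that it has not halted. -/
theorem one_le_sum_halted_add (hn : 1 ≤ n) {q : Prog} {t : ℕ}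
    (hq : (run C N q t).toOuterMeasure {c | c.1 = [] ∧ c.2 ∈ {m : Mem | ∃ i, 1 < m.nat 0 i}} = 0) :
    1 ≤ ∑ b : Bits n, (run C N q t).toOuterMeasure (haltedWith b)
      + ∑' c, run C N q t c * (Config.cost (n ^ 2) c : ℝ≥0∞) := by
  classical
  rw [← add_zero (∑ b : Bits n, _), ← hq, ← (run C N q t).tsum_coe]
  simp only [PMF.toOuterMeasure_apply]
  rw [← Summable.tsum_finsetSum fun _ _ => ENNReal.summable, ← ENNReal.tsum_add, ← ENNReal.tsum_add]
  refine ENNReal.tsum_le_tsum fun c => ?_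
  obtain ⟨K, m⟩ := c
  rcases K with - | ⟨p, K⟩
  · refine le_trans ?_ le_self_add
    by_cases hm : ∃ i, 1 < m.nat 0 i
    · refine le_trans (le_of_eq ?_) le_add_self
      rw [Set.indicator_of_mem]
      exact ⟨rfl, hm⟩
    · refine le_trans (le_trans (le_of_eq ?_) (Finset.single_le_sum (f := fun b : Bits n =>
        (haltedWith b).indicator (run C N q t) ([], m)) (fun _ _ => zero_le)
        (Finset.mem_univ (m.bits n 0)))) le_self_add
      rw [Set.indicator_of_mem]
      refine ⟨rfl, fun v => ?_⟩
      have : m.nat 0 v < 2 := by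
        by_contra h
        exact hm ⟨v, by omega⟩
      simp [Mem.bits, Fin.ofNat, Nat.mod_eq_of_lt this]
  · refine le_trans ?_ le_add_self
    have : (1 : ℝ≥0∞) ≤ (Config.cost (n ^ 2) (p :: K, m) : ℕ) := by
      exact_mod_cast one_le_stepCost (Nat.one_le_pow 2 n hn) p
    simpa using mul_le_mul_right this (run C N q t (p :: K, m))

/-- If the expected running time is finite, upper bounds for the probabilities of the outcomes that
sum up to `1` are attained. -/
theorem samplingProb_eq_of_le (hn : 1 ≤ n) {q : Prog} {P : Bits n → ℝ≥0∞}
    (hP : ∀ b, samplingProb C N q b ≤ P b) (hsum : ∑ b, P b = 1)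
    (hq : ∀ t, (run C N q t).toOuterMeasure
      {c | c.1 = [] ∧ c.2 ∈ {m : Mem | ∃ i, 1 < m.nat 0 i}} = 0)
    (htime : expectedTime C N q ≠ ⊤) (b : Bits n) : samplingProb C N q b = P b := by
  -- The expected cost of step `t` tends to `0`, since the sum over `t` is finite.
  have h1 : 1 ≤ ∑ b : Bits n, samplingProb C N q b := by
    have hlim := (ENNReal.tendsto_atTop_zero_of_tsum_ne_top htime).const_add
      (∑ b : Bits n, samplingProb C N q b)
    rw [add_zero] at hlim
    refine ge_of_tendsto' hlim fun t => (one_le_sum_halted_add hn (hq t)).trans ?_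
    exact add_le_add_left (Finset.sum_le_sum fun b _ => le_iSup
      (fun t => (run C N q t).toOuterMeasure (haltedWith b)) t) _
  refine le_antisymm (hP b) ?_
  rw [← hsum, ← Finset.add_sum_erase _ _ (Finset.mem_univ b),
    ← Finset.add_sum_erase _ (samplingProb C N q) (Finset.mem_univ b)] at h1
  have hfin : ∑ x ∈ Finset.univ.erase b, P x ≠ ⊤ := by
    refine ne_top_of_le_ne_top ENNReal.one_ne_top ?_
    rw [← hsum]
    exact Finset.sum_le_sum_of_subset (Finset.erase_subset _ _)
  exact (ENNReal.add_le_add_iff_right hfin).1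
    (h1.trans (add_le_add_right (Finset.sum_le_sum fun x _ => hP x) _))

theorem expectedTime_sampler_le (hn : 1 ≤ n) (hk : 1 ≤ k) (h0 : 0 < N.p)
    (hd : depthThreshold N.p k ≤ d) :
    expectedTime C N sampler ≤ (6000 * (d * n ^ 5) : ℕ) := by
  refine (expectedTime_le_ert sampler).trans
    ((ert_sampler_le (κ := 0) (b := 0) hn hk h0 hd fun m => zero_le).trans (le_of_eq ?_))
  simp

theorem samplingProb_sampler (hn : 1 ≤ n) (hk : 1 ≤ k) (h0 : 0 < N.p)
    (hd : depthThreshold N.p k ≤ d) (b : Bits n) :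
    samplingProb C N sampler b = ENNReal.ofReal (outputProb C N b) := by
  refine samplingProb_eq_of_le (P := fun b => ENNReal.ofReal (outputProb C N b)) hn (fun b => ?_)
    ?_ (fun t => ?_) ?_ b
  · refine iSup_le fun t => (run_halted_le_ert sampler t
      {m | ∀ v : Fin n, m.nat 0 v = (b v : ℕ)}).trans ((ert_sampler_le (κ := 1) (b := b)
        hn hk h0 hd fun m => ?_).trans (le_of_eq (by simp)))
    by_cases hm : ∀ v : Fin n, m.nat 0 v = (b v : ℕ)
    · have hb : m.bits n 0 = b := by
        funext v
        simp [Mem.bits, hm v]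
      rw [if_pos hb]
      exact Set.indicator_le_self _ _ m
    · exact (Set.indicator_of_notMem (s := {m : Mem | ∀ v : Fin n, m.nat 0 v = (b v : ℕ)}) hm
        _).le.trans zero_le
  · rw [← ENNReal.ofReal_sum_of_nonneg fun b _ => outputProb_nonneg C N b, sum_outputProb,
      ENNReal.ofReal_one]
  · have h : ert C N 0 sampler ({m : Mem | ∃ i, 1 < m.nat 0 i}.indicator 1) Mem.zero ≤ 0 := by
      refine (ert_le_of_preserves preserves_sampler (X' := fun _ => 0) (fun m hm => ?_)
        fun _ => Nat.zero_le 1).trans ((ert_sampler_le (κ := 0) (b := 0) hn hk h0 hd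
          fun m => zero_le).trans (le_of_eq (by simp)))
      rw [Set.indicator_of_notMem]
      rintro ⟨i, hi⟩
      exact (hm i).not_gt hi
    exact nonpos_iff_eq_zero.1 ((run_halted_le_ert sampler t _).trans h)
  · exact ne_top_of_le_ne_top (ENNReal.natCast_ne_top _) (expectedTime_sampler_le hn hk h0 hd)

end Termination

end NoisyIQP

end

theorem theorem1 :
    ∃ (alg : NoisyIQP.Prog) (A B : ℝ) (dc : ℝ → ℕ → ℕ),
      (∀ (p : ℝ) (k : ℕ), 0 < p → p ≤ 1 / 2 → 1 ≤ k →
        (dc p k : ℝ) ≤ A * (p⁻¹ * Real.log ((k : ℝ) * p⁻¹))) ∧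
      ∀ (n d k : ℕ) (C : NoisyIQP.Circuit n d k) (N : NoisyIQP.PauliNoise),
        1 ≤ n → 1 ≤ k → 0 < N.p → dc N.p k ≤ d →
          (∀ b : NoisyIQP.Bits n,
            NoisyIQP.samplingProb C N alg b = ENNReal.ofReal (NoisyIQP.outputProb C N b)) ∧
          NoisyIQP.expectedTime C N alg ≤ ENNReal.ofReal (B * ((d : ℝ) * (n : ℝ) ^ 5)) := by
  refine ⟨NoisyIQP.sampler, 6, 6000, NoisyIQP.depthThreshold,
    fun p k h0 h1 hk => NoisyIQP.depthThreshold_le h0 h1 hk, fun n d k C N hn hk h0 hd =>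
    ⟨NoisyIQP.samplingProb_sampler hn hk h0 hd,
      (NoisyIQP.expectedTime_sampler_le hn hk h0 hd).trans (le_of_eq ?_)⟩⟩
  rw [← ENNReal.ofReal_natCast]
  push_cast
  rfl
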